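/- Let $g\ge 0$, $n>0$ be integers, $\mu,\nu$ partitions of $n$ with $\ell(\mu),\ell(\nu)$ parts, and $b=g-1+\ell(\mu)+\ell(\nu)$ (so $b>0$). Write $2\mu$ for the partition of $2n$ in which each part of $\mu$ is repeated twice. **Twisted factorisations.** Let $\tau=(1\ n{+}1)(2\ n{+}2)\cdots(n\ 2n)\in\mathbb S_{2n}$. Let $B^\sim_\mu$ be the set of $\sigma\in\mathbb S_{2n}$ of cycle type $2\mu$ such that $\tau\sigma\tau=\sigma^{-1}$ and no cycle $c$ of $\sigma$ satisfies $\tau c\tau=c^{-1}$. Let $C_g(\mu,\nu)$ be the set of tuples $(\sigma_1,\eta_1,\dots,\eta_b,\sigma_2)$ in $\mathbb S_{2n}$ such that $\sigma_1\in B^\sim_\mu$, $\sigma_2$ has cycle type $2\nu$, the $\eta_i$ are transpositions with $\eta_i\ne\tau\eta_i\tau$, $\eta_b\cdots\eta_1\sigma_1(\tau\eta_1\tau)\cdots(\tau\eta_b\tau)=\sigma_2$, and $\sigma_1,\sigma_2$, all $\eta_i$ and all $\tau\eta_i\tau$ generate a group that is transitive on $\{1,\dots,2n\}$. **Twisted tropical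 covers.** A twisted tropical cover $(\pi,\iota)$ of type $(g,\mu,\nu)$ with branch points $p_1<\dots<p_b$ in $\mathbb R$ consists of a finite connected metric graph $\Gamma$ (the edges adjacent to $1$-valent vertices, called ends, have infinite length; the other edges, called internal, have finite positive length), a surjective map $\pi\colon\Gamma\to\mathbb R$ that is linear on each edge $e$ with integer slope $\omega(e)\ge 0$, the weight of $e$, and an isometric involution $\iota$ of the graph $\Gamma$ with $\pi\circ\iota=\pi$, such that: leaves lie over $\pm\infty$ and all other vertices over branch points; at every vertex that is not a leaf the sum of the weights of the edges leaving to the left equals the sum of the weights of the edges leaving to the right; the weights of the ends over $-\infty$ (respectively $+\infty$) are the parts of $2\mu$ (respectively $2\nu$), in pairs exchanged by $\iota$; the vertices over each $p_i$ are either two $3$-valent vertices or one $4$-valent vertex; the edges adjacent to a $4$-valent vertex all have the same weight; and the fixed locus of $\iota$ is exactly the set of $4$-valent vertices. There are no $2$-valent vertices: an edge may pass over several branch points. Isomorphisms of such covers are isomorphisms of metric graphs compatible with the maps to $\mathbb R$ and with the involutions; $\mathrm{Aut}(\pi)$ is the group of automorphisms in this sense. $\Gamma/\iota$ denotes the quotient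 graph, whose edges inherit lengths and weights from $\Gamma$. **The cover of a factorisation.** Given $(\sigma_1,\eta_1,\dots,\eta_b,\sigma_2)\in C_g(\mu,\nu)$ and $p_1<\dots<p_b$, put $p_0=-\infty$, $p_{b+1}=+\infty$ and $\sigma^{(m)}=\eta_m\cdots\eta_1\sigma_1(\tau\eta_1\tau)\cdots(\tau\eta_m\tau)$. Over $[p_m,p_{m+1}]$ take one strand for each cycle of $\sigma^{(m)}$ (fixed points included). A cycle of $\sigma^{(m-1)}$ that contains no point moved by $\eta_m$ or $\tau\eta_m\tau$ is also a cycle of $\sigma^{(m)}$, and its strand is continued over $p_m$ without a vertex. The other cycles of $\sigma^{(m-1)}$ and $\sigma^{(m)}$ are attached to vertices over $p_m$: either two pairs of cycles are joined (two vertices, one for each pair and the cycle obtained from it), or two cycles are each cut in two (two vertices, one for each cycle that is cut), or two cycles of equal length, exchanged by $\tau$, are rearranged into two cycles of the same length (one $4$-valent vertex). The strands over $p_0$ and $p_{b+1}$ end in leaves. The weight of an edge is the length of its cycle, bounded edges have the length of their image divided by their weight, and $\iota$ is induced by conjugation with $\tau$. **Proposition.** Let $(\pi\colon\Gamma\to\mathbb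 R,\iota)$ be a twisted tropical cover of type $(g,\mu,\nu)$ with branch points $p_1<\dots<p_b$. The number of tuples in $C_g(\mu,\nu)$ whose associated cover with branch points $p_1,\dots,p_b$ is isomorphic to $(\pi,\iota)$ equals $$(2n)!!\cdot 2^{b}\cdot\prod_V(\omega_V-1)\cdot\prod_e\omega(e)\cdot\frac1{|\mathrm{Aut}(\pi)|},$$ where the first product runs over all $4$-valent vertices $V$ of $\Gamma$, $\omega_V$ being the common weight of the edges adjacent to $V$, and the second product runs over all internal edges $e$ of $\Gamma/\iota$. -/

import Mathlib

open scoped ENNReal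

universe u v u' v'

set_option linter.checkUnivs false

noncomputable section

/-! ### Metric graphs, tropical covers of the line, twisted tropical covers -/

/-- A finite multigraph (loops and multiple edges allowed) with edge lengths in `[0,∞]`. -/
structure MetricGraph where
  V : Type u
  E : Type v
  [fintypeV : Fintype V]
  [fintypeE : Fintype E]
  /-- the two end vertices of an edge -/
  ends : E → Sym2 V
  length : E → ℝ≥0∞

attribute [instance] MetricGraph.fintypeV MetricGraph.fintypeE

namespace MetricGraph

open Classical in
/-- The valence of a vertex (a loop counts twice). -/
def valence (Γ : MetricGraph.{u, v}) (x : Γ.V) : ℕ :=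
  ∑ e : Γ.E, if x ∈ Γ.ends e then (if (Γ.ends e).IsDiag then 2 else 1) else 0

/-- Leaves are the `1`-valent vertices. -/
def IsLeaf (Γ : MetricGraph.{u, v}) (x : Γ.V) : Prop := Γ.valence x = 1

/-- Ends are the edges adjacent to a leaf; the other edges are internal. -/
def IsEnd (Γ : MetricGraph.{u, v}) (e : Γ.E) : Prop := ∃ x ∈ Γ.ends e, Γ.IsLeaf x

/-- Two vertices are adjacent if some edge joins them. -/
def Adj (Γ : MetricGraph.{u, v}) (x y : Γ.V) : Prop := ∃ e, Γ.ends e = s(x, y)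

/-- An abstract (explicit) tropical curve: a connected graph whose edges have positive length,
the edges of infinite length being exactly the ends. -/
structure IsTropicalCurve (Γ : MetricGraph.{u, v}) : Prop where
  nonempty : Nonempty Γ.V
  connected : ∀ x y : Γ.V, Relation.ReflTransGen Γ.Adj x y
  length_pos : ∀ e, 0 < Γ.length e
  length_eq_top : ∀ e, Γ.length e = ⊤ ↔ Γ.IsEnd e

end MetricGraph

/-- The data (without axioms) of a map `π` from a metric graph to the line together with a
self-map `ι` of the graph.  `pos` is `π` on vertices, where the leaves may be sent to `±∞`;
on an edge `e` the map `π` is linear with slope `weight e` (the weight `ω(e)`). -/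
structure CoverData extends MetricGraph.{u, v} where
  pos : V → EReal
  weight : E → ℕ
  invV : V → V
  invE : E → E

namespace CoverData

open Classical in
/-- Sum of the weights of the edges leaving `x` to the left. -/
def leftDegree (D : CoverData.{u, v}) (x : D.V) : ℕ :=
  ∑ e : D.E with ∃ y, D.ends e = s(y, x) ∧ D.pos y < D.pos x, D.weight e

open Classical in
/-- Sum of the weights of the edges leaving `x` to the right. -/
def rightDegree (D : CoverData.{u, v}) (x : D.V) : ℕ :=
  ∑ e : D.E with ∃ y, D.ends e = s(x, y) ∧ D.pos x < D.pos y, D.weight e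

/-- `π` is a tropical cover of `ℝ` subdivided at the points `p 0, …, p (b - 1)`: a surjective
harmonic map from an abstract tropical curve.  The leaves lie over `±∞` and the other vertices
over the points `p i`.  A point of the interior of an edge that lies over some `p i` is not
counted as a vertex, so an edge may pass over several of the `p i`. -/
structure IsTropicalCover (D : CoverData.{u, v}) {b : ℕ} (p : Fin b → ℝ) : Prop where
  curve : D.toMetricGraph.IsTropicalCurve
  pos_leaf : ∀ x, D.IsLeaf x → D.pos x = ⊥ ∨ D.pos x = ⊤
  pos_inner : ∀ x, ¬ D.IsLeaf x → ∃ i, D.pos x = (p i : EReal)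
  /-- `e` is mapped linearly with slope `ω(e)` onto the segment between the images of its ends;
  the slope is `0` exactly for contracted edges. -/
  linear : ∀ e x y, D.ends e = s(x, y) → D.pos x ≤ D.pos y →
    D.pos y - D.pos x = (((D.weight e : ℝ≥0∞) * D.length e : ℝ≥0∞) : EReal)
  balanced : ∀ x, ¬ D.IsLeaf x → D.leftDegree x = D.rightDegree x
  surjective : ∀ r : ℝ, ∃ e x y, D.ends e = s(x, y) ∧ D.pos x ≤ r ∧ (r : EReal) ≤ D.pos y

/-- `ι` is an involution of the metric graph that respects `π`. -/
structure IsInvolution (D : CoverData.{u, v}) : Prop where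
  invV_invV : ∀ x, D.invV (D.invV x) = x
  invE_invE : ∀ e, D.invE (D.invE e) = e
  ends : ∀ e, D.ends (D.invE e) = (D.ends e).map D.invV
  length : ∀ e, D.length (D.invE e) = D.length e
  pos : ∀ x, D.pos (D.invV x) = D.pos x
  weight : ∀ e, D.weight (D.invE e) = D.weight e

open Classical in
/-- The multiset of the weights of the ends over `-∞`. -/
def leftWeights (D : CoverData.{u, v}) : Multiset ℕ :=
  (Finset.univ.filter fun e : D.E => ∃ x ∈ D.ends e, D.pos x = ⊥).val.map D.weight

open Classical in
/-- The multiset of the weights of the ends over `+∞`. -/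
def rightWeights (D : CoverData.{u, v}) : Multiset ℕ :=
  (Finset.univ.filter fun e : D.E => ∃ x ∈ D.ends e, D.pos x = ⊤).val.map D.weight

/-- `(π, ι)` is a twisted tropical cover of type `(g, μ, ν)` with branch points `p`. -/
structure IsTwistedTropicalCover (D : CoverData.{u, v}) {n b : ℕ} (g : ℕ) (μ ν : n.Partition)
    (p : Fin b → ℝ) : Prop where
  branch_strictMono : StrictMono p
  branch_card : 2 * (b : ℤ) = 2 * g - 2 + 2 * μ.parts.card + 2 * ν.parts.card
  cover : D.IsTropicalCover p
  involution : D.IsInvolution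
  /-- the ends over `-∞` come in pairs with weights `μ₁, μ₂, …` -/
  left_ends : D.leftWeights = μ.parts + μ.parts
  /-- the ends over `+∞` come in pairs with weights `ν₁, ν₂, …` -/
  right_ends : D.rightWeights = ν.parts + ν.parts
  /-- over each branch point there are two `3`-valent vertices or one `4`-valent vertex -/
  fibre : ∀ i, ({x | D.pos x = (p i : EReal)}.ncard = 2 ∧
        ∀ x, D.pos x = (p i : EReal) → D.valence x = 3) ∨
      ({x | D.pos x = (p i : EReal)}.ncard = 1 ∧
        ∀ x, D.pos x = (p i : EReal) → D.valence x = 4)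
  four_valent : ∀ x, D.valence x = 4 → ∀ e e', x ∈ D.ends e → x ∈ D.ends e' →
    D.weight e = D.weight e'
  /-- The fixed locus of `ι` is the set of `4`-valent vertices.  An edge mapped to itself would
  contain a fixed point in its interior (it is fixed pointwise or flipped). -/
  fixed_vertex : ∀ x, D.invV x = x ↔ D.valence x = 4
  fixed_edge : ∀ e, D.invE e ≠ e

/-- An isomorphism of metric graphs that respects the maps to the line and the involutions. -/
@[ext]
structure Iso (D : CoverData.{u, v}) (D' : CoverData.{u', v'}) where
  onV : D.V ≃ D'.V
  onE : D.E ≃ D'.E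
  ends : ∀ e, D'.ends (onE e) = (D.ends e).map onV
  length : ∀ e, D'.length (onE e) = D.length e
  pos : ∀ x, D'.pos (onV x) = D.pos x
  weight : ∀ e, D'.weight (onE e) = D.weight e
  invV : ∀ x, D'.invV (onV x) = onV (D.invV x)
  invE : ∀ e, D'.invE (onE e) = onE (D.invE e)

/-- The automorphisms of `π` (compatible with `ι`). -/
abbrev Aut (D : CoverData.{u, v}) := Iso D D

/-- The edges of the quotient graph `Γ/ι`. -/
def QuotEdge (D : CoverData.{u, v}) := Quot fun e e' : D.E => D.invE e = e'

instance (D : CoverData.{u, v}) : Finite D.QuotEdge :=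
  inferInstanceAs (Finite (Quot fun e e' : D.E => D.invE e = e'))

instance (D : CoverData.{u, v}) : Fintype D.QuotEdge := Fintype.ofFinite _

/-- The length of an edge of `Γ/ι`. -/
def quotLength {D : CoverData.{u, v}} (h : D.IsInvolution) : D.QuotEdge → ℝ≥0∞ :=
  Quot.lift D.length (by rintro e _ rfl; exact (h.length e).symm)

/-- The weight of an edge of `Γ/ι`. -/
def quotWeight {D : CoverData.{u, v}} (h : D.IsInvolution) : D.QuotEdge → ℕ :=
  Quot.lift D.weight (by rintro e _ rfl; exact (h.weight e).symm)

open Classical in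
/-- The common weight `ω_V` of the edges adjacent to a `4`-valent vertex `x` (written as a
maximum, which is the common value if all these weights agree). -/
def vertexWeight (D : CoverData.{u, v}) (x : D.V) : ℕ :=
  (Finset.univ.filter fun e : D.E => x ∈ D.ends e).sup D.weight

end CoverData

/-! ### Twisted factorisations in the symmetric group -/

/-- The set `{1, …, 2n}`; `inl i` stands for `i` and `inr i` for `n + i`. -/
abbrev Pts (n : ℕ) := Fin n ⊕ Fin n

/-- The involution `τ = (1 n+1)(2 n+2)⋯(n 2n)`. -/
def tau (n : ℕ) : Equiv.Perm (Pts n) := Equiv.sumComm (Fin n) (Fin n)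

/-- The set `C^∼(τ)` of the `σ` with `τ σ τ = σ⁻¹`. -/
def CTilde (n : ℕ) : Set (Equiv.Perm (Pts n)) := {σ | tau n * σ * tau n = σ⁻¹}

/-- The set `B^∼_n` of the elements of `C^∼(τ)` without self-symmetric cycles, i.e. cycles `c`
with `τ c τ = c⁻¹`.  (A fixed point `x` is never a self-symmetric cycle, since `τ x ≠ x`.) -/
def BTilde (n : ℕ) : Set (Equiv.Perm (Pts n)) :=
  {σ ∈ CTilde n | ∀ c ∈ σ.cycleFactorsFinset, tau n * c * tau n ≠ c⁻¹}

/-- The set `B^∼_μ`; the cycle type records fixed points too and is `μ` with each part doubled. -/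
def BTildePart {n : ℕ} (μ : n.Partition) : Set (Equiv.Perm (Pts n)) :=
  {σ ∈ BTilde n | σ.partition.parts = μ.parts + μ.parts}

/-- A tuple `(σ₁, η₁, …, η_b, σ₂)` of permutations of `{1, …, 2n}`. -/
@[ext]
structure PermTuple (n b : ℕ) where
  σ₁ : Equiv.Perm (Pts n)
  η : Fin b → Equiv.Perm (Pts n)
  σ₂ : Equiv.Perm (Pts n)

namespace PermTuple

variable {n b : ℕ}

/-- `η_l` for `1 ≤ l ≤ b`, and the identity for all other `l`. -/
def etaAt (t : PermTuple n b) : ℕ → Equiv.Perm (Pts n)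
  | 0 => 1
  | l + 1 => if h : l < b then t.η ⟨l, h⟩ else 1

/-- The permutation `η_m ⋯ η_1 σ₁ (τ η_1 τ) ⋯ (τ η_m τ)`. -/
def perm (t : PermTuple n b) : ℕ → Equiv.Perm (Pts n)
  | 0 => t.σ₁
  | m + 1 => t.etaAt (m + 1) * t.perm m * (tau n * t.etaAt (m + 1) * tau n)

end PermTuple

/-- The set `C_g(μ, ν)` of twisted factorisations, where `b` is the number of transpositions. -/
structure IsTwistedFactorisation {n b : ℕ} (g : ℕ) (μ ν : n.Partition) (t : PermTuple n b) :
    Prop where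
  b_eq : 2 * (b : ℤ) = 2 * g - 2 + 2 * μ.parts.card + 2 * ν.parts.card
  b_pos : 0 < b
  type_σ₁ : t.σ₁.partition.parts = μ.parts + μ.parts
  type_σ₂ : t.σ₂.partition.parts = ν.parts + ν.parts
  isSwap : ∀ i, (t.η i).IsSwap
  ne_conj : ∀ i, t.η i ≠ tau n * t.η i * tau n
  mem_BTilde : t.σ₁ ∈ BTildePart μ
  prod_eq : t.perm b = t.σ₂
  transitive : MulAction.IsPretransitive
    (Subgroup.closure ({t.σ₁, t.σ₂} ∪ Set.range t.η ∪
      Set.range fun i => tau n * t.η i * tau n)) (Pts n)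

/-! ### The twisted cover associated with a twisted factorisation

The line has the nodes `0, 1, …, b + 1`: node `0` is `-∞`, node `l` with `1 ≤ l ≤ b` is the branch
point `p_l`, node `b + 1` is `+∞`.  The sheets over the interval between the nodes `m` and `m + 1`
are the cycles of `perm m`, and cycles are recorded by the sets of their elements. -/

namespace PermTuple

variable {n b : ℕ}

/-- The set `c` is (the set of elements of) a cycle of `σ`, possibly a fixed point. -/
def IsCycleSet (σ : Equiv.Perm (Pts n)) (c : Set (Pts n)) : Prop :=
  ∃ x, c = {y | σ.SameCycle x y}

/-- The multiplication by `η_l` and `τ η_l τ` affects the cycle (or union of cycles) `c`. -/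
def Touched (t : PermTuple n b) (l : ℕ) (c : Set (Pts n)) : Prop :=
  ∃ x ∈ c, t.etaAt l x ≠ x ∨ (tau n * t.etaAt l * tau n) x ≠ x

/-- The group generated by `perm l`, `η_l` and `τ η_l τ`; for `1 ≤ l ≤ b` it contains
`perm (l - 1)`, and for `l = 0` and `l = b + 1` it is generated by `σ₁` and by `perm b`. -/
def nodeGroup (t : PermTuple n b) (l : ℕ) : Subgroup (Equiv.Perm (Pts n)) :=
  Subgroup.closure {t.perm l, t.etaAt l, tau n * t.etaAt l * tau n}

/-- The vertices over the node `l`, encoded as sets of points.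
For `1 ≤ l ≤ b` they are the orbits of `⟨perm (l - 1), η_l, τ η_l τ⟩` met by the supports of `η_l`
and `τ η_l τ`: two cycles of `perm (l - 1)` belong to the same vertex iff they are linked by
`η_l` or `τ η_l τ`.  So we get two vertices, the joined cycles, in case of a join; two vertices, the
cycles that are split, in case of a cut; and one vertex, the union of the two cycles that are
rearranged, in the third case.  For `l = 0` and `l = b + 1` they are the leaves, one for each cycle
of `σ₁` and of `perm b`. -/
def IsVertex (t : PermTuple n b) (l : ℕ) (d : Set (Pts n)) : Prop :=
  (∃ x, d = MulAction.orbit (t.nodeGroup l) x) ∧ (l = 0 ∨ l = b + 1 ∨ t.Touched l d)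

/-- There is an edge over the interval from node `k` to node `l` labelled by the cycle `c`: it
starts at `-∞` or at a branch point that affects it, ends at `+∞` or at a branch point that affects
it, and is extended over all branch points in between. -/
def IsEdge (t : PermTuple n b) (k l : ℕ) (c : Set (Pts n)) : Prop :=
  k < l ∧ (∀ m, k ≤ m → m < l → IsCycleSet (t.perm m) c) ∧
    (k = 0 ∨ t.Touched k c) ∧ (l = b + 1 ∨ t.Touched l c) ∧
    ∀ m, k < m → m < l → ¬ t.Touched m c

/-- The union of the orbits at the node `l` that meet `c`.  For an edge labelled by `c` with an
end point over the node `l` this is the vertex at that end point. -/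
def nodeOf (t : PermTuple n b) (l : ℕ) (c : Set (Pts n)) : Set (Pts n) :=
  {y | ∃ x ∈ c, y ∈ MulAction.orbit (t.nodeGroup l) x}

/-- The position of the node `l` on the line. -/
def nodePos (p : Fin b → ℝ) : ℕ → EReal
  | 0 => ⊥
  | l + 1 => if h : l < b then (p ⟨l, h⟩ : EReal) else ⊤

theorem perm_mem_nodeGroup (t : PermTuple n b) (l : ℕ) : t.perm l ∈ t.nodeGroup l :=
  Subgroup.subset_closure (by simp)

theorem perm_mem_nodeGroup_succ (t : PermTuple n b) (l : ℕ) :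
    t.perm l ∈ t.nodeGroup (l + 1) := by
  have h1 : t.perm (l + 1) ∈ t.nodeGroup (l + 1) := t.perm_mem_nodeGroup (l + 1)
  have h2 : t.etaAt (l + 1) ∈ t.nodeGroup (l + 1) := Subgroup.subset_closure (by simp)
  have h3 : tau n * t.etaAt (l + 1) * tau n ∈ t.nodeGroup (l + 1) :=
    Subgroup.subset_closure (by simp)
  have h4 : t.perm l = (t.etaAt (l + 1))⁻¹ * t.perm (l + 1) *
      (tau n * t.etaAt (l + 1) * tau n)⁻¹ := by
    rw [perm]; group
  rw [h4]
  exact mul_mem (mul_mem (inv_mem h2) h1) (inv_mem h3)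

theorem nodeOf_eq_orbit (t : PermTuple n b) {l : ℕ} {σ : Equiv.Perm (Pts n)} {x : Pts n}
    (hσ : σ ∈ t.nodeGroup l) :
    t.nodeOf l {y | σ.SameCycle x y} = MulAction.orbit (t.nodeGroup l) x := by
  ext y
  constructor
  · rintro ⟨z, ⟨i, hz⟩, hy⟩
    have : MulAction.orbit (t.nodeGroup l) z = MulAction.orbit (t.nodeGroup l) x := by
      rw [MulAction.orbit_eq_iff]
      exact ⟨⟨σ ^ i, zpow_mem hσ i⟩, hz⟩
    rwa [this] at hy
  · intro hy
    exact ⟨x, Equiv.Perm.SameCycle.refl σ x, hy⟩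

theorem subset_nodeOf (t : PermTuple n b) (l : ℕ) (c : Set (Pts n)) : c ⊆ t.nodeOf l c :=
  fun x hx => ⟨x, hx, MulAction.mem_orbit_self x⟩

theorem Touched.mono {t : PermTuple n b} {l : ℕ} {c d : Set (Pts n)} (h : t.Touched l c)
    (hcd : c ⊆ d) : t.Touched l d := by
  obtain ⟨x, hx, h⟩ := h
  exact ⟨x, hcd hx, h⟩

theorem IsEdge.isVertex_left {t : PermTuple n b} {k l : ℕ} {c : Set (Pts n)}
    (h : t.IsEdge k l c) : t.IsVertex k (t.nodeOf k c) := by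
  obtain ⟨hkl, hc, hk, -, -⟩ := h
  refine ⟨?_, hk.imp_right fun hk => Or.inr (hk.mono (t.subset_nodeOf k c))⟩
  obtain ⟨x, rfl⟩ := hc k le_rfl hkl
  exact ⟨x, t.nodeOf_eq_orbit (t.perm_mem_nodeGroup k)⟩

theorem IsEdge.isVertex_right {t : PermTuple n b} {k l : ℕ} {c : Set (Pts n)}
    (h : t.IsEdge k l c) : t.IsVertex l (t.nodeOf l c) := by
  obtain ⟨hkl, hc, -, hl, -⟩ := h
  refine ⟨?_, Or.inr (hl.imp_right fun hl => hl.mono (t.subset_nodeOf l c))⟩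
  obtain ⟨m, rfl⟩ : ∃ m, l = m + 1 := ⟨l - 1, by omega⟩
  obtain ⟨x, rfl⟩ := hc m (by omega) (by omega)
  exact ⟨x, t.nodeOf_eq_orbit (t.perm_mem_nodeGroup_succ m)⟩

end PermTuple

theorem tau_mul_tau (n : ℕ) : tau n * tau n = 1 := by
  ext x; cases x <;> rfl

theorem tau_tau (n : ℕ) (x : Pts n) : tau n (tau n x) = x := by
  cases x <;> rfl

namespace IsTwistedFactorisation

open PermTuple

variable {n b g : ℕ} {μ ν : n.Partition} {t : PermTuple n b}

theorem etaAt_mul_self (h : IsTwistedFactorisation g μ ν t) (l : ℕ) :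
    t.etaAt l * t.etaAt l = 1 := by
  cases l with
  | zero => simp [etaAt]
  | succ l =>
    by_cases hl : l < b
    · obtain ⟨x, y, -, hxy⟩ := h.isSwap ⟨l, hl⟩
      simp [etaAt, hl, hxy]
    · simp [etaAt, hl]

theorem tau_perm_tau (h : IsTwistedFactorisation g μ ν t) (m : ℕ) :
    tau n * t.perm m * tau n = (t.perm m)⁻¹ := by
  have hτ := tau_mul_tau n
  have hτ' : (tau n)⁻¹ = tau n := inv_eq_of_mul_eq_one_left hτ
  induction m with
  | zero => exact h.mem_BTilde.1.1
  | succ m ih =>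
    have hη := h.etaAt_mul_self (m + 1)
    have hη' : (t.etaAt (m + 1))⁻¹ = t.etaAt (m + 1) := inv_eq_of_mul_eq_one_left hη
    have hττ : ∀ x, tau n * (tau n * x) = x := fun x => by rw [← mul_assoc, hτ, one_mul]
    rw [perm]
    simp only [mul_inv_rev, ← ih, hτ', hη', mul_assoc, hτ, mul_one, hττ]

theorem tau_conj_mem_nodeGroup (h : IsTwistedFactorisation g μ ν t) (l : ℕ)
    {γ : Equiv.Perm (Pts n)} (hγ : γ ∈ t.nodeGroup l) :
    tau n * γ * tau n ∈ t.nodeGroup l := by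
  have hτ := tau_mul_tau n
  have hτ' : (tau n)⁻¹ = tau n := inv_eq_of_mul_eq_one_left hτ
  have key : t.nodeGroup l ≤ (t.nodeGroup l).comap (MulAut.conj (tau n)).toMonoidHom := by
    rw [nodeGroup, Subgroup.closure_le]
    rintro γ (rfl | rfl | rfl)
    · simp only [SetLike.mem_coe, Subgroup.mem_comap, MulEquiv.coe_toMonoidHom,
        MulAut.conj_apply, hτ', h.tau_perm_tau]
      exact inv_mem (t.perm_mem_nodeGroup l)
    · simp only [SetLike.mem_coe, Subgroup.mem_comap, MulEquiv.coe_toMonoidHom,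
        MulAut.conj_apply, hτ']
      exact Subgroup.subset_closure (by simp)
    · simp only [SetLike.mem_coe, Subgroup.mem_comap, MulEquiv.coe_toMonoidHom,
        MulAut.conj_apply, hτ']
      have : tau n * (tau n * t.etaAt l * tau n) * tau n = t.etaAt l := by
        simp only [mul_assoc, hτ, mul_one]
        rw [← mul_assoc, hτ, one_mul]
      rw [this]
      exact Subgroup.subset_closure (by simp)
  have := key hγ
  simpa [hτ'] using this

theorem isCycleSet_tau (h : IsTwistedFactorisation g μ ν t) {m : ℕ} {c : Set (Pts n)}
    (hc : IsCycleSet (t.perm m) c) : IsCycleSet (t.perm m) (tau n '' c) := by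
  have hτ' : (tau n)⁻¹ = tau n := inv_eq_of_mul_eq_one_left (tau_mul_tau n)
  have key : ∀ x y, (t.perm m).SameCycle x y → (t.perm m).SameCycle (tau n x) (tau n y) := by
    intro x y hxy
    have h1 := h.tau_perm_tau m
    rw [← Equiv.Perm.sameCycle_inv, ← h1]
    have h2 := Equiv.Perm.sameCycle_conj (f := t.perm m) (g := tau n) (x := tau n x) (y := tau n y)
    rw [hτ', tau_tau, tau_tau] at h2
    exact h2.2 hxy
  obtain ⟨x, rfl⟩ := hc
  refine ⟨tau n x, ?_⟩
  ext y
  constructor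
  · rintro ⟨z, hz, rfl⟩
    exact key x z hz
  · intro hy
    refine ⟨tau n y, ?_, tau_tau n y⟩
    have := key _ _ hy
    rwa [tau_tau] at this

theorem touched_tau {l : ℕ} {c : Set (Pts n)}
    (hc : t.Touched l c) : t.Touched l (tau n '' c) := by
  obtain ⟨x, hx, h1⟩ := hc
  refine ⟨tau n x, ⟨x, hx, rfl⟩, ?_⟩
  rcases h1 with h1 | h1
  · right
    simpa [tau_tau] using h1
  · left
    intro h2
    apply h1
    simp [h2, tau_tau]

theorem tau_image_tau_image (c : Set (Pts n)) : tau n '' (tau n '' c) = c := by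
  rw [Set.image_image]
  simp [tau_tau]

theorem isVertex_tau (h : IsTwistedFactorisation g μ ν t) {l : ℕ} {d : Set (Pts n)}
    (hd : t.IsVertex l d) : t.IsVertex l (tau n '' d) := by
  obtain ⟨⟨x, rfl⟩, hl⟩ := hd
  refine ⟨⟨tau n x, ?_⟩, hl.imp_right fun hl => hl.imp_right touched_tau⟩
  have key : ∀ x y, y ∈ MulAction.orbit (t.nodeGroup l) x →
      tau n y ∈ MulAction.orbit (t.nodeGroup l) (tau n x) := by
    rintro x _ ⟨⟨γ, hγ⟩, rfl⟩
    refine ⟨⟨_, h.tau_conj_mem_nodeGroup l hγ⟩, ?_⟩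
    change (tau n * γ * tau n) (tau n x) = tau n (γ x)
    simp [tau_tau]
  ext y
  constructor
  · rintro ⟨z, hz, rfl⟩
    exact key x z hz
  · intro hy
    refine ⟨tau n y, ?_, tau_tau n y⟩
    have := key _ _ hy
    rwa [tau_tau] at this

theorem isEdge_tau (h : IsTwistedFactorisation g μ ν t) {k l : ℕ} {c : Set (Pts n)}
    (hc : t.IsEdge k l c) : t.IsEdge k l (tau n '' c) := by
  obtain ⟨h1, h2, h3, h4, h5⟩ := hc
  refine ⟨h1, fun m hm hm' => h.isCycleSet_tau (h2 m hm hm'), h3.imp_right touched_tau,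
    h4.imp_right touched_tau, fun m hm hm' hT => h5 m hm hm' ?_⟩
  have := touched_tau hT
  rwa [tau_image_tau_image] at this

open Classical in
/-- The cover `π` with involution `ι` constructed from a twisted factorisation and from the branch
points `p`.  The weight of an edge is the length of the cycle labelling it, the length of an edge
is the length of its image divided by its weight, and `ι` is induced by conjugation with `τ`. -/
def toCover (h : IsTwistedFactorisation g μ ν t) (p : Fin b → ℝ) : CoverData.{0, 0} where
  V := {x : Fin (b + 2) × Set (Pts n) // t.IsVertex x.1 x.2}
  E := {e : Fin (b + 2) × Fin (b + 2) × Set (Pts n) // t.IsEdge e.1 e.2.1 e.2.2}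
  ends e := s(⟨(e.1.1, t.nodeOf e.1.1 e.1.2.2), e.2.isVertex_left⟩,
    ⟨(e.1.2.1, t.nodeOf e.1.2.1 e.1.2.2), e.2.isVertex_right⟩)
  length e := (nodePos p e.1.2.1 - nodePos p e.1.1).toENNReal / (e.1.2.2.ncard : ℝ≥0∞)
  pos x := nodePos p x.1.1
  weight e := e.1.2.2.ncard
  invV x := ⟨(x.1.1, tau n '' x.1.2), h.isVertex_tau x.2⟩
  invE e := ⟨(e.1.1, e.1.2.1, tau n '' e.1.2.2), h.isEdge_tau e.2⟩

end IsTwistedFactorisation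

end

/-! The proof counts factorisations together with an identification of their cover with `D`. Such a
pair amounts to labelling, over every interval between consecutive nodes of the line, the cycles of
the intermediate permutation by the edges of `D` over that interval, compatibly with `τ` and `ι`,
with lengths and weights, and with the incidences at the vertices. This is `bijective_pathOf`: pairs
of a factorisation and an isomorphism from its cover to `D` correspond to sequences of labelled
permutations (`IsPath`). For a fixed factorisation whose cover is isomorphic to `D`, these
isomorphisms are in bijection with the automorphisms of `D`. Hence the required number, multiplied
by the order of the automorphism group, is the number of paths (`ncard_mul_card_aut`).

Paths are counted one branch point at a time (`card_paths`), starting from the number of labelled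
permutations over the first interval. A labelled permutation with a base point on every cycle,
chosen compatibly with `τ`, is the same as an equivariant bijection from a standard model to the
points. These bijections form a torsor under the centralizer of `τ`, which has order `(2n)!!`. The
base points can be chosen in as many ways as the product of the weights over the pairs of labels
exchanged by `ι`. So the number of labelled permutations is `(2n)!!` divided by this product
(`card_isLabelled`).

The centralizer also acts transitively on the labelled permutations with a given label set, so the
number of continuations at a branch point does not depend on the state. If edges of weights `w₁`,
`w₂` are joined, there are `2 w₁ w₂` continuations: a point on each of the two cycles, or on each of
their images under `τ`. A cut is a join read backwards. Double counting with the numbers of labelled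
permutations on the two sides gives twice the weight of the edge that is cut. At a `4`-valent vertex
of weight `w` there are `2 w (w - 1)` continuations: a point `x` of one cycle, a point `y ≠ τ x` of
the other, and the choice of the outgoing edge that receives the new cycle of `x`. In all cases the
number is `2` times the weights of the incoming pairs of edges, times `ω_V - 1` if there is a
`4`-valent vertex `V`.

In the product over all branch points every pair of edges that ends at a branch point contributes
its weight once. As no edge runs from `-∞` to `+∞`, the weights of the edges from `-∞` all occur and
cancel the denominator of the initial count. What remains are the weights of the internal edges of
`Γ/ι` (`card_isPath`). -/

section

/-! ### Cycles of a permutation multiplied by a transposition -/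

namespace Equiv.Perm

variable {α : Type*}

/-- An equivalence relation that is respected by a permutation is coarser than its cycles. -/
theorem SameCycle.of_equivalence [Finite α] {σ : Perm α} {r : α → α → Prop} (hr : Equivalence r)
    (h : ∀ a, r a (σ a)) {a b : α} (hab : σ.SameCycle a b) : r a b := by
  obtain ⟨i, -, rfl⟩ := hab.exists_pow_eq'
  induction i with
  | zero => exact hr.refl a
  | succ i ih => 
    rw [pow_succ', mul_apply]
    exact hr.trans (ih ⟨i, by simp⟩) (h _)

theorem SameCycle.of_forall [Finite α] {σ σ' : Perm α} (h : ∀ a, σ'.SameCycle a (σ a)) {a b : α}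
    (hab : σ.SameCycle a b) : σ'.SameCycle a b :=
  hab.of_equivalence (SameCycle.equivalence σ') h

/-- A set preserved by a permutation contains every cycle that it meets. -/
theorem SameCycle.mem_of_mapsTo [Finite α] {σ : Perm α} {s : Set α} (h : ∀ a ∈ s, σ a ∈ s)
    {a b : α} (hab : σ.SameCycle a b) (ha : a ∈ s) : b ∈ s := by
  obtain ⟨i, -, rfl⟩ := hab.exists_pow_eq'
  clear hab
  induction i with
  | zero => exact ha
  | succ i ih => 
    rw [pow_succ', mul_apply]
    exact h _ ih

/-- A permutation inverted by a fixed point free involution `τ` has no cycle preserved by `τ` if its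
product with `τ` has no fixed point. -/
theorem not_sameCycle_apply_of_conj_eq_inv {σ τ : Perm α} (hτ : τ * τ = 1) (hfix : ∀ x, τ x ≠ x)
    (hconj : τ * σ * τ = σ⁻¹) (hfix' : ∀ x, σ (τ x) ≠ x) (z : α) : ¬ σ.SameCycle z (τ z) := by
  have hττ : ∀ x, τ (τ x) = x := fun x => by rw [← mul_apply, hτ, one_apply]
  have hτ' : τ⁻¹ = τ := inv_eq_of_mul_eq_one_left hτ
  have hpow : ∀ (k : ℤ) (x : α), τ ((σ ^ k) x) = (σ ^ (-k)) (τ x) := by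
    intro k x
    have h1 : τ * σ ^ k * τ⁻¹ = σ ^ (-k) := by
      rw [← conj_zpow, hτ', hconj, inv_zpow, zpow_neg]
    rw [← h1, hτ']
    simp [hττ]
  rintro ⟨k, hk⟩
  -- On the arc from `z` to `τ z` along `σ`, the midpoint is fixed by `τ` if the length is even; if
  -- it is odd, the point just after the middle is fixed by `σ τ`.
  obtain ⟨j, rfl | rfl⟩ := k.even_or_odd'
  · apply hfix ((σ ^ j) z)
    rw [hpow, ← hk, ← mul_apply, ← zpow_add]
    congr 2; ring
  · apply hfix' ((σ ^ (j + 1)) z)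
    rw [hpow, ← hk, ← mul_apply, ← mul_apply, ← zpow_one_add, ← zpow_add]
    congr 2; ring

variable [DecidableEq α]

/-- The product sends `y` to `σ x` and then follows `σ` as long as neither `x` nor `y` is met. The
point `y` is not on the `σ`-cycle of `x`, so the walk runs through this cycle until it reaches `x`.
-/
theorem sameCycle_mul_swap_self [Finite α] {σ : Perm α} {x y : α} (h : ¬ σ.SameCycle x y) :
    (σ * swap x y).SameCycle x y := by
  by_contra hc
  have key : ∀ k : ℕ, (σ * swap x y).SameCycle y ((σ ^ (k + 1)) x) := by
    intro k
    induction k with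
    | zero =>
      refine ⟨1, ?_⟩
      simp
    | succ k ih =>
      have h1 : (σ ^ (k + 1)) x ≠ x := fun h1 => hc (by rw [h1] at ih; exact ih.symm)
      have h2 : (σ ^ (k + 1)) x ≠ y := fun h2 => h ⟨(k + 1 : ℕ), by rw [zpow_natCast, h2]⟩
      refine ih.trans ⟨1, ?_⟩
      rw [zpow_one, mul_apply, swap_apply_of_ne_of_ne h1 h2, ← mul_apply, ← pow_succ']
  have h1 := key (orderOf σ - 1)
  rw [Nat.sub_add_cancel (orderOf_pos σ), pow_orderOf_eq_one] at h1
  exact hc h1.symm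

/-- Multiplication by a transposition that moves points of two different cycles joins them. -/
theorem sameCycle_mul_swap_iff [Finite α] {σ : Perm α} {x y : α} (h : ¬ σ.SameCycle x y) {a b : α} :
    (σ * swap x y).SameCycle a b ↔ σ.SameCycle a b ∨
      ((σ.SameCycle x a ∨ σ.SameCycle y a) ∧ (σ.SameCycle x b ∨ σ.SameCycle y b)) := by
  have hxy := sameCycle_mul_swap_self h
  have key : ∀ a b, σ.SameCycle a b → (σ * swap x y).SameCycle a b := by
    intro a b
    refine SameCycle.of_forall fun a => ?_
    by_cases hx : a = x
    · subst hx
      exact hxy.trans ⟨1, by simp⟩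
    by_cases hy : a = y
    · subst hy
      exact hxy.symm.trans ⟨1, by simp⟩
    exact ⟨1, by rw [zpow_one, mul_apply, swap_apply_of_ne_of_ne hx hy]⟩
  constructor
  -- The right-hand side is an equivalence relation respected by the product, so it is coarser than
  -- the cycles of the product.
  · refine SameCycle.of_equivalence (r := fun a b => σ.SameCycle a b ∨
      ((σ.SameCycle x a ∨ σ.SameCycle y a) ∧ (σ.SameCycle x b ∨ σ.SameCycle y b)))
      ⟨fun a => Or.inl (SameCycle.refl σ a), ?_, ?_⟩ ?_
    · rintro a b (h | h)
      · exact Or.inl h.symm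
      · exact Or.inr h.symm
    · rintro a b c (h | h) (h' | h')
      · exact Or.inl (h.trans h')
      · exact Or.inr ⟨h'.1.imp (fun h1 => h1.trans h.symm) (fun h1 => h1.trans h.symm), h'.2⟩
      · exact Or.inr ⟨h.1, h.2.imp (fun h1 => h1.trans h') (fun h1 => h1.trans h')⟩
      · exact Or.inr ⟨h.1, h'.2⟩
    · intro a
      by_cases hx : a = x
      · subst hx
        exact Or.inr ⟨Or.inl (SameCycle.refl σ _), Or.inr ⟨1, by simp⟩⟩
      by_cases hy : a = y
      · subst hy
        exact Or.inr ⟨Or.inr (SameCycle.refl σ _), Or.inl ⟨1, by simp⟩⟩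
      exact Or.inl ⟨1, by rw [zpow_one, mul_apply, swap_apply_of_ne_of_ne hx hy]⟩
  · rintro (h1 | ⟨h1, h2⟩)
    · exact key _ _ h1
    · have h1' : (σ * swap x y).SameCycle x a := h1.elim (key _ _) fun h1 => hxy.trans (key _ _ h1)
      have h2' : (σ * swap x y).SameCycle x b := h2.elim (key _ _) fun h1 => hxy.trans (key _ _ h1)
      exact h1'.symm.trans h2'

theorem sameCycle_swap_mul_iff [Finite α] {σ : Perm α} {x y : α} (h : ¬ σ.SameCycle x y) {a b : α} :
    (swap x y * σ).SameCycle a b ↔ σ.SameCycle a b ∨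
      ((σ.SameCycle x a ∨ σ.SameCycle y a) ∧ (σ.SameCycle x b ∨ σ.SameCycle y b)) := by
  rw [swap_mul_eq_mul_swap, sameCycle_mul_swap_iff (by simpa using h)]
  simp

/-- Multiplication by a transposition that moves two points of the same cycle separates them. -/
theorem not_sameCycle_mul_swap [Finite α] {σ : Perm α} {x y : α} (h : σ.SameCycle x y)
    (hne : x ≠ y) : ¬ (σ * swap x y).SameCycle x y := by
  classical
  have hex : ∃ k, (σ ^ k) x = y := by
    obtain ⟨i, -, hi⟩ := h.exists_pow_eq'
    exact ⟨i, hi⟩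
  set k := Nat.find hex with hk
  have hky : (σ ^ k) x = y := Nat.find_spec hex
  have hmin : ∀ i < k, (σ ^ i) x ≠ y := fun i hi => Nat.find_min hex hi
  have hk0 : 0 < k := by
    rcases Nat.eq_zero_or_pos k with h0 | h0
    · rw [h0] at hky; exact absurd hky hne
    · exact h0
  have hx : ∀ i, 0 < i → i ≤ k → (σ ^ i) x ≠ x := by
    intro i hi hik hix
    refine hmin (k - i) (by omega) ?_
    rw [← hky]
    conv_rhs => rw [← Nat.sub_add_cancel hik, pow_add, mul_apply, hix]
  intro hc
  -- The arc `σ x, …, σ^k x = y` is closed under the product, which sends its last point `y` back to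
  -- `σ x`. It contains `y`, but not `x` because `k` is minimal.
  have := hc.symm.mem_of_mapsTo (s := {z | ∃ i, 0 < i ∧ i ≤ k ∧ (σ ^ i) x = z}) ?_
    ⟨k, hk0, le_rfl, hky⟩
  · obtain ⟨i, hi, hik, hix⟩ := this
    exact hx i hi hik hix
  · rintro _ ⟨i, hi, hik, rfl⟩
    rcases hik.lt_or_eq with hlt | rfl
    · refine ⟨i + 1, by omega, hlt, ?_⟩
      rw [mul_apply, swap_apply_of_ne_of_ne (hx i hi hik) (hmin i hlt), pow_succ', mul_apply]
    · exact ⟨1, one_pos, hk0, by rw [hky]; simp⟩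

/-- The product equals `σ * swap (σ⁻¹ x) (σ⁻¹ y)`, which separates `σ⁻¹ x` from `σ⁻¹ y`. It sends
these points to `y` and `x`, so it separates `y` from `x`. -/
theorem not_sameCycle_swap_mul [Finite α] {σ : Perm α} {x y : α} (h : σ.SameCycle x y)
    (hne : x ≠ y) : ¬ (swap x y * σ).SameCycle x y := by
  rw [swap_mul_eq_mul_swap]
  have := not_sameCycle_mul_swap (σ := σ) (x := σ⁻¹ x) (y := σ⁻¹ y) (by simpa using h)
    (by simpa using hne)
  intro hc
  apply this
  have e1 : ∀ z, (σ * swap (σ⁻¹ x) (σ⁻¹ y)).SameCycle (σ⁻¹ x) z ↔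
      (σ * swap (σ⁻¹ x) (σ⁻¹ y)).SameCycle y z := by
    intro z
    rw [← sameCycle_apply_left]; simp
  have e2 : ∀ z, (σ * swap (σ⁻¹ x) (σ⁻¹ y)).SameCycle z (σ⁻¹ y) ↔
      (σ * swap (σ⁻¹ x) (σ⁻¹ y)).SameCycle z x := by
    intro z
    rw [← sameCycle_apply_right]; simp
  rw [e1, e2]
  exact hc.symm

end Equiv.Perm

end

section

/-! ### Permutations with labelled cycles -/

open Equiv Equiv.Perm

/-- A fixed point free involution `τ` of the points and weighted labels with a fixed point free
involution `ι`. -/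
structure TwistData (α : Type*) (E : Type*) where
  τ : Perm α
  ι : E → E
  w : E → ℕ
  tau_mul_tau : τ * τ = 1
  tau_ne : ∀ x, τ x ≠ x
  inv_inv : ∀ e, ι (ι e) = e
  inv_ne : ∀ e, ι e ≠ e
  w_inv : ∀ e, w (ι e) = w e
  w_pos : ∀ e, 0 < w e

namespace TwistData

variable {α E : Type*} (T : TwistData α E)

theorem tau_tau (x : α) : T.τ (T.τ x) = x := by
  rw [← mul_apply, T.tau_mul_tau, one_apply]

theorem tau_inv : T.τ⁻¹ = T.τ := inv_eq_of_mul_eq_one_left T.tau_mul_tau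

/-- A permutation `s.1` inverted by `τ` with a labelling `s.2` of its cycles by the set `A` that is
compatible with the involutions and with the weights. -/
structure IsLabelled (A : Set E) (s : Perm α × (α → E)) : Prop where
  conj : T.τ * s.1 * T.τ = s.1⁻¹
  sameCycle : ∀ x y, s.2 x = s.2 y ↔ s.1.SameCycle x y
  tau : ∀ x, s.2 (T.τ x) = T.ι (s.2 x)
  mem : ∀ x, s.2 x ∈ A
  ncard : ∀ e ∈ A, {x | s.2 x = e}.ncard = T.w e

variable {T} {A : Set E} {s : Perm α × (α → E)}

theorem tau_zpow (hs : T.τ * s.1 * T.τ = s.1⁻¹) (k : ℤ) (x : α) :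
    T.τ ((s.1 ^ k) x) = (s.1 ^ (-k)) (T.τ x) := by
  have h1 : T.τ * s.1 ^ k * T.τ⁻¹ = s.1 ^ (-k) := by
    rw [← conj_zpow, T.tau_inv, hs, inv_zpow, zpow_neg]
  rw [← h1, T.tau_inv]
  simp [T.tau_tau]

namespace IsLabelled

variable (hs : T.IsLabelled A s)
include hs

theorem apply (x : α) : s.2 (s.1 x) = s.2 x :=
  (hs.sameCycle _ _).2 (by simp [SameCycle.refl])

theorem zpow_apply (k : ℤ) (x : α) : s.2 ((s.1 ^ k) x) = s.2 x :=
  (hs.sameCycle _ _).2 (by simp [SameCycle.refl])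

theorem exists_eq {e : E} (he : e ∈ A) [Finite α] : ∃ x, s.2 x = e := by
  have := hs.ncard e he
  have h2 := T.w_pos e
  rw [← this] at h2
  exact Set.nonempty_of_ncard_ne_zero h2.ne'

theorem inv_mem [Finite α] {e : E} (he : e ∈ A) : T.ι e ∈ A := by
  obtain ⟨x, rfl⟩ := hs.exists_eq he
  rw [← hs.tau]
  exact hs.mem _

/-- The cycle through `x` is the fibre of its label, so the minimal period of `x` is the weight of
the label. -/
theorem zpow_eq_zpow_iff [Finite α] (a b : ℤ) (x : α) :
    (s.1 ^ a) x = (s.1 ^ b) x ↔ (T.w (s.2 x) : ℤ) ∣ a - b := by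
  classical
  have hw : Function.minimalPeriod (s.1 • ·) x = T.w (s.2 x) := by
    have := Fintype.ofFinite (MulAction.orbit (Subgroup.zpowers s.1) x)
    rw [MulAction.minimalPeriod_eq_card, ← hs.ncard _ (hs.mem x), ← Nat.card_eq_fintype_card,
      ← Nat.card_coe_set_eq]
    congr 2
    ext y
    rw [Set.mem_ofPred_eq, eq_comm, hs.sameCycle]
    constructor
    · rintro ⟨⟨_, k, rfl⟩, rfl⟩
      exact ⟨k, rfl⟩
    · rintro ⟨k, rfl⟩
      exact ⟨⟨_, k, rfl⟩, rfl⟩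
  rw [← hw, ← MulAction.zpow_smul_eq_iff_minimalPeriod_dvd]
  rw [sub_eq_neg_add, zpow_add, Perm.smul_def, mul_apply, zpow_neg, inv_eq_iff_eq]

end IsLabelled

/-! #### The standard model of a labelled permutation -/

variable (T A)

/-- The cyclic words of lengths `w e`, for `e ∈ A`. -/
abbrev Model := Σ e : A, ZMod (T.w e)

variable {A}

/-- The permutation of the standard model that rotates all the cycles. -/
def modelPerm : Perm (T.Model A) :=
  Equiv.sigmaCongrRight fun _ => Equiv.addRight 1

/-- The involution of the standard model. -/
def modelTau (hA : ∀ e ∈ A, T.ι e ∈ A) (z : T.Model A) : T.Model A :=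
  -- The sign makes the involution invert the rotation; `ringEquivCongr` is only the passage between
  -- the residue rings of the equal moduli `w e` and `w (ι e)`.
  ⟨⟨T.ι z.1, hA _ z.1.2⟩, ZMod.ringEquivCongr (T.w_inv z.1.1).symm (-z.2)⟩

/-- The `k`-th letter of the cyclic word `e`. -/
def modelMk (e : A) (k : ℤ) : T.Model A := ⟨e, (k : ZMod (T.w e))⟩

theorem exists_modelMk_eq (z : T.Model A) : ∃ e k, T.modelMk e k = z := by
  obtain ⟨e, a⟩ := z
  obtain ⟨k, rfl⟩ := ZMod.intCast_surjective a
  exact ⟨e, k, rfl⟩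

theorem modelTau_mk (hA : ∀ e ∈ A, T.ι e ∈ A) (e : A) (k : ℤ) :
    T.modelTau hA (T.modelMk e k) = T.modelMk ⟨T.ι e, hA _ e.2⟩ (-k) := by
  unfold modelTau modelMk
  refine Sigma.ext rfl (heq_of_eq ?_)
  change ZMod.ringEquivCongr _ (-(k : ZMod (T.w e))) = ((-k : ℤ) : ZMod (T.w (T.ι e)))
  rw [← Int.cast_neg, map_intCast]

theorem modelTau_modelTau (hA : ∀ e ∈ A, T.ι e ∈ A) (z : T.Model A) :
    T.modelTau hA (T.modelTau hA z) = z := by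
  obtain ⟨e, k, rfl⟩ := T.exists_modelMk_eq z
  rw [modelTau_mk, modelTau_mk, neg_neg]
  exact congrArg (fun e => T.modelMk e k) (Subtype.ext (T.inv_inv _))

theorem modelTau_ne (hA : ∀ e ∈ A, T.ι e ∈ A) (z : T.Model A) : T.modelTau hA z ≠ z := by
  intro h
  exact T.inv_ne z.1.1 (congrArg (fun z => z.1.1) h)

theorem modelPerm_mk (e : A) (k : ℤ) : T.modelPerm (T.modelMk e k) = T.modelMk e (k + 1) := by
  simp [modelPerm, modelMk]

theorem modelPerm_zpow (e : A) (k : ℤ) (m : ℤ) :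
    (T.modelPerm ^ m) (T.modelMk e k) = T.modelMk e (k + m) := by
  induction m generalizing k with
  | zero => simp
  | succ m ih =>
    rw [zpow_add, mul_apply, zpow_one, modelPerm_mk, ih]
    exact congrArg (T.modelMk e) (by ring)
  | pred m ih =>
    have h2 : (T.modelPerm ^ (-1 : ℤ)) (T.modelMk e k) = T.modelMk e (k - 1) := by
      rw [zpow_neg, zpow_one, inv_eq_iff_eq, modelPerm_mk]
      exact congrArg (T.modelMk e) (by ring)
    rw [sub_eq_add_neg, zpow_add, mul_apply, h2, ih]
    exact congrArg (T.modelMk e) (by ring)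

theorem modelMk_eq_iff (e : A) (k l : ℤ) :
    T.modelMk e k = T.modelMk e l ↔ (T.w e : ℤ) ∣ k - l := by
  unfold modelMk
  rw [Sigma.mk.injEq, heq_eq_eq, ← ZMod.intCast_zmod_eq_zero_iff_dvd, Int.cast_sub, sub_eq_zero]
  simp

/-- The labelled permutation obtained by writing the points on the standard model. -/
def stateOf (ψ : T.Model A ≃ α) : Perm α × (α → E) :=
  (ψ.permCongr T.modelPerm, fun a => (ψ.symm a).1)

theorem stateOf_zpow (ψ : T.Model A ≃ α) (m : ℤ) (z : T.Model A) :
    ((T.stateOf ψ).1 ^ m) (ψ z) = ψ ((T.modelPerm ^ m) z) := by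
  have : (T.stateOf ψ).1 ^ m = ψ.permCongr (T.modelPerm ^ m) :=
    (map_zpow ψ.permCongrHom T.modelPerm m).symm
  rw [this]
  simp [Equiv.permCongr_apply]

theorem isLabelled_stateOf (hA : ∀ e ∈ A, T.ι e ∈ A) (ψ : T.Model A ≃ α)
    (hψ : ∀ z, ψ (T.modelTau hA z) = T.τ (ψ z)) : T.IsLabelled A (T.stateOf ψ) := by
  refine ⟨?_, ?_, ?_, ?_, ?_⟩
  · rw [eq_inv_iff_mul_eq_one]
    ext x
    obtain ⟨z, rfl⟩ := ψ.surjective x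
    obtain ⟨e, k, rfl⟩ := T.exists_modelMk_eq z
    have h1 : ∀ z, (T.stateOf ψ).1 (ψ z) = ψ (T.modelPerm z) := by
      simpa using T.stateOf_zpow ψ 1
    simp only [mul_apply, h1, modelPerm_mk, ← hψ, modelTau_mk, one_apply, neg_add_rev, neg_neg, neg_add_cancel_comm_assoc]
    congr 2
    exact Subtype.ext (T.inv_inv _)
  · intro x y
    obtain ⟨z, rfl⟩ := ψ.surjective x
    obtain ⟨z', rfl⟩ := ψ.surjective y
    obtain ⟨e, k, rfl⟩ := T.exists_modelMk_eq z
    obtain ⟨e', k', rfl⟩ := T.exists_modelMk_eq z'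
    simp only [stateOf, Equiv.symm_apply_apply]
    constructor
    · intro h
      obtain rfl : e = e' := Subtype.ext h
      refine ⟨k' - k, ?_⟩
      have := T.stateOf_zpow ψ (k' - k) (T.modelMk e k)
      rw [modelPerm_zpow] at this
      simpa [stateOf] using this
    · rintro ⟨m, hm⟩
      have h2 := T.stateOf_zpow ψ m (T.modelMk e k)
      unfold stateOf at h2
      rw [h2] at hm
      rw [modelPerm_zpow] at hm
      have := ψ.injective hm
      exact congrArg (fun z => z.1.1) this
  · intro x
    obtain ⟨z, rfl⟩ := ψ.surjective x
    simp only [stateOf, ← hψ, Equiv.symm_apply_apply]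
    rfl
  · intro x
    exact (ψ.symm x).1.2
  · intro e he
    rw [← Nat.card_coe_set_eq, ← Nat.card_zmod (T.w e)]
    refine (Nat.card_congr (Equiv.ofBijective
      (fun a : ZMod (T.w e) => ⟨ψ ⟨⟨e, he⟩, a⟩, by simp [stateOf]⟩) ⟨?_, ?_⟩)).symm
    · intro a a' h
      have h2 := ψ.injective (congrArg Subtype.val h)
      rw [Sigma.mk.injEq] at h2
      exact eq_of_heq h2.2
    · rintro ⟨x, hx⟩
      obtain ⟨⟨⟨e', he'⟩, a⟩, rfl⟩ := ψ.surjective x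
      obtain rfl : e' = e := by simpa [stateOf] using hx
      exact ⟨a, rfl⟩

/-- A choice of base points on all the cycles that is compatible with the involutions. -/
def IsFraming (s : Perm α × (α → E)) (x : A → α) : Prop :=
  (∀ e, s.2 (x e) = e) ∧ ∀ e e' : A, (e' : E) = T.ι e → x e' = T.τ (x e)

variable {T} in
-- The `k`-th letter of the word `e` is sent to `σ^k (x e)`. This is well defined and injective
-- because the cycle has exactly `w e` points, surjective because every cycle carries a base point,
-- and equivariant because `τ σ^k = σ^(-k) τ`.
theorem IsLabelled.exists_model [Finite α] {s : Perm α × (α → E)} (hs : T.IsLabelled A s)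
    {x : A → α} (hx : T.IsFraming s x) :
    ∃ ψ : T.Model A ≃ α, (∀ z, ψ (T.modelTau (fun _ => hs.inv_mem) z) = T.τ (ψ z)) ∧
      T.stateOf ψ = s ∧ ∀ e, ψ (T.modelMk e 0) = x e := by
  let F : T.Model A → α := fun z => (s.1 ^ (ZMod.cast z.2 : ℤ)) (x z.1)
  have hF : ∀ e k, F (T.modelMk e k) = (s.1 ^ k) (x e) := by
    intro e k
    change (s.1 ^ (ZMod.cast (k : ZMod (T.w e)) : ℤ)) (x e) = _
    rw [hs.zpow_eq_zpow_iff, hx.1, ← ZMod.intCast_zmod_eq_zero_iff_dvd]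
    simp
  have hbij : Function.Bijective F := by
    constructor
    · intro z z' h
      obtain ⟨e, k, rfl⟩ := T.exists_modelMk_eq z
      obtain ⟨e', k', rfl⟩ := T.exists_modelMk_eq z'
      rw [hF, hF] at h
      have h2 := congrArg s.2 h
      rw [hs.zpow_apply, hs.zpow_apply, hx.1, hx.1] at h2
      obtain rfl : e = e' := Subtype.ext h2
      rw [modelMk_eq_iff]
      rw [hs.zpow_eq_zpow_iff, hx.1] at h
      exact h
    · intro a
      have : s.1.SameCycle (x ⟨s.2 a, hs.mem a⟩) a := by
        rw [← hs.sameCycle, hx.1]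
      obtain ⟨k, hk⟩ := this
      exact ⟨T.modelMk ⟨s.2 a, hs.mem a⟩ k, by rw [hF, hk]⟩
  refine ⟨Equiv.ofBijective F hbij, ?_, ?_, ?_⟩
  · intro z
    obtain ⟨e, k, rfl⟩ := T.exists_modelMk_eq z
    rw [modelTau_mk]
    simp only [Equiv.ofBijective_apply, hF]
    rw [tau_zpow hs.conj, hx.2 e _ rfl]
  · refine Prod.ext ?_ ?_
    · ext a
      obtain ⟨z, rfl⟩ := hbij.2 a
      obtain ⟨e, k, rfl⟩ := T.exists_modelMk_eq z
      have := T.stateOf_zpow (Equiv.ofBijective F hbij) 1 (T.modelMk e k)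
      rw [zpow_one, zpow_one, modelPerm_mk] at this
      refine this.trans ?_
      simp only [Equiv.ofBijective_apply, hF]
      rw [add_comm, zpow_add, zpow_one, mul_apply]
    · ext a
      obtain ⟨z, rfl⟩ := hbij.2 a
      obtain ⟨e, k, rfl⟩ := T.exists_modelMk_eq z
      have h1 : (Equiv.ofBijective F hbij).symm (F (T.modelMk e k)) = T.modelMk e k :=
        Equiv.symm_apply_apply (Equiv.ofBijective F hbij) _
      simp only [stateOf, h1]
      rw [hF, hs.zpow_apply, hx.1]
      rfl
  · intro e
    simp [hF]

end TwistData

end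

section

/-! ### The number of labelled permutations -/

open Equiv Equiv.Perm

namespace TwistData

variable {α E : Type*} {T : TwistData α E} {A : Set E} {s s' : Perm α × (α → E)}

/-- The set `R` contains exactly one label of every pair exchanged by the involution. -/
def IsTransversal (T : TwistData α E) (R : Set E) : Prop := ∀ e, e ∈ R ↔ T.ι e ∉ R

theorem exists_isTransversal (T : TwistData α E) : ∃ R, T.IsTransversal R := by
  -- The classes are the pairs `{e, ι e}`; `Quotient.out` selects one member of each.
  let r : Setoid E := ⟨fun e e' => e = e' ∨ T.ι e = e', fun e => Or.inl rfl, by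
    rintro e e' (h | h)
    · exact Or.inl h.symm
    · exact Or.inr (by rw [← h, T.inv_inv]), by
    rintro e e' e'' (rfl | rfl) (rfl | rfl)
    · exact Or.inl rfl
    · exact Or.inr rfl
    · exact Or.inr rfl
    · exact Or.inl (T.inv_inv _).symm⟩
  refine ⟨{e | (Quotient.mk r e).out = e}, fun e => ?_⟩
  have h1 : Quotient.mk r (T.ι e) = Quotient.mk r e := Quotient.sound (Or.inr (T.inv_inv e))
  have h2 : e = (Quotient.mk r e).out ∨ T.ι e = (Quotient.mk r e).out :=
    Quotient.exact (Quotient.out_eq (Quotient.mk r e)).symm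
  simp only [Set.mem_ofPred_eq, h1]
  constructor
  · intro h h'
    exact T.inv_ne e (h'.symm.trans h)
  · intro h
    exact (h2.resolve_right fun h3 => h h3.symm).symm

theorem IsTransversal.inv_mem {R : Set E} (hR : T.IsTransversal R) {e : E} (he : e ∉ R) :
    T.ι e ∈ R := by
  by_contra h
  exact he ((hR e).2 h)

open Classical in
-- The base points on the cycles with labels in `R` can be chosen freely, and `τ` forces all the
-- others.
theorem IsLabelled.card_framing [Finite α] [Fintype E] (hs : T.IsLabelled A s) {R : Set E}
    (hR : T.IsTransversal R) :
    Nat.card {x // T.IsFraming (A := A) s x} = ∏ e with e ∈ A ∧ e ∈ R, T.w e := by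
  let F : {x // T.IsFraming (A := A) s x} → ∀ e : {e // e ∈ A ∧ e ∈ R}, {a // s.2 a = e} :=
    fun x e => ⟨x.1 ⟨e, e.2.1⟩, x.2.1 _⟩
  have hF : Function.Bijective F := by
    constructor
    · rintro ⟨x, hx⟩ ⟨y, hy⟩ h
      have key : ∀ e : A, e.1 ∈ R → x e = y e := fun e he =>
        congrArg Subtype.val (congrFun h ⟨e.1, e.2, he⟩)
      refine Subtype.ext (funext fun e => ?_)
      by_cases he : e.1 ∈ R
      · exact key e he
      · change x e = y e
        have h1 : e.1 = T.ι (T.ι e.1) := (T.inv_inv _).symm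
        rw [hx.2 ⟨T.ι e, hs.inv_mem e.2⟩ e h1, hy.2 ⟨T.ι e, hs.inv_mem e.2⟩ e h1,
          key _ (hR.inv_mem he)]
    · intro y
      refine ⟨⟨fun e => if he : e.1 ∈ R then (y ⟨e.1, e.2, he⟩).1 else
        T.τ (y ⟨T.ι e.1, hs.inv_mem e.2, hR.inv_mem he⟩).1, ?_, ?_⟩, ?_⟩
      · intro e
        by_cases he : e.1 ∈ R
        · simp only [he, dif_pos]
          exact (y ⟨e.1, e.2, he⟩).2
        · simp only [he, dif_neg, not_false_eq_true]
          rw [hs.tau, (y ⟨T.ι e.1, hs.inv_mem e.2, hR.inv_mem he⟩).2, T.inv_inv]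
      · rintro ⟨e, he⟩ ⟨_, he'⟩ rfl
        by_cases h : e ∈ R
        · have h' : T.ι e ∉ R := (hR e).1 h
          simp only [h, h', dif_pos, dif_neg, not_false_eq_true]
          have : ∀ (e' : E) (h₁ : e' ∈ A ∧ e' ∈ R) (h₂ : e ∈ A ∧ e ∈ R), e' = e →
              (y ⟨e', h₁⟩).1 = (y ⟨e, h₂⟩).1 := by
            rintro _ _ _ rfl; rfl
          rw [this _ _ ⟨he, h⟩ (T.inv_inv e)]
        · have h' : T.ι e ∈ R := hR.inv_mem h
          simp only [h, h', dif_pos, dif_neg, not_false_eq_true, T.tau_tau]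
      · funext e
        simp only [F, e.2.2, dif_pos, Subtype.coe_eta]
  rw [Nat.card_congr (Equiv.ofBijective F hF), Nat.card_pi]
  rw [Finset.prod_subtype (Finset.univ.filter fun e => e ∈ A ∧ e ∈ R) (p := fun e => e ∈ A ∧ e ∈ R)
    (by simp)]
  refine Finset.prod_congr rfl fun e _ => ?_
  rw [← hs.ncard e e.2.1, ← Nat.card_coe_set_eq]
  rfl

theorem IsLabelled.exists_framing [Finite α] (hs : T.IsLabelled A s) :
    ∃ x : A → α, T.IsFraming s x := by
  classical
  obtain ⟨R, hR⟩ := T.exists_isTransversal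
  choose y hy using fun e : A => hs.exists_eq e.2
  refine ⟨fun e => if e.1 ∈ R then y e else T.τ (y ⟨T.ι e.1, hs.inv_mem e.2⟩), ?_, ?_⟩
  · intro e
    by_cases he : e.1 ∈ R
    · simp only [he, if_true, hy]
    · simp only [he, if_false, hs.tau, hy, T.inv_inv]
  · rintro ⟨e, he⟩ ⟨_, he'⟩ rfl
    by_cases h : e ∈ R
    · have h' : T.ι e ∉ R := (hR e).1 h
      simp only [h, h', if_true, if_false, T.inv_inv]
    · have h' : T.ι e ∈ R := hR.inv_mem h
      simp only [h, h', if_true, if_false, T.tau_tau]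

theorem stateOf_trans (g : Perm α) (ψ : T.Model A ≃ α) :
    T.stateOf (ψ.trans g) = (g * (T.stateOf ψ).1 * g⁻¹, fun a => (T.stateOf ψ).2 (g⁻¹ a)) :=
  rfl

/-- The centralizer of `τ` acts transitively on the labelled permutations. -/
theorem IsLabelled.exists_conj [Finite α] (hs : T.IsLabelled A s) (hs' : T.IsLabelled A s') :
    ∃ g : Perm α, g * T.τ = T.τ * g ∧ s' = (g * s.1 * g⁻¹, fun a => s.2 (g⁻¹ a)) := by
  obtain ⟨x, hx⟩ := hs.exists_framing
  obtain ⟨x', hx'⟩ := hs'.exists_framing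
  obtain ⟨ψ, h1, h2, -⟩ := hs.exists_model hx
  obtain ⟨ψ', h1', h2', -⟩ := hs'.exists_model hx'
  refine ⟨ψ.symm.trans ψ', ?_, ?_⟩
  · ext a
    obtain ⟨z, rfl⟩ := ψ.surjective a
    simp only [mul_apply, Equiv.trans_apply, Equiv.symm_apply_apply, ← h1, ← h1']
  · rw [← h2, ← h2', ← stateOf_trans]
    congr 1
    ext z
    simp

/-- Framed labelled permutations are the equivariant bijections from the standard model. -/
theorem card_sigma_framing [Finite α] (hA : ∀ e ∈ A, T.ι e ∈ A) :
    Nat.card (Σ s : {s // T.IsLabelled A s}, {x // T.IsFraming (A := A) s.1 x}) =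
      Nat.card {ψ : T.Model A ≃ α // ∀ z, ψ (T.modelTau hA z) = T.τ (ψ z)} := by
  symm
  have hfr : ∀ ψ : {ψ : T.Model A ≃ α // ∀ z, ψ (T.modelTau hA z) = T.τ (ψ z)},
      T.IsFraming (A := A) (T.stateOf ψ.1) fun e => ψ.1 (T.modelMk e 0) := by
    rintro ⟨ψ, hψ⟩
    refine ⟨fun e => ?_, ?_⟩
    · simp only [stateOf, Equiv.symm_apply_apply]
      rfl
    · rintro ⟨e, he⟩ ⟨_, he'⟩ rfl
      simp only [← hψ, modelTau_mk, neg_zero]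
  refine Nat.card_congr (Equiv.ofBijective (fun ψ => ⟨⟨T.stateOf ψ.1,
    T.isLabelled_stateOf hA ψ.1 ψ.2⟩, ⟨_, hfr ψ⟩⟩) ⟨?_, ?_⟩)
  · rintro ⟨ψ, hψ⟩ ⟨ψ', hψ'⟩ h
    rw [Sigma.mk.injEq] at h
    have h1 : T.stateOf ψ = T.stateOf ψ' := congrArg Subtype.val h.1
    have h2 : ∀ e, ψ (T.modelMk e 0) = ψ' (T.modelMk e 0) := by
      have aux : ∀ (s₁ s₂ : {s // T.IsLabelled A s}) (h : s₁ = s₂)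
          (y₁ : {x // T.IsFraming (A := A) s₁.1 x}) (y₂ : {x // T.IsFraming (A := A) s₂.1 x}),
          HEq y₁ y₂ → y₁.1 = y₂.1 := by
        rintro s₁ _ rfl y₁ y₂ h
        rw [eq_of_heq h]
      exact congrFun (aux _ _ h.1 _ _ h.2)
    refine Subtype.ext (Equiv.ext fun z => ?_)
    obtain ⟨e, k, rfl⟩ := T.exists_modelMk_eq z
    have h3 := T.stateOf_zpow ψ k (T.modelMk e 0)
    have h4 := T.stateOf_zpow ψ' k (T.modelMk e 0)
    rw [modelPerm_zpow, zero_add] at h3 h4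
    change ψ _ = ψ' _
    rw [← h3, ← h4, h1, h2]
  · rintro ⟨⟨s, hs⟩, ⟨x, hx⟩⟩
    obtain ⟨ψ, h1, rfl, h3⟩ := hs.exists_model hx
    refine ⟨⟨ψ, h1⟩, ?_⟩
    have : (fun e => ψ (T.modelMk e 0)) = x := funext h3
    subst this
    rfl

theorem card_model [Fintype E] [DecidablePred (· ∈ A)] :
    Nat.card (T.Model A) = ∑ e with e ∈ A, T.w e := by
  have : ∀ e, NeZero (T.w e) := fun e => ⟨(T.w_pos e).ne'⟩
  rw [Nat.card_sigma]
  simp only [Nat.card_zmod]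
  exact (Finset.sum_subtype _ (by simp) T.w).symm

end TwistData

/-- Two fixed point free involutions are conjugate. -/
theorem Equiv.Perm.isConj_of_fixedPointFree {α : Type*} [Finite α] {σ τ : Perm α} (hσ : σ * σ = 1)
    (hτ : τ * τ = 1) (hσ' : ∀ x, σ x ≠ x) (hτ' : ∀ x, τ x ≠ x) : IsConj σ τ := by
  classical
  have := Fintype.ofFinite α
  -- All nontrivial cycles have length `2` and there are no fixed points, so the cycle type depends
  -- only on the number of points.
  have key : ∀ σ : Perm α, σ * σ = 1 → (∀ x, σ x ≠ x) →
      σ.cycleType = Multiset.replicate (Fintype.card α / 2) 2 := by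
    intro σ h h'
    have h1 := cycleType_of_pow_prime_eq_one (p := 2) (by rw [pow_two, h])
    have h2 := σ.sum_cycleType
    have h3 : σ.support = Finset.univ := by
      ext x; simp [h']
    rw [h3, Finset.card_univ, h1, Multiset.sum_replicate, smul_eq_mul] at h2
    rw [h1, ← h2, Nat.mul_div_cancel _ two_pos]
  rw [isConj_iff_cycleType_eq, key σ hσ hσ', key τ hτ hτ']

namespace TwistData

variable {α E : Type*} {T : TwistData α E} {A : Set E} {s s' : Perm α × (α → E)}

open Classical in
/-- The number of labelled permutations. -/
theorem card_isLabelled [Finite α] [Fintype E] (hA : ∀ e ∈ A, T.ι e ∈ A)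
    (hcard : ∑ e with e ∈ A, T.w e = Nat.card α) {R : Set E} (hR : T.IsTransversal R) :
    Nat.card {s // T.IsLabelled A s} * ∏ e with e ∈ A ∧ e ∈ R, T.w e =
      Nat.card (Subgroup.centralizer {T.τ}) := by
  have : ∀ e, NeZero (T.w e) := fun e => ⟨(T.w_pos e).ne'⟩
  have h1 := T.card_sigma_framing hA
  have := Fintype.ofFinite {s // T.IsLabelled A s}
  -- All labelled permutations have the same number of framings, so framed permutations are counted
  -- by a product.
  rw [Nat.card_sigma, Finset.sum_congr rfl fun s _ => s.2.card_framing hR, Finset.sum_const,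
    smul_eq_mul, Finset.card_univ, ← Nat.card_eq_fintype_card] at h1
  rw [h1]
  obtain ⟨θ⟩ : Nonempty (T.Model A ≃ α) := by
    have := Fintype.ofFinite α
    refine ⟨Fintype.equivOfCardEq ?_⟩
    rw [← Nat.card_eq_fintype_card, ← Nat.card_eq_fintype_card, T.card_model, hcard]
  -- An arbitrary bijection `θ` carries the involution of the model to a fixed point free
  -- involution, which is conjugate to `τ`. Correcting `θ` by the conjugating element gives one
  -- equivariant bijection; all others differ from it by an element of the centralizer.
  let τ' : Perm α := θ.permCongr
    ⟨T.modelTau hA, T.modelTau hA, T.modelTau_modelTau hA, T.modelTau_modelTau hA⟩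
  have hτ' : ∀ z, τ' (θ z) = θ (T.modelTau hA z) := by
    intro z
    simp [τ', Equiv.permCongr_apply]
  obtain ⟨g, hg⟩ : IsConj τ' T.τ := by
    refine isConj_of_fixedPointFree ?_ T.tau_mul_tau ?_ T.tau_ne
    · ext x
      obtain ⟨z, rfl⟩ := θ.surjective x
      rw [mul_apply, hτ', hτ', T.modelTau_modelTau, one_apply]
    · intro x
      obtain ⟨z, rfl⟩ := θ.surjective x
      rw [hτ']
      exact fun h => T.modelTau_ne hA z (θ.injective h)
  have hg' : ∀ x, g.1 (τ' x) = T.τ (g.1 x) := fun x => congrArg (fun f : Perm α => f x) hg.eq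
  symm
  refine Nat.card_congr (Equiv.ofBijective
    (fun h => ⟨(θ.trans g.1).trans h.1, fun z => ?_⟩) ⟨?_, ?_⟩)
  · have h2 : T.τ * h.1 = h.1 * T.τ := (Subgroup.mem_centralizer_singleton_iff.1 h.2).symm
    have h3 : ∀ x, T.τ (h.1 x) = h.1 (T.τ x) := fun x => congrArg (fun f : Perm α => f x) h2
    simp only [Equiv.trans_apply, ← hτ', hg', h3]
  · intro h h' hh
    refine Subtype.ext (Equiv.ext fun x => ?_)
    have := congrArg Subtype.val hh
    have := congrArg (fun f : T.Model A ≃ α => f ((θ.trans g.1).symm x)) this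
    simpa using this
  · rintro ⟨ψ, hψ⟩
    refine ⟨⟨(θ.trans g.1).symm.trans ψ, ?_⟩, ?_⟩
    · rw [Subgroup.mem_centralizer_singleton_iff]
      ext x
      obtain ⟨z, rfl⟩ := (θ.trans g.1).surjective x
      have : T.τ ((θ.trans g.1) z) = (θ.trans g.1) (T.modelTau hA z) := by
        simp only [Equiv.trans_apply, ← hτ', hg']
      have h2 : ∀ z, ((θ.trans g.1).symm.trans ψ) ((θ.trans g.1) z) = ψ z := fun z => by
        rw [Equiv.trans_apply, Equiv.symm_apply_apply]
      rw [mul_apply, mul_apply, this]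
      exact (h2 _).trans ((hψ z).trans (congrArg T.τ (h2 z).symm))
    · refine Subtype.ext (Equiv.ext fun x => ?_)
      simp

theorem IsLabelled.sum_w [Finite α] [Fintype E] [DecidablePred (· ∈ A)] (hs : T.IsLabelled A s) :
    ∑ e with e ∈ A, T.w e = Nat.card α := by
  have : ∀ e, NeZero (T.w e) := fun e => ⟨(T.w_pos e).ne'⟩
  obtain ⟨x, hx⟩ := hs.exists_framing
  obtain ⟨ψ, -⟩ := hs.exists_model hx
  rw [← T.card_model, Nat.card_congr ψ]

end TwistData

/-- The involution consists of `n` transpositions without fixed points, so its centralizer has order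
`2^n n!`. -/
theorem card_centralizer_tau (n : ℕ) :
    Nat.card (Subgroup.centralizer {tau n}) = Nat.doubleFactorial (2 * n) := by
  have hfix : (tau n).support = Finset.univ := by
    ext x; cases x <;> simp [tau]
  have h1 := cycleType_of_pow_prime_eq_one (σ := tau n) (p := 2) (by rw [pow_two, tau_mul_tau])
  have h2 := (tau n).sum_cycleType
  rw [hfix, Finset.card_univ, h1, Multiset.sum_replicate, smul_eq_mul] at h2
  have h3 : Fintype.card (Pts n) = 2 * n := by simp [Pts]; ring
  rw [h3] at h2
  have h4 : (tau n).cycleType = Multiset.replicate n 2 := by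
    rw [h1]; congr 1; omega
  rw [nat_card_centralizer, h4, Nat.doubleFactorial_two_mul, h3, Multiset.sum_replicate,
    Multiset.prod_replicate]
  -- For `n = 0` the set of cycle lengths is empty instead of `{2}`.
  rcases Nat.eq_zero_or_pos n with rfl | hn
  · simp
  · rw [Multiset.toFinset_replicate, if_neg hn.ne', Finset.prod_singleton, Multiset.count_replicate_self,
      smul_eq_mul, mul_comm n 2, Nat.sub_self, Nat.factorial_zero, one_mul]

end

section

/-! ### Transitions between labelled permutations -/

open Equiv Equiv.Perm

/-- The labels before a branch point (`A`) and after it (`B`), those that end there (`In`) and those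
that start there (`Out`), with the vertices at which they do so. -/
structure NodeData (E V : Type*) where
  A : Set E
  B : Set E
  In : Set E
  Out : Set E
  tgt : E → V
  src : E → V

/-- The same node, read from right to left. -/
def NodeData.rev {E V : Type*} (N : NodeData E V) : NodeData E V :=
  ⟨N.B, N.A, N.Out, N.In, N.src, N.tgt⟩

theorem Equiv.Perm.apply_inv_apply {α : Type*} (g : Perm α) (x : α) : g (g⁻¹ x) = x :=
  g.apply_symm_apply x

namespace TwistData

variable {α E V : Type*} (T : TwistData α E)

/-- The group generated by a permutation, by `η` and by `τ η τ`. -/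
def localGroup (σ η : Perm α) : Subgroup (Perm α) :=
  Subgroup.closure {σ, η, T.τ * η * T.τ}

/-- The labelled permutation `s` is transformed to `s'` by `η` as prescribed by the node `N`. -/
structure IsTransition (N : NodeData E V) (s : Perm α × (α → E)) (η : Perm α)
    (s' : Perm α × (α → E)) : Prop where
  left : T.IsLabelled N.A s
  right : T.IsLabelled N.B s'
  eq_mul : s'.1 = η * s.1 * (T.τ * η * T.τ)
  exists_swap : ∃ x y, x ≠ y ∧ T.τ x ≠ y ∧ (∀ z, η z ≠ z ↔ z = x ∨ z = y) ∧ η x = y ∧ η y = x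
  mem_In : ∀ x, s.2 x ∈ N.In ↔ ∃ y, s.2 y = s.2 x ∧ (η y ≠ y ∨ (T.τ * η * T.τ) y ≠ y)
  mem_Out : ∀ x, s'.2 x ∈ N.Out ↔ ∃ y, s'.2 y = s'.2 x ∧ (η y ≠ y ∨ (T.τ * η * T.τ) y ≠ y)
  eq_of_notMem_In : ∀ x, s.2 x ∉ N.In → s'.2 x = s.2 x
  eq_of_notMem_Out : ∀ x, s'.2 x ∉ N.Out → s'.2 x = s.2 x
  src_eq : ∀ x, s.2 x ∈ N.In → s'.2 x ∈ N.Out ∧ N.src (s'.2 x) = N.tgt (s.2 x)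
  tgt_eq : ∀ x, s'.2 x ∈ N.Out → s.2 x ∈ N.In ∧ N.tgt (s.2 x) = N.src (s'.2 x)
  -- It suffices to require this for incoming labels: `src_eq` and `tgt_eq` transfer it to the
  -- outgoing ones.
  orbit : ∀ x y, s.2 x ∈ N.In → s.2 y ∈ N.In →
    (N.tgt (s.2 x) = N.tgt (s.2 y) ↔ y ∈ MulAction.orbit (T.localGroup s'.1 η) x)

variable {T}

theorem sameCycle_mem_orbit {σ η : Perm α} {x y : α} (h : σ.SameCycle x y) :
    y ∈ MulAction.orbit (T.localGroup σ η) x := by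
  obtain ⟨k, rfl⟩ := h
  exact ⟨⟨σ ^ k, zpow_mem (Subgroup.subset_closure (by simp)) k⟩, rfl⟩

theorem apply_mem_orbit {σ η : Perm α} (x : α) :
    η x ∈ MulAction.orbit (T.localGroup σ η) x :=
  ⟨⟨η, Subgroup.subset_closure (by simp)⟩, rfl⟩

/-- On a finite set a permutation that maps `S` into itself also preserves it backwards, so
stability under the generators suffices. -/
theorem orbit_subset [Finite α] {σ η : Perm α} {S : Set α} (h₁ : ∀ z ∈ S, σ z ∈ S)
    (h₂ : ∀ z ∈ S, η z ∈ S) (h₃ : ∀ z ∈ S, (T.τ * η * T.τ) z ∈ S) {x y : α} (hx : x ∈ S)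
    (hy : y ∈ MulAction.orbit (T.localGroup σ η) x) : y ∈ S := by
  have key : ∀ γ : Perm α, (∀ z ∈ S, γ z ∈ S) → ∀ z, γ z ∈ S ↔ z ∈ S := fun γ hγ z =>
    ⟨fun h => SameCycle.mem_of_mapsTo hγ (show γ.SameCycle (γ z) z by simp [SameCycle.refl]) h,
      hγ z⟩
  obtain ⟨⟨γ, hγ⟩, rfl⟩ := hy
  suffices ∀ z, γ z ∈ S ↔ z ∈ S from (this x).2 hx
  induction hγ using Subgroup.closure_induction with
  | mem γ hγ =>
    rcases hγ with rfl | rfl | rfl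
    · exact key _ h₁
    · exact key _ h₂
    · exact key _ h₃
  | one => exact fun z => Iff.rfl
  | mul γ γ' _ _ ih ih' => exact fun z => by rw [mul_apply, ih, ih']
  | inv γ _ ih => exact fun z => by rw [← ih, apply_inv_apply]

/-- The vertices at a node can thus be computed from the permutation on either side. -/
theorem localGroup_eq {σ σ' η : Perm α} (h : σ' = η * σ * (T.τ * η * T.τ)) :
    T.localGroup σ' η = T.localGroup σ η := by
  have h2 : ∀ σ, η ∈ T.localGroup σ η := fun σ => Subgroup.subset_closure (by simp)
  have h3 : ∀ σ, T.τ * η * T.τ ∈ T.localGroup σ η := fun σ => Subgroup.subset_closure (by simp)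
  have h1 : ∀ σ, σ ∈ T.localGroup σ η := fun σ => Subgroup.subset_closure (by simp)
  apply le_antisymm
  · refine (Subgroup.closure_le _).2 ?_
    rintro γ (rfl | rfl | rfl)
    · rw [h]
      exact mul_mem (mul_mem (h2 _) (h1 _)) (h3 _)
    · exact h2 _
    · exact h3 _
  · refine (Subgroup.closure_le _).2 ?_
    rintro γ (rfl | rfl | rfl)
    · have h4 : γ = η⁻¹ * σ' * (T.τ * η * T.τ)⁻¹ := by rw [h]; group
      rw [h4]
      exact mul_mem (mul_mem (inv_mem (h2 _)) (h1 _)) (inv_mem (h3 _))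
    · exact h2 _
    · exact h3 _

namespace IsTransition

variable {N : NodeData E V} {s s' : Perm α × (α → E)} {η : Perm α}

theorem mul_self (h : T.IsTransition N s η s') : η * η = 1 := by
  obtain ⟨x, y, -, -, h1, h2, h3⟩ := h.exists_swap
  ext z
  by_cases hz : η z = z
  · simp [hz]
  · rcases (h1 z).1 hz with rfl | rfl
    · simp [h2, h3]
    · simp [h2, h3]

/-- Since `η` and `τ η τ` are involutions, the same `η` leads back. This is what allows a cut to be
treated as a join. -/
theorem rev (h : T.IsTransition N s η s') : T.IsTransition N.rev s' η s where
  left := h.right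
  right := h.left
  eq_mul := by
    have h1 := h.mul_self
    have h2 : ∀ x, η * (η * x) = x := fun x => by rw [← mul_assoc, h1, one_mul]
    have h3 : ∀ x, T.τ * (T.τ * x) = x := fun x => by rw [← mul_assoc, T.tau_mul_tau, one_mul]
    rw [h.eq_mul]
    simp only [mul_assoc, h3, h2, T.tau_mul_tau, mul_one]
  exists_swap := h.exists_swap
  mem_In := h.mem_Out
  mem_Out := h.mem_In
  eq_of_notMem_In x hx := (h.eq_of_notMem_Out x hx).symm
  eq_of_notMem_Out x hx := (h.eq_of_notMem_In x hx).symm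
  src_eq := h.tgt_eq
  tgt_eq := h.src_eq
  orbit x y hx hy := by
    rw [← localGroup_eq h.eq_mul]
    have h1 := h.tgt_eq x hx
    have h2 := h.tgt_eq y hy
    change N.src _ = N.src _ ↔ _
    rw [← h1.2, ← h2.2, h.orbit x y h1.1 h2.1]

/-- The new permutation is determined by the old one and `η`; only the new labelling involves a
choice. -/
theorem ext_left (h : T.IsTransition N s η s') {s'' : Perm α × (α → E)}
    (h' : T.IsTransition N s η s'') (hf : s'.2 = s''.2) : s' = s'' :=
  Prod.ext (h.eq_mul.trans h'.eq_mul.symm) hf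

end IsTransition

/-! #### The action of the centralizer of `τ` -/

/-- Relabelling of the points by a permutation. -/
def conjState (g : Perm α) (s : Perm α × (α → E)) : Perm α × (α → E) :=
  (g * s.1 * g⁻¹, fun a => s.2 (g⁻¹ a))

theorem conjState_inv_conjState (g : Perm α) (s : Perm α × (α → E)) :
    conjState g⁻¹ (conjState g s) = s := by
  refine Prod.ext ?_ ?_
  · change g⁻¹ * (g * s.1 * g⁻¹) * g⁻¹⁻¹ = s.1
    group
  · funext a
    change s.2 (g⁻¹ (g⁻¹⁻¹ a)) = s.2 a
    simp

theorem IsLabelled.conjState {A : Set E} {s : Perm α × (α → E)} (hs : T.IsLabelled A s)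
    {g : Perm α} (hg : g * T.τ = T.τ * g) : T.IsLabelled A (conjState g s) where
  conj := by
    have h1 : T.τ = g * T.τ * g⁻¹ := by rw [hg]; group
    change T.τ * (g * s.1 * g⁻¹) * T.τ = (g * s.1 * g⁻¹)⁻¹
    have h2 : (g * s.1 * g⁻¹)⁻¹ = g * (T.τ * s.1 * T.τ) * g⁻¹ := by rw [hs.conj]; group
    rw [h2]
    calc T.τ * (g * s.1 * g⁻¹) * T.τ = (T.τ * g) * s.1 * g⁻¹ * (g * T.τ * g⁻¹) := by
          rw [← h1]; group
      _ = _ := by rw [← hg]; group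
  sameCycle x y := by
    change s.2 _ = s.2 _ ↔ (g * s.1 * g⁻¹).SameCycle x y
    rw [sameCycle_conj, hs.sameCycle]
  tau x := by
    have h1 : g⁻¹ (T.τ x) = T.τ (g⁻¹ x) := by
      rw [inv_eq_iff_eq, ← mul_apply, hg, mul_apply, apply_inv_apply]
    change s.2 _ = T.ι (s.2 _)
    rw [h1, hs.tau]
  mem x := hs.mem _
  ncard e he := by
    rw [← hs.ncard e he, ← Set.ncard_image_of_injective {x | s.2 x = e} g.injective]
    congr 1
    ext x
    simp only [TwistData.conjState, Set.mem_ofPred_eq, Set.mem_image]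
    constructor
    · intro h
      exact ⟨g⁻¹ x, h, by simp⟩
    · rintro ⟨z, h, rfl⟩
      simpa using h

/-- Conjugation by an element that commutes with `τ` also carries `τ η τ` to the corresponding
conjugate, so every condition is only transported. -/
theorem IsTransition.conj {N : NodeData E V} {s s' : Perm α × (α → E)} {η : Perm α}
    (h : T.IsTransition N s η s') {g : Perm α} (hg : g * T.τ = T.τ * g) :
    T.IsTransition N (conjState g s) (g * η * g⁻¹) (conjState g s') := by
  have hgτ : ∀ x, g⁻¹ (T.τ x) = T.τ (g⁻¹ x) := fun x => by
    rw [inv_eq_iff_eq, ← mul_apply, hg, mul_apply, apply_inv_apply]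
  have hgτ' : ∀ x, g (T.τ x) = T.τ (g x) := fun x => by
    rw [← mul_apply, hg, mul_apply]
  have hη : T.τ * (g * η * g⁻¹) * T.τ = g * (T.τ * η * T.τ) * g⁻¹ := by
    ext x
    simp only [mul_apply, hgτ, hgτ']
  have hmov : ∀ (γ : Perm α) x, (g * γ * g⁻¹) x ≠ x ↔ γ (g⁻¹ x) ≠ g⁻¹ x := by
    intro γ x
    rw [mul_apply, mul_apply, not_iff_not]
    exact ⟨fun h => by rw [eq_inv_iff_eq, h], fun h => by rw [h, apply_inv_apply]⟩
  have hex : ∀ p : α → Prop, (∃ y, p (g⁻¹ y)) ↔ ∃ y, p y := fun p =>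
    ⟨fun ⟨y, hy⟩ => ⟨_, hy⟩, fun ⟨y, hy⟩ => ⟨g y, by simpa using hy⟩⟩
  refine ⟨h.left.conjState hg, h.right.conjState hg, ?_, ?_, ?_, ?_, fun x => h.eq_of_notMem_In _,
    fun x => h.eq_of_notMem_Out _, fun x => h.src_eq _, fun x => h.tgt_eq _, ?_⟩
  · change g * s'.1 * g⁻¹ = g * η * g⁻¹ * (g * s.1 * g⁻¹) * (T.τ * (g * η * g⁻¹) * T.τ)
    rw [hη, h.eq_mul]
    group
  · obtain ⟨x, y, h1, h2, h3, h4, h5⟩ := h.exists_swap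
    refine ⟨g x, g y, by simpa using h1, ?_, ?_, by simp [h4], by simp [h5]⟩
    · rw [← hgτ']; simpa using h2
    · intro z
      rw [hmov, h3, inv_eq_iff_eq, inv_eq_iff_eq]
  · intro x
    rw [hη]
    simp only [hmov]
    exact (h.mem_In _).trans (hex fun y => s.2 y = s.2 (g⁻¹ x) ∧
      (η y ≠ y ∨ (T.τ * η * T.τ) y ≠ y)).symm
  · intro x
    rw [hη]
    simp only [hmov]
    exact (h.mem_Out _).trans (hex fun y => s'.2 y = s'.2 (g⁻¹ x) ∧
      (η y ≠ y ∨ (T.τ * η * T.τ) y ≠ y)).symm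
  · intro x y hx hy
    refine (h.orbit _ _ hx hy).trans ?_
    have h1 : T.localGroup (g * s'.1 * g⁻¹) (g * η * g⁻¹) =
        (T.localGroup s'.1 η).map (MulAut.conj g).toMonoidHom := by
      unfold localGroup
      rw [MonoidHom.map_closure, hη]
      congr 1
      simp [Set.image_insert_eq]
    change _ ↔ y ∈ MulAction.orbit (T.localGroup (g * s'.1 * g⁻¹) (g * η * g⁻¹)) x
    rw [h1]
    constructor
    · rintro ⟨⟨γ, hγ⟩, h2⟩
      have h2' : γ (g⁻¹ x) = g⁻¹ y := h2
      refine ⟨⟨_, Subgroup.mem_map_of_mem _ hγ⟩, ?_⟩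
      change (g * γ * g⁻¹) x = y
      rw [mul_apply, mul_apply, h2', apply_inv_apply]
    · rintro ⟨⟨_, γ, hγ, rfl⟩, rfl⟩
      refine ⟨⟨γ, hγ⟩, ?_⟩
      change γ (g⁻¹ x) = g⁻¹ ((g * γ * g⁻¹) x)
      simp

/-- The number of transitions that start at a labelled permutation does not depend on it. -/
theorem card_transition_eq [Finite α] {N : NodeData E V} {s t : Perm α × (α → E)}
    (hs : T.IsLabelled N.A s) (ht : T.IsLabelled N.A t) :
    Nat.card {q : Perm α × (Perm α × (α → E)) // T.IsTransition N s q.1 q.2} =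
      Nat.card {q : Perm α × (Perm α × (α → E)) // T.IsTransition N t q.1 q.2} := by
  obtain ⟨g, hg, rfl⟩ := hs.exists_conj ht
  have hg' : g⁻¹ * T.τ = T.τ * g⁻¹ := by
    rw [inv_mul_eq_iff_eq_mul, ← mul_assoc, hg]; group
  refine Nat.card_congr ⟨fun q => ⟨(g * q.1.1 * g⁻¹, conjState g q.1.2), q.2.conj hg⟩,
    fun q => ⟨(g⁻¹ * q.1.1 * g⁻¹⁻¹, conjState g⁻¹ q.1.2), ?_⟩, ?_, ?_⟩
  · have := q.2.conj hg'
    rwa [show TwistData.conjState g⁻¹ (g * s.1 * g⁻¹, fun a => s.2 (g⁻¹ a)) = s from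
      conjState_inv_conjState g s] at this
  · rintro ⟨⟨η, s'⟩, h⟩
    refine Subtype.ext (Prod.ext ?_ (conjState_inv_conjState g s'))
    change g⁻¹ * (g * η * g⁻¹) * g⁻¹⁻¹ = η
    group
  · rintro ⟨⟨η, s'⟩, h⟩
    refine Subtype.ext (Prod.ext ?_ ?_)
    · change g * (g⁻¹ * η * g⁻¹⁻¹) * g⁻¹ = η
      group
    · simpa using conjState_inv_conjState g⁻¹ s'

/-- Double counting of the transitions at a node. -/
theorem card_transition_mul [Finite α] [Finite E] {N : NodeData E V} {s : Perm α × (α → E)}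
    (hs : T.IsLabelled N.A s) {k : ℕ} (hk : ∀ s', T.IsLabelled N.B s' →
      Nat.card {q : Perm α × (Perm α × (α → E)) // T.IsTransition N.rev s' q.1 q.2} = k) :
    Nat.card {q : Perm α × (Perm α × (α → E)) // T.IsTransition N s q.1 q.2} *
      Nat.card {s // T.IsLabelled N.A s} = k * Nat.card {s // T.IsLabelled N.B s} := by
  have := Fintype.ofFinite {s // T.IsLabelled N.A s}
  have := Fintype.ofFinite {s // T.IsLabelled N.B s}
  -- The transitions at the node are counted once by their source and once by their target.
  have h1 : Nat.card (Σ s : {s // T.IsLabelled N.A s},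
      {q : Perm α × (Perm α × (α → E)) // T.IsTransition N s q.1 q.2}) =
      Nat.card (Σ s : {s // T.IsLabelled N.B s},
      {q : Perm α × (Perm α × (α → E)) // T.IsTransition N.rev s q.1 q.2}) :=
    Nat.card_congr ⟨fun z => ⟨⟨z.2.1.2, z.2.2.right⟩, ⟨(z.2.1.1, z.1.1), z.2.2.rev⟩⟩,
      fun z => ⟨⟨z.2.1.2, z.2.2.right⟩, ⟨(z.2.1.1, z.1.1), z.2.2.rev⟩⟩,
      fun z => rfl, fun z => rfl⟩
  rw [Nat.card_sigma, Nat.card_sigma, Finset.sum_congr rfl fun t _ => card_transition_eq t.2 hs,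
    Finset.sum_congr rfl fun t _ => hk _ t.2, Finset.sum_const, Finset.sum_const, smul_eq_mul,
    smul_eq_mul, Finset.card_univ, Finset.card_univ, ← Nat.card_eq_fintype_card,
    ← Nat.card_eq_fintype_card] at h1
  rw [mul_comm, h1, mul_comm]

end TwistData

end

section

/-! ### Counting the transitions at a node -/

open Equiv Equiv.Perm

namespace TwistData

variable {α E V : Type*} {T : TwistData α E} {N : NodeData E V}

theorem tau_mul_swap_mul_tau [DecidableEq α] (x y : α) :
    T.τ * swap x y * T.τ = swap (T.τ x) (T.τ y) := by
  rw [mul_swap_eq_swap_mul, mul_assoc, T.tau_mul_tau, mul_one]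

theorem conj_mul_mul {σ η : Perm α} (hσ : T.τ * σ * T.τ = σ⁻¹) (hη : η * η = 1) :
    T.τ * (η * σ * (T.τ * η * T.τ)) * T.τ = (η * σ * (T.τ * η * T.τ))⁻¹ := by
  have hη' : η⁻¹ = η := inv_eq_of_mul_eq_one_left hη
  have h3 : ∀ x, T.τ * (T.τ * x) = x := fun x => by rw [← mul_assoc, T.tau_mul_tau, one_mul]
  simp only [mul_inv_rev, ← hσ, T.tau_inv, hη', mul_assoc, T.tau_mul_tau, mul_one, h3]

theorem IsTransition.exists_eq_swap [DecidableEq α] {s s' : Perm α × (α → E)} {η : Perm α}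
    (h : T.IsTransition N s η s') : ∃ x y, x ≠ y ∧ T.τ x ≠ y ∧ η = swap x y := by
  obtain ⟨x, y, h1, h2, h3, h4, h5⟩ := h.exists_swap
  refine ⟨x, y, h1, h2, Equiv.ext fun z => ?_⟩
  by_cases hx : z = x
  · subst hx; simp [h4]
  by_cases hy : z = y
  · subst hy; simp [h5]
  rw [swap_apply_of_ne_of_ne hx hy]
  by_contra h
  rcases (h3 z).1 h with h | h
  · exact hx h
  · exact hy h

theorem swap_moves_iff [DecidableEq α] {x y : α} (hxy : x ≠ y) (z : α) :
    (swap x y z ≠ z ∨ (T.τ * swap x y * T.τ) z ≠ z) ↔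
      z = x ∨ z = y ∨ z = T.τ x ∨ z = T.τ y := by
  rw [tau_mul_swap_mul_tau, swap_apply_ne_self_iff, swap_apply_ne_self_iff]
  simp [hxy, or_assoc]

/-- The points moved by `η` and `τ η τ` only lead to points of the same two cycles. -/
theorem IsLabelled.orbit_swap_subset [Finite α] [DecidableEq α] {A : Set E}
    {s : Perm α × (α → E)} (hs : T.IsLabelled A s) {x y z : α}
    (hz : z ∈ MulAction.orbit (T.localGroup s.1 (swap x y)) x) :
    s.2 z = s.2 x ∨ s.2 z = s.2 y := by
  refine orbit_subset (S := {z | s.2 z = s.2 x ∨ s.2 z = s.2 y}) ?_ ?_ ?_ (Or.inl rfl) hz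
  · rintro z hz
    rwa [Set.mem_ofPred_eq, hs.apply]
  · rintro z hz
    by_cases hx : z = x
    · subst hx; simp
    by_cases hy : z = y
    · subst hy; simp
    rwa [swap_apply_of_ne_of_ne hx hy]
  · rintro z hz
    rw [tau_mul_swap_mul_tau]
    have h1 := T.inv_ne (s.2 x)
    have h2 := T.inv_ne (s.2 y)
    have h3 := T.inv_inv (s.2 x)
    have h4 := T.inv_inv (s.2 y)
    have hx' := hs.tau x
    have hy' := hs.tau y
    simp only [Set.mem_ofPred_eq] at hz ⊢
    -- If the cycle of `τ x` is one of the two, it can only be that of `y`, as `ι` fixes no label.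
    -- Then `τ y` lies on the cycle of `x`, so exchanging `τ x` and `τ y` stays inside. The next
    -- case is symmetric.
    by_cases hx : z = T.τ x
    · subst hx
      rw [swap_apply_left]
      grind
    by_cases hy : z = T.τ y
    · subst hy
      rw [swap_apply_right]
      grind
    rwa [swap_apply_of_ne_of_ne hx hy]

/-- At the node the edges `e₁`, `e₂` are joined to `e₃`, and so are their images. -/
structure IsJoin (T : TwistData α E) (N : NodeData E V) (e₁ e₂ e₃ : E) : Prop where
  mem_In : ∀ e, e ∈ N.In ↔ e = e₁ ∨ e = e₂ ∨ e = T.ι e₁ ∨ e = T.ι e₂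
  mem_Out : ∀ e, e ∈ N.Out ↔ e = e₃ ∨ e = T.ι e₃
  In_subset : N.In ⊆ N.A
  Out_subset : N.Out ⊆ N.B
  stay : ∀ e, (e ∈ N.A ∧ e ∉ N.In) ↔ (e ∈ N.B ∧ e ∉ N.Out)
  ne : e₁ ≠ e₂
  tgt₁ : N.tgt e₁ = N.src e₃
  tgt₂ : N.tgt e₂ = N.src e₃
  tgt₁' : N.tgt (T.ι e₁) = N.src (T.ι e₃)
  tgt₂' : N.tgt (T.ι e₂) = N.src (T.ι e₃)
  src_ne : N.src e₃ ≠ N.src (T.ι e₃)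
  w : T.w e₃ = T.w e₁ + T.w e₂

namespace IsJoin

variable {e₁ e₂ e₃ : E}

theorem inv (J : T.IsJoin N e₁ e₂ e₃) : T.IsJoin N (T.ι e₁) (T.ι e₂) (T.ι e₃) where
  mem_In e := by rw [J.mem_In, T.inv_inv, T.inv_inv]; tauto
  mem_Out e := by rw [J.mem_Out, T.inv_inv]; tauto
  In_subset := J.In_subset
  Out_subset := J.Out_subset
  stay := J.stay
  ne h := J.ne (by rw [← T.inv_inv e₁, h, T.inv_inv])
  tgt₁ := J.tgt₁'
  tgt₂ := J.tgt₂'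
  tgt₁' := by rw [T.inv_inv, T.inv_inv, J.tgt₁]
  tgt₂' := by rw [T.inv_inv, T.inv_inv, J.tgt₂]
  src_ne := by rw [T.inv_inv]; exact J.src_ne.symm
  w := by rw [T.w_inv, T.w_inv, T.w_inv, J.w]

/-- The edges `e₁` and `ι e₂` end at the two different vertices of the join. -/
theorem ne' (J : T.IsJoin N e₁ e₂ e₃) : e₁ ≠ T.ι e₂ := fun h => by
  apply J.src_ne
  rw [← J.tgt₁, h, J.tgt₂']

/-- The labelling after the join. -/
structure IsMerge (T : TwistData α E) (N : NodeData E V) (e₁ e₂ e₃ : E) (f f' : α → E) : Prop where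
  eq₁ : ∀ x, f x = e₁ ∨ f x = e₂ → f' x = e₃
  eq₂ : ∀ x, f x = T.ι e₁ ∨ f x = T.ι e₂ → f' x = T.ι e₃
  eq₃ : ∀ x, f x ∉ N.In → f' x = f x

theorem IsMerge.inv {f f' : α → E} (h : IsMerge T N e₁ e₂ e₃ f f') :
    IsMerge T N (T.ι e₁) (T.ι e₂) (T.ι e₃) f f' :=
  ⟨h.eq₂, by simpa only [T.inv_inv] using h.eq₁, h.eq₃⟩

/-- The right factor `swap (τ x) (τ y)` joins the cycles labelled `ι e₁` and `ι e₂`. This leaves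
those of `x` and `y` apart and unchanged, so the left factor joins them in turn. The new labelling
has exactly the resulting cycles as fibres. -/
theorem isTransition_aux [Finite α] [DecidableEq α] (J : T.IsJoin N e₁ e₂ e₃)
    {s : Perm α × (α → E)} (hs : T.IsLabelled N.A s) {f' : α → E}
    (hf : IsMerge T N e₁ e₂ e₃ s.2 f') {x y : α} (hx : s.2 x = e₁) (hy : s.2 y = e₂) :
    T.IsTransition N s (swap x y) (swap x y * s.1 * (T.τ * swap x y * T.τ), f') := by
  have hx' : s.2 (T.τ x) = T.ι e₁ := by rw [hs.tau, hx]
  have hy' : s.2 (T.τ y) = T.ι e₂ := by rw [hs.tau, hy]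
  have d1 := J.ne
  have d2 := J.ne'
  have d3 := T.inv_ne e₁
  have d4 := T.inv_ne e₂
  have d5 := J.inv.ne
  have d6 : e₂ ≠ T.ι e₁ := fun h => d2 (by rw [h, T.inv_inv])
  have d7 := T.inv_ne e₃
  have hxy : x ≠ y := fun h => d1 (by rw [← hx, h, hy])
  have hIn := J.mem_In
  have hOut := J.mem_Out
  have hstay : ∀ a, s.2 a ∉ N.In → s.2 a ∉ N.Out := fun a h =>
    ((J.stay _).1 ⟨hs.mem a, h⟩).2
  -- values of the new labelling
  have hval : ∀ a, ((s.2 a = e₁ ∨ s.2 a = e₂) ∧ f' a = e₃) ∨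
      ((s.2 a = T.ι e₁ ∨ s.2 a = T.ι e₂) ∧ f' a = T.ι e₃) ∨
      (s.2 a ∉ N.In ∧ s.2 a ∉ N.Out ∧ f' a = s.2 a) := by
    intro a
    by_cases h : s.2 a ∈ N.In
    · rcases (hIn _).1 h with h | h | h | h
      · exact Or.inl ⟨Or.inl h, hf.eq₁ a (Or.inl h)⟩
      · exact Or.inl ⟨Or.inr h, hf.eq₁ a (Or.inr h)⟩
      · exact Or.inr (Or.inl ⟨Or.inl h, hf.eq₂ a (Or.inl h)⟩)
      · exact Or.inr (Or.inl ⟨Or.inr h, hf.eq₂ a (Or.inr h)⟩)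
    · exact Or.inr (Or.inr ⟨h, hstay a h, hf.eq₃ a h⟩)
  have hOutIn : ∀ a, f' a ∈ N.Out ↔ s.2 a ∈ N.In := by
    intro a
    rcases hval a with ⟨h, h'⟩ | ⟨h, h'⟩ | ⟨h, h', h''⟩
    · simp only [hIn, hOut, h']
      tauto
    · simp only [hIn, hOut, h']
      tauto
    · rw [h'']; tauto
  have hSC1 : ∀ a b, (s.1 * swap (T.τ x) (T.τ y)).SameCycle a b ↔ s.2 a = s.2 b ∨
      ((s.2 a = T.ι e₁ ∨ s.2 a = T.ι e₂) ∧ (s.2 b = T.ι e₁ ∨ s.2 b = T.ι e₂)) := by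
    intro a b
    have h : ¬ s.1.SameCycle (T.τ x) (T.τ y) := by rw [← hs.sameCycle, hx', hy']; exact d5
    rw [sameCycle_mul_swap_iff h]
    simp only [← hs.sameCycle, hx', hy', eq_comm (a := T.ι e₁), eq_comm (a := T.ι e₂)]
  have hSC : ∀ a b, f' a = f' b ↔
      (swap x y * s.1 * (T.τ * swap x y * T.τ)).SameCycle a b := by
    intro a b
    have h : ¬ (s.1 * swap (T.τ x) (T.τ y)).SameCycle x y := by
      rw [hSC1, hx, hy]
      tauto
    rw [tau_mul_swap_mul_tau, mul_assoc, sameCycle_swap_mul_iff h]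
    simp only [hSC1, hx, hy]
    have ha := hval a
    have hb := hval b
    simp only [hIn, hOut] at ha hb
    grind
  refine ⟨hs, ⟨conj_mul_mul hs.conj (swap_mul_self x y), hSC, ?_, ?_, ?_⟩, rfl,
    ⟨x, y, hxy, ?_, ?_, swap_apply_left x y, swap_apply_right x y⟩, ?_, ?_, hf.eq₃, ?_, ?_, ?_, ?_⟩
  · intro a
    have h1 := hs.tau a
    have h2 := T.inv_inv (s.2 a)
    have h3 := T.inv_inv e₁
    have h4 := T.inv_inv e₂
    have h5 := T.inv_inv e₃
    have ha := hval a
    have hb := hval (T.τ a)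
    simp only [hIn, hOut] at ha hb
    change f' (T.τ a) = T.ι (f' a)
    grind
  · intro a
    change f' a ∈ N.B
    rcases hval a with ⟨h, h'⟩ | ⟨h, h'⟩ | ⟨h, h', h''⟩
    · rw [h']; exact J.Out_subset ((hOut _).2 (Or.inl rfl))
    · rw [h']; exact J.Out_subset ((hOut _).2 (Or.inr rfl))
    · rw [h'']; exact ((J.stay _).1 ⟨hs.mem a, h⟩).1
  · intro e he
    change {a | f' a = e}.ncard = T.w e
    have hmemIn : ∀ e, e = e₁ ∨ e = e₂ ∨ e = T.ι e₁ ∨ e = T.ι e₂ → e ∈ N.A := fun e h =>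
      J.In_subset ((hIn e).2 h)
    by_cases h : e ∈ N.Out
    · rcases (hOut e).1 h with rfl | rfl
      · have : {a | f' a = e} = {a | s.2 a = e₁} ∪ {a | s.2 a = e₂} := by
          ext a
          have ha := hval a
          simp only [hIn, hOut] at ha
          simp only [Set.mem_ofPred_eq, Set.mem_union]
          grind
        rw [this, Set.ncard_union_eq ?_ (Set.toFinite _) (Set.toFinite _), J.w,
          hs.ncard _ (hmemIn _ (Or.inl rfl)), hs.ncard _ (hmemIn _ (Or.inr (Or.inl rfl)))]
        rw [Set.disjoint_left]
        intro a h1 h2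
        exact d1 (h1.symm.trans h2)
      · have : {a | f' a = T.ι e₃} = {a | s.2 a = T.ι e₁} ∪ {a | s.2 a = T.ι e₂} := by
          ext a
          have ha := hval a
          simp only [hIn, hOut] at ha
          simp only [Set.mem_ofPred_eq, Set.mem_union]
          grind
        rw [this, Set.ncard_union_eq ?_ (Set.toFinite _) (Set.toFinite _), J.inv.w,
          hs.ncard _ (hmemIn _ (by tauto)), hs.ncard _ (hmemIn _ (by tauto))]
        rw [Set.disjoint_left]
        intro a h1 h2
        exact d5 (h1.symm.trans h2)
    · have h2 := (J.stay e).2 ⟨he, h⟩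
      rw [← hs.ncard e h2.1]
      congr 1
      ext a
      have ha := hval a
      have h3 := h2.2
      simp only [hIn, hOut] at ha h3 h
      simp only [Set.mem_ofPred_eq]
      grind
  · intro h
    exact d6 (by rw [← hx', h, hy])
  · intro z
    rw [swap_apply_ne_self_iff]
    simp [hxy]
  · intro a
    simp only [swap_moves_iff hxy, hIn]
    constructor
    · rintro (h | h | h | h)
      · exact ⟨x, by rw [h, hx], by tauto⟩
      · exact ⟨y, by rw [h, hy], by tauto⟩
      · exact ⟨T.τ x, by rw [h, hx'], by tauto⟩
      · exact ⟨T.τ y, by rw [h, hy'], by tauto⟩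
    · rintro ⟨z, h, rfl | rfl | rfl | rfl⟩
      · rw [← h]; tauto
      · rw [← h]; tauto
      · rw [← h]; tauto
      · rw [← h]; tauto
  · intro a
    simp only [swap_moves_iff hxy, hOut]
    have h1 := hf.eq₁ x (Or.inl hx)
    have h2 := hf.eq₁ y (Or.inr hy)
    have h3 := hf.eq₂ _ (Or.inl hx')
    have h4 := hf.eq₂ _ (Or.inr hy')
    constructor
    · rintro (h | h)
      · exact ⟨x, by rw [h, h1], by tauto⟩
      · exact ⟨T.τ x, by rw [h, h3], by tauto⟩
    · rintro ⟨z, h, rfl | rfl | rfl | rfl⟩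
      · rw [← h]; tauto
      · rw [← h]; tauto
      · rw [← h]; tauto
      · rw [← h]; tauto
  · intro a h
    exact hf.eq₃ a (by rwa [hOutIn] at h)
  · intro a h
    refine ⟨(hOutIn a).2 h, ?_⟩
    change N.src (f' a) = _
    rcases (hIn _).1 h with h | h | h | h
    · rw [hf.eq₁ a (Or.inl h), h, J.tgt₁]
    · rw [hf.eq₁ a (Or.inr h), h, J.tgt₂]
    · rw [hf.eq₂ a (Or.inl h), h, J.tgt₁']
    · rw [hf.eq₂ a (Or.inr h), h, J.tgt₂']
  · intro a h
    have h := (hOutIn a).1 h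
    refine ⟨h, ?_⟩
    change _ = N.src (f' a)
    rcases (hIn _).1 h with h | h | h | h
    · rw [hf.eq₁ a (Or.inl h), h, J.tgt₁]
    · rw [hf.eq₁ a (Or.inr h), h, J.tgt₂]
    · rw [hf.eq₂ a (Or.inl h), h, J.tgt₁']
    · rw [hf.eq₂ a (Or.inr h), h, J.tgt₂']
  · intro a b ha hb
    have htgt : ∀ c, s.2 c ∈ N.In → N.tgt (s.2 c) = N.src (f' c) := by
      intro c h
      rcases (hIn _).1 h with h | h | h | h
      · rw [hf.eq₁ c (Or.inl h), h, J.tgt₁]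
      · rw [hf.eq₁ c (Or.inr h), h, J.tgt₂]
      · rw [hf.eq₂ c (Or.inl h), h, J.tgt₁']
      · rw [hf.eq₂ c (Or.inr h), h, J.tgt₂']
    constructor
    · intro h
      refine sameCycle_mem_orbit ((hSC a b).1 ?_)
      rw [htgt a ha, htgt b hb] at h
      have := J.src_ne
      rcases (hOut _).1 ((hOutIn a).2 ha) with h1 | h1 <;>
        rcases (hOut _).1 ((hOutIn b).2 hb) with h2 | h2 <;> rw [h1, h2] at h ⊢
      · exact absurd h this
      · exact absurd h.symm this
    · intro h
      -- Each fibre of `f'` is stable under both transpositions and the new permutation, so an orbit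
      -- cannot connect the two vertices.
      have h5 : ∀ z, f' z = f' a → f' (swap x y z) = f' a := by
        intro z hz
        by_cases h1 : z = x
        · subst h1
          rw [swap_apply_left, ← hz, hf.eq₁ _ (Or.inl hx), hf.eq₁ _ (Or.inr hy)]
        by_cases h2 : z = y
        · subst h2
          rw [swap_apply_right, ← hz, hf.eq₁ _ (Or.inl hx), hf.eq₁ _ (Or.inr hy)]
        rwa [swap_apply_of_ne_of_ne h1 h2]
      have h6 : ∀ z, f' z = f' a → f' (swap (T.τ x) (T.τ y) z) = f' a := by
        intro z hz
        by_cases h1 : z = T.τ x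
        · subst h1
          rw [swap_apply_left, ← hz, hf.eq₂ _ (Or.inl hx'), hf.eq₂ _ (Or.inr hy')]
        by_cases h2 : z = T.τ y
        · subst h2
          rw [swap_apply_right, ← hz, hf.eq₂ _ (Or.inl hx'), hf.eq₂ _ (Or.inr hy')]
        rwa [swap_apply_of_ne_of_ne h1 h2]
      have h7 := orbit_subset (S := {z | f' z = f' a}) (fun z hz => by
        rw [Set.mem_ofPred_eq, ← show f' z = f' a from hz, hSC]
        exact sameCycle_apply_left.2 (SameCycle.refl _ _)) h5 (by rw [tau_mul_swap_mul_tau]; exact h6) rfl h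
      rw [htgt a ha, htgt b hb, show f' b = f' a from h7]

theorem isTransition [Finite α] [DecidableEq α] (J : T.IsJoin N e₁ e₂ e₃)
    {s : Perm α × (α → E)} (hs : T.IsLabelled N.A s) {f' : α → E}
    (hf : IsMerge T N e₁ e₂ e₃ s.2 f') {x y : α}
    (h : s.2 x = e₁ ∧ s.2 y = e₂ ∨ s.2 x = T.ι e₁ ∧ s.2 y = T.ι e₂) :
    T.IsTransition N s (swap x y) (swap x y * s.1 * (T.τ * swap x y * T.τ), f') := by
  rcases h with h | h
  · exact J.isTransition_aux hs hf h.1 h.2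
  · exact J.inv.isTransition_aux hs hf.inv h.1 h.2

/-- The two outgoing edges start at different vertices, so incidence determines the new labels. The
orbit of a point `x` moved by `η` must contain both incoming cycles at its vertex. It meets only the
cycles of `x` and `η x`, so `η x` lies on the partner of the cycle of `x`. -/
theorem exists_of_isTransition [Finite α] [DecidableEq α] (J : T.IsJoin N e₁ e₂ e₃)
    {s s' : Perm α × (α → E)} {η : Perm α} (h : T.IsTransition N s η s') :
    IsMerge T N e₁ e₂ e₃ s.2 s'.2 ∧ ∃ x y,
      (s.2 x = e₁ ∧ s.2 y = e₂ ∨ s.2 x = T.ι e₁ ∧ s.2 y = T.ι e₂) ∧ η = swap x y := by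
  have hIn := J.mem_In
  have hOut := J.mem_Out
  refine ⟨⟨?_, ?_, h.eq_of_notMem_In⟩, ?_⟩
  · intro x hx
    have h1 := h.src_eq x ((hIn _).2 (by tauto))
    refine ((hOut _).1 h1.1).resolve_right fun h2 => J.src_ne ?_
    rw [← h2, h1.2]
    rcases hx with hx | hx <;> rw [hx]
    · exact J.tgt₁.symm
    · exact J.tgt₂.symm
  · intro x hx
    have h1 := h.src_eq x ((hIn _).2 (by tauto))
    refine ((hOut _).1 h1.1).resolve_left fun h2 => J.src_ne ?_
    rw [show N.src e₃ = N.tgt (s.2 x) by rw [← h1.2, h2]]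
    rcases hx with hx | hx <;> rw [hx]
    · exact J.tgt₁'
    · exact J.tgt₂'
  · obtain ⟨x, y, hxy, -, rfl⟩ := h.exists_eq_swap
    have hxIn : s.2 x ∈ N.In := (h.mem_In x).2 ⟨x, rfl, (swap_moves_iff hxy x).2 (by tauto)⟩
    have key : ∀ e, e ∈ N.In → N.tgt e = N.tgt (s.2 x) → e ≠ s.2 x → s.2 y = e := by
      intro e he h1 h2
      obtain ⟨z, rfl⟩ := h.left.exists_eq (J.In_subset he)
      have h3 := (h.orbit x z hxIn he).1 h1.symm
      rw [localGroup_eq h.eq_mul] at h3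
      exact ((h.left.orbit_swap_subset h3).resolve_left h2).symm
    rcases (hIn _).1 hxIn with hx | hx | hx | hx
    · refine ⟨x, y, Or.inl ⟨hx, key e₂ ((hIn _).2 (by tauto)) ?_ ?_⟩, rfl⟩
      · rw [hx, J.tgt₁, J.tgt₂]
      · rw [hx]; exact J.ne.symm
    · refine ⟨y, x, Or.inl ⟨key e₁ ((hIn _).2 (by tauto)) ?_ ?_, hx⟩, swap_comm _ _⟩
      · rw [hx, J.tgt₁, J.tgt₂]
      · rw [hx]; exact J.ne
    · refine ⟨x, y, Or.inr ⟨hx, key (T.ι e₂) ((hIn _).2 (by tauto)) ?_ ?_⟩, rfl⟩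
      · rw [hx, J.tgt₁', J.tgt₂']
      · rw [hx]; exact J.inv.ne.symm
    · refine ⟨y, x, Or.inr ⟨key (T.ι e₁) ((hIn _).2 (by tauto)) ?_ ?_, hx⟩, swap_comm _ _⟩
      · rw [hx, J.tgt₁', J.tgt₂']
      · rw [hx]; exact J.inv.ne

theorem exists_isMerge (J : T.IsJoin N e₁ e₂ e₃) (f : α → E) :
    ∃ f', IsMerge T N e₁ e₂ e₃ f f' := by
  classical
  have d2 := J.ne'
  have d3 := T.inv_ne e₁
  have d4 := T.inv_ne e₂
  have d6 : e₂ ≠ T.ι e₁ := fun h => d2 (by rw [h, T.inv_inv])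
  refine ⟨fun x => if f x = e₁ ∨ f x = e₂ then e₃ else
    if f x = T.ι e₁ ∨ f x = T.ι e₂ then T.ι e₃ else f x, ?_, ?_, ?_⟩
  · intro x hx
    simp [hx]
  · intro x hx
    have : ¬ (f x = e₁ ∨ f x = e₂) := by grind
    simp [hx, this]
  · intro x hx
    rw [J.mem_In] at hx
    have h1 : ¬ (f x = e₁ ∨ f x = e₂) := by tauto
    have h2 : ¬ (f x = T.ι e₁ ∨ f x = T.ι e₂) := by tauto
    simp [h1, h2]

theorem IsMerge.unique (J : T.IsJoin N e₁ e₂ e₃) {f f' f'' : α → E}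
    (h' : IsMerge T N e₁ e₂ e₃ f f') (h'' : IsMerge T N e₁ e₂ e₃ f f'') : f' = f'' := by
  funext x
  by_cases h : f x ∈ N.In
  · rcases (J.mem_In _).1 h with h | h | h | h
    · rw [h'.eq₁ x (by tauto), h''.eq₁ x (by tauto)]
    · rw [h'.eq₁ x (by tauto), h''.eq₁ x (by tauto)]
    · rw [h'.eq₂ x (by tauto), h''.eq₂ x (by tauto)]
    · rw [h'.eq₂ x (by tauto), h''.eq₂ x (by tauto)]
  · rw [h'.eq₃ x h, h''.eq₃ x h]

/-- A transition is given by a point on each of `e₁` and `e₂`, or on each of `ι e₁` and `ι e₂`. The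
relabelling is forced, and the order of the two points can be recovered from their labels, so
different choices give different transpositions. -/
theorem card_transition [Finite α] (J : T.IsJoin N e₁ e₂ e₃)
    {s : Perm α × (α → E)} (hs : T.IsLabelled N.A s) :
    Nat.card {q : Perm α × (Perm α × (α → E)) // T.IsTransition N s q.1 q.2} =
      2 * (T.w e₁ * T.w e₂) := by
  classical
  obtain ⟨f', hf⟩ := J.exists_isMerge s.2
  have d1 := J.ne
  have d2 := J.ne'
  have d3 := T.inv_ne e₁
  have d4 := T.inv_ne e₂
  have d5 := J.inv.ne
  have d6 : e₂ ≠ T.ι e₁ := fun h => d2 (by rw [h, T.inv_inv])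
  let P : Set (α × α) := {p | s.2 p.1 = e₁ ∧ s.2 p.2 = e₂ ∨ s.2 p.1 = T.ι e₁ ∧ s.2 p.2 = T.ι e₂}
  let F : P → {q : Perm α × (Perm α × (α → E)) // T.IsTransition N s q.1 q.2} := fun p =>
    ⟨(swap p.1.1 p.1.2, (swap p.1.1 p.1.2 * s.1 * (T.τ * swap p.1.1 p.1.2 * T.τ), f')),
      J.isTransition hs hf p.2⟩
  have hF : Function.Bijective F := by
    constructor
    · rintro ⟨⟨x, y⟩, h⟩ ⟨⟨x', y'⟩, h'⟩ hh
      have h1 : swap x y = swap x' y' := congrArg (fun q => q.1.1) hh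
      simp only [P, Set.mem_ofPred_eq] at h h'
      have hxy : x ≠ y := by rintro rfl; grind
      have hxy' : x' ≠ y' := by rintro rfl; grind
      have h2 : swap x' y' x ≠ x := by rw [← h1, swap_apply_left]; exact hxy.symm
      have h3 := (swap_apply_ne_self_iff.1 h2).2
      have h4 : swap x' y' x = y := by rw [← h1, swap_apply_left]
      rcases h3 with rfl | rfl
      · rw [swap_apply_left] at h4
        subst h4
        rfl
      · grind
    · rintro ⟨⟨η, s'⟩, h⟩
      obtain ⟨hm, x, y, hxy, rfl⟩ := J.exists_of_isTransition h
      refine ⟨⟨(x, y), hxy⟩, Subtype.ext (Prod.ext rfl ?_)⟩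
      exact (J.isTransition hs hf hxy).ext_left h (IsMerge.unique J hf hm)
  rw [← Nat.card_congr (Equiv.ofBijective F hF), Nat.card_coe_set_eq]
  have hP : P = ({x | s.2 x = e₁} ×ˢ {x | s.2 x = e₂}) ∪
      ({x | s.2 x = T.ι e₁} ×ˢ {x | s.2 x = T.ι e₂}) := by
    ext ⟨x, y⟩
    simp [P]
  have hA : ∀ e, e = e₁ ∨ e = e₂ ∨ e = T.ι e₁ ∨ e = T.ι e₂ → e ∈ N.A := fun e h =>
      J.In_subset ((J.mem_In e).2 h)
  rw [hP, Set.ncard_union_eq ?_ (Set.toFinite _) (Set.toFinite _), Set.ncard_prod, Set.ncard_prod,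
    hs.ncard _ (hA _ (by tauto)), hs.ncard _ (hA _ (by tauto)), hs.ncard _ (hA _ (by tauto)),
    hs.ncard _ (hA _ (by tauto)), T.w_inv, T.w_inv]
  · ring
  · rw [Set.disjoint_left]
    rintro ⟨x, y⟩ h1 h2
    exact d3 (h2.1.symm.trans h1.1)

end IsJoin

end TwistData

end

/-! ### Rearrangements of two cycles at a `4`-valent vertex -/

section

open Equiv Equiv.Perm

namespace TwistData

variable {α E V : Type*} {T : TwistData α E} {N : NodeData E V}

/-- At the node the edges `e₁`, `ι e₁` end and the edges `e₂`, `ι e₂` of the same weight start, all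
at the same vertex. -/
structure IsRearrangement (T : TwistData α E) (N : NodeData E V) (e₁ e₂ : E) : Prop where
  mem_In : ∀ e, e ∈ N.In ↔ e = e₁ ∨ e = T.ι e₁
  mem_Out : ∀ e, e ∈ N.Out ↔ e = e₂ ∨ e = T.ι e₂
  In_subset : N.In ⊆ N.A
  Out_subset : N.Out ⊆ N.B
  stay : ∀ e, (e ∈ N.A ∧ e ∉ N.In) ↔ (e ∈ N.B ∧ e ∉ N.Out)
  tgt_eq_src : ∀ e ∈ N.In, ∀ e' ∈ N.Out, N.tgt e = N.src e'
  w : T.w e₁ = T.w e₂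

namespace IsRearrangement

variable {e₁ e₂ : E}

/-- The labelling `f'` after the rearrangement of two cycles to those of `σ'`, when the cycle of `x`
gets the label `e`. -/
structure IsRelabelling (T : TwistData α E) (N : NodeData E V) (f : α → E) (σ' : Perm α) (x : α)
    (e : E) (f' : α → E) : Prop where
  eq₁ : ∀ a, f a ∈ N.In → σ'.SameCycle x a → f' a = e
  eq₂ : ∀ a, f a ∈ N.In → ¬ σ'.SameCycle x a → f' a = T.ι e
  eq₃ : ∀ a, f a ∉ N.In → f' a = f a

theorem exists_isRelabelling (f : α → E) (σ' : Perm α) (x : α) (e : E) :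
    ∃ f', IsRelabelling T N f σ' x e f' := by
  classical
  refine ⟨fun a => if f a ∈ N.In then (if σ'.SameCycle x a then e else T.ι e) else f a, ?_, ?_, ?_⟩
  · intro a h h'
    simp [h, h']
  · intro a h h'
    simp [h, h']
  · intro a h
    simp [h]

theorem IsRelabelling.unique {f : α → E} {σ' : Perm α} {x : α} {e : E} {f' f'' : α → E}
    (h' : IsRelabelling T N f σ' x e f') (h'' : IsRelabelling T N f σ' x e f'') : f' = f'' := by
  funext a
  by_cases h : f a ∈ N.In
  · by_cases hx : σ'.SameCycle x a
    · rw [h'.eq₁ a h hx, h''.eq₁ a h hx]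
    · rw [h'.eq₂ a h hx, h''.eq₂ a h hx]
  · rw [h'.eq₃ a h, h''.eq₃ a h]

section

variable [Finite α] [DecidableEq α] (J : T.IsRearrangement N e₁ e₂)
    {s : Perm α × (α → E)} (hs : T.IsLabelled N.A s) {x y : α} (hx : s.2 x = e₁)
    (hy : s.2 y = T.ι e₁)
include J hs hx hy

/-- The right factor `swap (τ x) (τ y)` joins the two incoming cycles into one, and the left factor
cuts it again so that `x` and `y` are separated. The new cycles of `x` and `y` therefore fill the
same set of points as the old ones. -/
theorem sameCycle_iff :
    ¬ (swap x y * s.1 * (T.τ * swap x y * T.τ)).SameCycle x y ∧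
    (∀ a, s.2 a ∈ N.In ↔ (swap x y * s.1 * (T.τ * swap x y * T.τ)).SameCycle x a ∨
      (swap x y * s.1 * (T.τ * swap x y * T.τ)).SameCycle y a) ∧
    ∀ a b, s.2 a ∉ N.In → (s.2 a = s.2 b ↔
      (swap x y * s.1 * (T.τ * swap x y * T.τ)).SameCycle a b) := by
  have hx' : s.2 (T.τ x) = T.ι e₁ := by rw [hs.tau, hx]
  have hy' : s.2 (T.τ y) = e₁ := by rw [hs.tau, hy, T.inv_inv]
  have d3 := T.inv_ne e₁
  have hxy : x ≠ y := fun h => d3 (by rw [← hy, ← h, hx])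
  have hIn := J.mem_In
  rw [tau_mul_swap_mul_tau, mul_assoc]
  have hSC1 : ∀ a b, (s.1 * swap (T.τ x) (T.τ y)).SameCycle a b ↔ s.2 a = s.2 b ∨
      (s.2 a ∈ N.In ∧ s.2 b ∈ N.In) := by
    intro a b
    have h : ¬ s.1.SameCycle (T.τ x) (T.τ y) := by rw [← hs.sameCycle, hx', hy']; exact d3
    rw [sameCycle_mul_swap_iff h]
    simp only [← hs.sameCycle, hx', hy', hIn]
    grind
  have hxIn : s.2 x ∈ N.In := (hIn _).2 (Or.inl hx)
  have hyIn : s.2 y ∈ N.In := (hIn _).2 (Or.inr hy)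
  have h1 := not_sameCycle_swap_mul ((hSC1 x y).2 (Or.inr ⟨hxIn, hyIn⟩)) hxy
  have h2 := fun a b => sameCycle_swap_mul_iff h1 (a := a) (b := b)
  simp only [swap_mul_self_mul] at h2
  have h3 : ∀ a, s.2 a ∈ N.In ↔
      (swap x y * (s.1 * swap (T.τ x) (T.τ y))).SameCycle x a ∨
      (swap x y * (s.1 * swap (T.τ x) (T.τ y))).SameCycle y a := by
    intro a
    have h4 := h2 x a
    rw [hSC1] at h4
    simp only [hxIn, true_and, SameCycle.refl, true_or] at h4
    constructor
    · intro ha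
      rcases h4.1 (Or.inr ha) with h | h
      · exact Or.inl h
      · exact h
    · intro ha
      rcases h4.2 (Or.inr ha) with h | h
      · rwa [← h]
      · exact h
  refine ⟨h1, h3, ?_⟩
  intro a b ha
  have h4 := h2 a b
  rw [hSC1, ← h3] at h4
  simp only [ha, false_and, or_false] at h4
  exact h4

/-- No cycle of the new permutation is preserved by `τ`, so `τ` exchanges the two new cycles and
they have equal length. Hence either outgoing edge may label the cycle of `x`. -/
theorem isTransition (hne : T.τ x ≠ y) {e : E} (he : e ∈ N.Out) {f' : α → E}
    (hf : IsRelabelling T N s.2 (swap x y * s.1 * (T.τ * swap x y * T.τ)) x e f') :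
    T.IsTransition N s (swap x y) (swap x y * s.1 * (T.τ * swap x y * T.τ), f') := by
  obtain ⟨h1, h2, h3⟩ := J.sameCycle_iff hs hx hy
  have hx' : s.2 (T.τ x) = T.ι e₁ := by rw [hs.tau, hx]
  have hy' : s.2 (T.τ y) = e₁ := by rw [hs.tau, hy, T.inv_inv]
  have d3 := T.inv_ne e₁
  have hxy : x ≠ y := fun h => d3 (by rw [← hy, ← h, hx])
  have hIn := J.mem_In
  have hOut : ∀ e', e' ∈ N.Out ↔ e' = e ∨ e' = T.ι e := by
    have hOut := J.mem_Out
    intro e'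
    rw [hOut]
    rcases (hOut e).1 he with rfl | rfl
    · rfl
    · rw [T.inv_inv]; tauto
  have hconj := conj_mul_mul hs.conj (swap_mul_self x y)
  set σ' := swap x y * s.1 * (T.τ * swap x y * T.τ) with hσ'
  -- A fixed point `z` of `σ' τ` would make `η z` a fixed point of `σ τ`, and then its label would
  -- be fixed by `ι`.
  have hself : ∀ z, ¬ σ'.SameCycle z (T.τ z) := by
    refine not_sameCycle_apply_of_conj_eq_inv T.tau_mul_tau T.tau_ne hconj fun z hz => ?_
    have h4 : s.1 (T.τ (swap x y z)) = swap x y z := by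
      have : swap x y (s.1 (T.τ (swap x y (T.τ (T.τ z))))) = z := hz
      rw [T.tau_tau] at this
      have := congrArg (swap x y) this
      rwa [swap_apply_self] at this
    have h5 := hs.apply (T.τ (swap x y z))
    rw [h4, hs.tau] at h5
    exact T.inv_ne _ h5.symm
  have hxIn : s.2 x ∈ N.In := (hIn _).2 (Or.inl hx)
  have hyIn : s.2 y ∈ N.In := (hIn _).2 (Or.inr hy)
  have hx'In : s.2 (T.τ x) ∈ N.In := (hIn _).2 (Or.inr hx')
  have hy'In : s.2 (T.τ y) ∈ N.In := (hIn _).2 (Or.inl hy')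
  have hstay : ∀ a, s.2 a ∉ N.In → s.2 a ∉ N.Out := fun a h =>
    ((J.stay _).1 ⟨hs.mem a, h⟩).2
  have hde := T.inv_ne e
  have hee := T.inv_inv e
  have hval : ∀ a, (s.2 a ∈ N.In ∧ σ'.SameCycle x a ∧ ¬ σ'.SameCycle y a ∧ f' a = e) ∨
      (s.2 a ∈ N.In ∧ ¬ σ'.SameCycle x a ∧ σ'.SameCycle y a ∧ f' a = T.ι e) ∨
      (s.2 a ∉ N.In ∧ s.2 a ∉ N.Out ∧ ¬ σ'.SameCycle x a ∧ ¬ σ'.SameCycle y a ∧ f' a = s.2 a) := by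
    intro a
    by_cases ha : s.2 a ∈ N.In
    · by_cases hxa : σ'.SameCycle x a
      · exact Or.inl ⟨ha, hxa, fun hya => h1 (hxa.trans hya.symm), hf.eq₁ a ha hxa⟩
      · exact Or.inr (Or.inl ⟨ha, hxa, ((h2 a).1 ha).resolve_left hxa, hf.eq₂ a ha hxa⟩)
    · have := fun h => ha ((h2 a).2 h)
      exact Or.inr (Or.inr ⟨ha, hstay a ha, by tauto, by tauto, hf.eq₃ a ha⟩)
  have hOutIn : ∀ a, f' a ∈ N.Out ↔ s.2 a ∈ N.In := by
    intro a
    have := hval a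
    have := hOut (f' a)
    grind
  have hInTau : ∀ a, s.2 a ∈ N.In → s.2 (T.τ a) ∈ N.In := by
    intro a ha
    rw [hs.tau, hIn]
    rcases (hIn _).1 ha with h | h
    · rw [h]; tauto
    · rw [h, T.inv_inv]; tauto
  have htau : ∀ a, f' (T.τ a) = T.ι (f' a) := by
    intro a
    by_cases ha : s.2 a ∈ N.In
    · have h4 := hInTau a ha
      have h5 := hself a
      rcases hval a with h | h | h
      · rw [h.2.2.2]
        exact hf.eq₂ _ h4 fun h6 => h5 (h.2.1.symm.trans h6)
      · rw [h.2.2.2, T.inv_inv]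
        refine hf.eq₁ _ h4 (((h2 _).1 h4).resolve_right fun h6 => h5 (h.2.2.1.symm.trans h6))
      · exact absurd ha h.1
    · have h4 : s.2 (T.τ a) ∉ N.In := fun h => ha (by
        have := hInTau _ h
        rwa [T.tau_tau] at this)
      rw [hf.eq₃ a ha, hf.eq₃ _ h4, hs.tau]
  -- The two new fibres have equal size because `τ` exchanges them, and together they are as large
  -- as the two old cycles.
  have hcard : {a | f' a = e}.ncard = T.w e ∧ {a | f' a = T.ι e}.ncard = T.w e := by
    have h4 : {a | f' a = T.ι e} = T.τ '' {a | f' a = e} := by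
      ext a
      constructor
      · intro h
        refine ⟨T.τ a, ?_, T.tau_tau a⟩
        rw [Set.mem_ofPred_eq, htau, show f' a = _ from h, T.inv_inv]
      · rintro ⟨b, hb, rfl⟩
        rw [Set.mem_ofPred_eq, htau, show f' b = _ from hb]
    have h5 : {a | f' a = T.ι e}.ncard = {a | f' a = e}.ncard := by
      rw [h4, Set.ncard_image_of_injective _ T.τ.injective]
    have h6 : {a | f' a = e} ∪ {a | f' a = T.ι e} = {a | s.2 a = e₁} ∪ {a | s.2 a = T.ι e₁} := by
      ext a
      have h7 := hOutIn a
      rw [hIn, hOut] at h7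
      exact h7
    have h7 := Set.ncard_union_eq (s := {a | f' a = e}) (t := {a | f' a = T.ι e})
      (by rw [Set.disjoint_left]; intro a h h'; exact hde (h'.symm.trans h))
      (Set.toFinite _) (Set.toFinite _)
    have h8 := Set.ncard_union_eq (s := {a | s.2 a = e₁}) (t := {a | s.2 a = T.ι e₁})
      (by rw [Set.disjoint_left]; intro a h h'; exact d3 (h'.symm.trans h))
      (Set.toFinite _) (Set.toFinite _)
    rw [h6, h8, h5, hs.ncard _ (J.In_subset ((hIn _).2 (Or.inl rfl))),
      hs.ncard _ (J.In_subset ((hIn _).2 (Or.inr rfl))), T.w_inv, J.w] at h7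
    have h9 : T.w e = T.w e₂ := by
      rcases (J.mem_Out e).1 he with rfl | rfl
      · rfl
      · rw [T.w_inv]
    omega
  refine ⟨hs, ⟨hconj, ?_, htau, ?_, ?_⟩, rfl,
    ⟨x, y, hxy, hne, ?_, swap_apply_left x y, swap_apply_right x y⟩, ?_, ?_, hf.eq₃, ?_, ?_, ?_, ?_⟩
  · intro a b
    change f' a = f' b ↔ σ'.SameCycle a b
    have hb := hval b
    rcases hval a with h | h | h
    · rcases hb with h' | h' | h'
      · rw [h.2.2.2, h'.2.2.2]
        exact iff_of_true rfl (h.2.1.symm.trans h'.2.1)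
      · rw [h.2.2.2, h'.2.2.2]
        exact iff_of_false hde.symm fun h6 => h'.2.1 (h.2.1.trans h6)
      · refine iff_of_false ?_ fun h6 => h'.2.2.1 (h.2.1.trans h6)
        intro h6
        exact h'.1 ((hOutIn b).1 (h6 ▸ (hOutIn a).2 h.1))
    · rcases hb with h' | h' | h'
      · rw [h.2.2.2, h'.2.2.2]
        exact iff_of_false hde fun h6 => h.2.1 (h'.2.1.trans h6.symm)
      · rw [h.2.2.2, h'.2.2.2]
        exact iff_of_true rfl (h.2.2.1.symm.trans h'.2.2.1)
      · refine iff_of_false ?_ fun h6 => h'.2.2.2.1 (h.2.2.1.trans h6)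
        intro h6
        exact h'.1 ((hOutIn b).1 (h6 ▸ (hOutIn a).2 h.1))
    · by_cases hb' : s.2 b ∈ N.In
      · refine iff_of_false ?_ fun h6 => ?_
        · intro h6
          exact h.1 ((hOutIn a).1 (h6 ▸ (hOutIn b).2 hb'))
        · rw [← h3 a b h.1] at h6
          exact h.1 (h6 ▸ hb')
      · rw [hf.eq₃ a h.1, hf.eq₃ b hb', h3 a b h.1]
  · intro a
    change f' a ∈ N.B
    by_cases ha : s.2 a ∈ N.In
    · exact J.Out_subset ((hOutIn a).2 ha)
    · rw [hf.eq₃ a ha]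
      exact ((J.stay _).1 ⟨hs.mem a, ha⟩).1
  · intro e' he'
    change {a | f' a = e'}.ncard = T.w e'
    by_cases h : e' ∈ N.Out
    · rcases (hOut e').1 h with rfl | rfl
      · exact hcard.1
      · rw [T.w_inv]; exact hcard.2
    · have h5 := (J.stay e').2 ⟨he', h⟩
      rw [← hs.ncard e' h5.1]
      congr 1
      ext a
      rw [Set.mem_ofPred_eq, Set.mem_ofPred_eq]
      by_cases ha : s.2 a ∈ N.In
      · refine iff_of_false ?_ ?_
        · rintro rfl
          exact h ((hOutIn a).2 ha)
        · rintro rfl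
          exact h5.2 ha
      · rw [hf.eq₃ a ha]
  · intro z
    rw [swap_apply_ne_self_iff]
    simp [hxy]
  · intro a
    simp only [swap_moves_iff hxy]
    constructor
    · intro h
      rcases (hIn _).1 h with h | h
      · exact ⟨x, by rw [h, hx], by tauto⟩
      · exact ⟨y, by rw [h, hy], by tauto⟩
    · rintro ⟨z, h, rfl | rfl | rfl | rfl⟩ <;> rw [← h] <;> assumption
  · intro a
    simp only [swap_moves_iff hxy]
    constructor
    · intro h
      rcases (hOut _).1 h with h | h
      · exact ⟨x, by rw [h, hf.eq₁ x hxIn (SameCycle.refl _ _)], by tauto⟩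
      · exact ⟨y, by rw [h, hf.eq₂ y hyIn h1], by tauto⟩
    · rintro ⟨z, h, rfl | rfl | rfl | rfl⟩ <;> rw [← h, hOutIn] <;> assumption
  · intro a h
    exact hf.eq₃ a fun h' => h ((hOutIn a).2 h')
  · intro a h
    have h4 := (hOutIn a).2 h
    exact ⟨h4, (J.tgt_eq_src _ h _ h4).symm⟩
  · intro a h
    have h4 := (hOutIn a).1 h
    exact ⟨h4, J.tgt_eq_src _ h4 _ h⟩
  · intro a b ha hb
    rw [J.tgt_eq_src _ ha _ he, J.tgt_eq_src _ hb _ he]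
    refine iff_of_true rfl ?_
    -- The transposition moves `x` to `y` and so links the two new cycles: there is a single vertex.
    have key : ∀ a, s.2 a ∈ N.In → MulAction.orbit (T.localGroup σ' (swap x y)) a =
        MulAction.orbit (T.localGroup σ' (swap x y)) x := by
      intro a ha
      rcases (h2 a).1 ha with h | h
      · exact MulAction.orbit_eq_iff.2 (sameCycle_mem_orbit h)
      · rw [MulAction.orbit_eq_iff.2 (sameCycle_mem_orbit h)]
        have := apply_mem_orbit (T := T) (σ := σ') (η := swap x y) x
        rw [swap_apply_left] at this
        exact MulAction.orbit_eq_iff.2 this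
    change b ∈ MulAction.orbit (T.localGroup σ' (swap x y)) a
    rw [key a ha, ← key b hb]
    exact MulAction.mem_orbit_self b

end

/-- Both incoming cycles end at one vertex, so the orbit of a moved point contains both. As it meets
only the cycles of the two points exchanged by `η`, these points lie on different incoming cycles.
-/
theorem exists_of_isTransition [Finite α] [DecidableEq α] (J : T.IsRearrangement N e₁ e₂)
    {s s' : Perm α × (α → E)} {η : Perm α} (h : T.IsTransition N s η s') :
    ∃ x y, s.2 x = e₁ ∧ s.2 y = T.ι e₁ ∧ T.τ x ≠ y ∧ s'.2 x ∈ N.Out ∧ η = swap x y := by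
  have hIn := J.mem_In
  obtain ⟨x, y, hxy, hne, rfl⟩ := h.exists_eq_swap
  have hxIn : s.2 x ∈ N.In := (h.mem_In x).2 ⟨x, rfl, (swap_moves_iff hxy x).2 (by tauto)⟩
  have hyIn : s.2 y ∈ N.In := (h.mem_In y).2 ⟨y, rfl, (swap_moves_iff hxy y).2 (by tauto)⟩
  have key : ∀ e, e ∈ N.In → e ≠ s.2 x → s.2 y = e := by
    intro e he h2
    obtain ⟨z, rfl⟩ := h.left.exists_eq (J.In_subset he)
    have h4 := h.src_eq x hxIn
    have h3 := (h.orbit x z hxIn he).1 (by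
      rw [J.tgt_eq_src _ hxIn _ h4.1, J.tgt_eq_src _ he _ h4.1])
    rw [localGroup_eq h.eq_mul] at h3
    exact ((h.left.orbit_swap_subset h3).resolve_left h2).symm
  rcases (hIn _).1 hxIn with hx | hx
  · refine ⟨x, y, hx, key (T.ι e₁) ((hIn _).2 (by tauto)) ?_, hne, (h.src_eq x hxIn).1, rfl⟩
    rw [hx]; exact T.inv_ne _
  · refine ⟨y, x, key e₁ ((hIn _).2 (by tauto)) ?_, hx, ?_, (h.src_eq y hyIn).1, swap_comm _ _⟩
    · rw [hx]; exact (T.inv_ne _).symm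
    · intro h'
      exact hne (by rw [← h', T.tau_tau])

/-- Only two outgoing labels are available, so the label of the cycle of `x` determines that of the
other cycle. -/
theorem isRelabelling_of_isTransition [Finite α] [DecidableEq α] (J : T.IsRearrangement N e₁ e₂)
    {s s' : Perm α × (α → E)} {x y : α} (h : T.IsTransition N s (swap x y) s')
    (hx : s.2 x = e₁) (hy : s.2 y = T.ι e₁) :
    IsRelabelling T N s.2 (swap x y * s.1 * (T.τ * swap x y * T.τ)) x (s'.2 x) s'.2 := by
  obtain ⟨h1, h2, h3⟩ := J.sameCycle_iff h.left hx hy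
  rw [← h.eq_mul] at h1 h2 h3 ⊢
  refine ⟨fun a _ ha => ((h.right.sameCycle _ _).2 ha).symm, fun a ha ha' => ?_,
    h.eq_of_notMem_In⟩
  have h4 := h.src_eq a ha
  have h5 := h.src_eq x ((J.mem_In _).2 (Or.inl hx))
  have h6 : s'.2 a ≠ s'.2 x := fun h6 => ha' ((h.right.sameCycle _ _).1 h6.symm)
  rcases (J.mem_Out _).1 h4.1 with h7 | h7 <;> rcases (J.mem_Out _).1 h5.1 with h8 | h8
  · exact absurd (h7.trans h8.symm) h6
  · rw [h7, h8, T.inv_inv]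
  · rw [h7, h8]
  · exact absurd (h7.trans h8.symm) h6

/-- Of the `w²` pairs of points on the two cycles the `w` pairs `(x, τ x)` are excluded. The factor
`2` is the choice of the outgoing edge that receives the new cycle of `x`, read off from the new
labelling. -/
theorem card_transition [Finite α] (J : T.IsRearrangement N e₁ e₂)
    {s : Perm α × (α → E)} (hs : T.IsLabelled N.A s) :
    Nat.card {q : Perm α × (Perm α × (α → E)) // T.IsTransition N s q.1 q.2} =
      2 * (T.w e₁ * (T.w e₁ - 1)) := by
  classical
  have d3 := T.inv_ne e₁
  have d4 := T.inv_ne e₂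
  choose f' hf using fun (p : α × α) (e : E) => exists_isRelabelling (T := T) (N := N) s.2
    (swap p.1 p.2 * s.1 * (T.τ * swap p.1 p.2 * T.τ)) p.1 e
  let P : Set (α × α) := {p | s.2 p.1 = e₁ ∧ s.2 p.2 = T.ι e₁ ∧ T.τ p.1 ≠ p.2}
  let F : P × N.Out → {q : Perm α × (Perm α × (α → E)) // T.IsTransition N s q.1 q.2} := fun p =>
    ⟨(swap p.1.1.1 p.1.1.2,
      (swap p.1.1.1 p.1.1.2 * s.1 * (T.τ * swap p.1.1.1 p.1.1.2 * T.τ), f' p.1.1 p.2)),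
      J.isTransition hs p.1.2.1 p.1.2.2.1 p.1.2.2.2 p.2.2 (hf _ _)⟩
  have hval : ∀ p ∈ P, ∀ e, f' p e p.1 = e := fun p hp e =>
    (hf p e).eq₁ p.1 ((J.mem_In _).2 (Or.inl hp.1)) (SameCycle.refl _ _)
  have hF : Function.Bijective F := by
    constructor
    · rintro ⟨⟨⟨x, y⟩, h⟩, e⟩ ⟨⟨⟨x', y'⟩, h'⟩, e'⟩ hh
      have h1 : swap x y = swap x' y' := congrArg (fun q => q.1.1) hh
      have hg : f' (x, y) e = f' (x', y') e' := congrArg (fun q => q.1.2.2) hh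
      have hvx := hval (x, y) h e
      have hvx' := hval (x', y') h' e'
      simp only [P, Set.mem_ofPred_eq] at h h'
      have hxy : x ≠ y := by rintro rfl; grind
      have hxy' : x' ≠ y' := by rintro rfl; grind
      have h2 : swap x' y' x ≠ x := by rw [← h1, swap_apply_left]; exact hxy.symm
      have h3 := (swap_apply_ne_self_iff.1 h2).2
      have h4 : swap x' y' x = y := by rw [← h1, swap_apply_left]
      rcases h3 with rfl | rfl
      · rw [swap_apply_left] at h4
        subst h4
        rw [hg] at hvx
        obtain rfl : e = e' := Subtype.ext (hvx.symm.trans hvx')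
        rfl
      · grind
    · rintro ⟨⟨η, s'⟩, h⟩
      obtain ⟨x, y, hx, hy, hne, he, rfl⟩ := J.exists_of_isTransition h
      refine ⟨⟨⟨(x, y), hx, hy, hne⟩, ⟨s'.2 x, he⟩⟩, Subtype.ext (Prod.ext rfl ?_)⟩
      refine (J.isTransition hs hx hy hne he (hf (x, y) _)).ext_left h ?_
      exact IsRelabelling.unique (hf (x, y) _) (J.isRelabelling_of_isTransition h hx hy)
  have hOut : Nat.card N.Out = 2 := by
    have : N.Out = {e₂, T.ι e₂} := by
      ext e; rw [J.mem_Out]; rfl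
    rw [this, Nat.card_coe_set_eq, Set.ncard_pair d4.symm]
  rw [← Nat.card_congr (Equiv.ofBijective F hF), Nat.card_prod, hOut, Nat.card_coe_set_eq]
  have hP : P = ({x | s.2 x = e₁} ×ˢ {x | s.2 x = T.ι e₁}) \
      ((fun x => (x, T.τ x)) '' {x | s.2 x = e₁}) := by
    ext ⟨x, y⟩
    simp only [P, Set.mem_ofPred_eq, Set.mem_sdiff, Set.mem_prod, Set.mem_image, Prod.mk.injEq,
      not_exists, not_and]
    constructor
    · rintro ⟨h1, h2, h3⟩
      refine ⟨⟨h1, h2⟩, ?_⟩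
      rintro z hz rfl
      exact h3
    · rintro ⟨⟨h1, h2⟩, h3⟩
      exact ⟨h1, h2, h3 x h1 rfl⟩
  have hsub : ((fun x => (x, T.τ x)) '' {x | s.2 x = e₁}) ⊆
      ({x | s.2 x = e₁} ×ˢ {x | s.2 x = T.ι e₁}) := by
    rintro _ ⟨x, hx, rfl⟩
    exact ⟨hx, by rw [Set.mem_ofPred_eq, hs.tau, show s.2 x = e₁ from hx]⟩
  rw [hP, Set.ncard_sdiff hsub (Set.toFinite _), Set.ncard_prod,
    Set.ncard_image_of_injective _ fun x y h => congrArg Prod.fst h,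
    hs.ncard _ (J.In_subset ((J.mem_In _).2 (Or.inl rfl))),
    hs.ncard _ (J.In_subset ((J.mem_In _).2 (Or.inr rfl))), T.w_inv, Nat.mul_sub_one, mul_comm]

end IsRearrangement

end TwistData

end

/-! ### Products over pairs of labels, and cuts counted as reversed joins -/

section

open Equiv Equiv.Perm

namespace TwistData

variable {α E V : Type*} {T : TwistData α E} {N : NodeData E V}

/-- The representative in `R` of the pair of `e`. -/
theorem IsTransversal.exists_rep {R : Set E} (hR : T.IsTransversal R) (e : E) :
    ∃ r, r ∈ R ∧ T.w r = T.w e ∧ ∀ e' ∈ R, (e' = e ∨ e' = T.ι e) ↔ e' = r := by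
  by_cases h : e ∈ R
  · refine ⟨e, h, rfl, fun e' he' => ⟨fun h' => h'.resolve_right ?_, Or.inl⟩⟩
    rintro rfl
    exact (hR e).1 h he'
  · refine ⟨T.ι e, hR.inv_mem h, T.w_inv e, fun e' he' => ⟨fun h' => h'.resolve_left ?_, Or.inr⟩⟩
    rintro rfl
    exact h he'

open Classical in
theorem IsTransversal.prod_pair [Fintype E] {R S : Set E} (hR : T.IsTransversal R) {e : E}
    (hS : ∀ e', e' ∈ S ↔ e' = e ∨ e' = T.ι e) : ∏ e with e ∈ S ∧ e ∈ R, T.w e = T.w e := by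
  obtain ⟨r, hr, hw, h⟩ := hR.exists_rep e
  have : (Finset.univ.filter fun e => e ∈ S ∧ e ∈ R) = {r} := by
    ext e'
    simp only [Finset.mem_filter, Finset.mem_univ, true_and, Finset.mem_singleton, hS]
    constructor
    · rintro ⟨h1, h2⟩
      exact (h e' h2).1 h1
    · rintro rfl
      exact ⟨(h e' hr).2 rfl, hr⟩
  rw [this, Finset.prod_singleton, hw]

open Classical in
theorem IsTransversal.prod_pair_pair [Fintype E] {R S : Set E} (hR : T.IsTransversal R) {e₁ e₂ : E}
    (h₁ : e₁ ≠ e₂) (h₂ : e₁ ≠ T.ι e₂)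
    (hS : ∀ e', e' ∈ S ↔ e' = e₁ ∨ e' = e₂ ∨ e' = T.ι e₁ ∨ e' = T.ι e₂) :
    ∏ e with e ∈ S ∧ e ∈ R, T.w e = T.w e₁ * T.w e₂ := by
  obtain ⟨r₁, hr₁, hw₁, h1⟩ := hR.exists_rep e₁
  obtain ⟨r₂, hr₂, hw₂, h2⟩ := hR.exists_rep e₂
  have hne : r₁ ≠ r₂ := by
    rintro rfl
    have h3 := (h1 _ hr₁).2 rfl
    have h4 := (h2 _ hr₁).2 rfl
    have h5 := T.inv_inv e₁
    have h6 := T.inv_inv e₂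
    grind
  have : (Finset.univ.filter fun e => e ∈ S ∧ e ∈ R) = {r₁, r₂} := by
    ext e'
    simp only [Finset.mem_filter, Finset.mem_univ, true_and, Finset.mem_insert,
      Finset.mem_singleton, hS]
    constructor
    · rintro ⟨h3, h4⟩
      rw [← h1 e' h4, ← h2 e' h4]
      tauto
    · rintro (rfl | rfl)
      · have := (h1 e' hr₁).2 rfl
        exact ⟨by tauto, hr₁⟩
      · have := (h2 e' hr₂).2 rfl
        exact ⟨by tauto, hr₂⟩
  rw [this, Finset.prod_pair hne, hw₁, hw₂]

open Classical in
theorem prod_filter_split [Fintype E] {M : Type*} [CommMonoid M] {A In R : Set E} (h : In ⊆ A)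
    (f : E → M) : ∏ e with e ∈ A ∧ e ∈ R, f e =
      (∏ e with (e ∈ A ∧ e ∉ In) ∧ e ∈ R, f e) * ∏ e with e ∈ In ∧ e ∈ R, f e := by
  rw [← Finset.prod_filter_mul_prod_filter_not _ (fun e => e ∉ In), Finset.filter_filter,
    Finset.filter_filter]
  congr 2
  · ext e; simp; tauto
  · ext e
    simp only [Finset.mem_filter, Finset.mem_univ, true_and, not_not]
    exact ⟨fun h' => ⟨h'.2, h'.1.2⟩, fun h' => ⟨⟨h h'.1, h'.2⟩, h'.1⟩⟩

open Classical in
theorem sum_filter_split [Fintype E] {A In : Set E} (h : In ⊆ A)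
    (f : E → ℕ) : ∑ e with e ∈ A, f e =
      (∑ e with (e ∈ A ∧ e ∉ In), f e) + ∑ e with e ∈ In, f e := by
  rw [← Finset.sum_filter_add_sum_filter_not _ (fun e => e ∉ In), Finset.filter_filter,
    Finset.filter_filter]
  congr 2
  ext e
  simp only [Finset.mem_filter, Finset.mem_univ, true_and, not_not]
  exact ⟨fun h' => h'.2, fun h' => ⟨h h', h'⟩⟩

namespace IsJoin

variable {e₁ e₂ e₃ : E}

open Classical in
theorem sum_In [Fintype E] (J : T.IsJoin N e₁ e₂ e₃) :
    ∑ e with e ∈ N.In, T.w e = 2 * T.w e₃ := by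
  have : (Finset.univ.filter fun e => e ∈ N.In) = {e₁, e₂, T.ι e₁, T.ι e₂} := by
    ext e; simp [J.mem_In]
  have d2 := J.ne'
  have d6 : e₂ ≠ T.ι e₁ := fun h => d2 (by rw [h, T.inv_inv])
  rw [this, Finset.sum_insert, Finset.sum_insert, Finset.sum_pair J.inv.ne, T.w_inv, T.w_inv, J.w]
  · ring
  · simp [d6, (T.inv_ne e₂).symm]
  · simp [J.ne, d2, (T.inv_ne e₁).symm]

open Classical in
theorem sum_Out [Fintype E] (J : T.IsJoin N e₁ e₂ e₃) :
    ∑ e with e ∈ N.Out, T.w e = 2 * T.w e₃ := by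
  have : (Finset.univ.filter fun e => e ∈ N.Out) = {e₃, T.ι e₃} := by
    ext e; simp [J.mem_Out]
  rw [this, Finset.sum_pair (T.inv_ne _).symm, T.w_inv]
  ring

theorem inv_mem_In (J : T.IsJoin N e₁ e₂ e₃) {e : E} : T.ι e ∈ N.In ↔ e ∈ N.In := by
  have key : ∀ e, e ∈ N.In → T.ι e ∈ N.In := by
    intro e he
    rw [J.mem_In] at he ⊢
    rcases he with rfl | rfl | rfl | rfl <;> simp [T.inv_inv]
  exact ⟨fun h => by have := key _ h; rwa [T.inv_inv] at this, key e⟩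

theorem inv_mem_Out (J : T.IsJoin N e₁ e₂ e₃) {e : E} : T.ι e ∈ N.Out ↔ e ∈ N.Out := by
  have key : ∀ e, e ∈ N.Out → T.ι e ∈ N.Out := by
    intro e he
    rw [J.mem_Out] at he ⊢
    rcases he with rfl | rfl <;> simp [T.inv_inv]
  exact ⟨fun h => by have := key _ h; rwa [T.inv_inv] at this, key e⟩

/-- The number of transitions at a node at which cycles are cut: such a node is a join when it is
read from right to left. -/
theorem card_transition_of_rev [Finite α] [Finite E] (J : T.IsJoin N.rev e₁ e₂ e₃)
    {s : Perm α × (α → E)} (hs : T.IsLabelled N.A s) :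
    Nat.card {q : Perm α × (Perm α × (α → E)) // T.IsTransition N s q.1 q.2} = 2 * T.w e₃ := by
  classical
  have := Fintype.ofFinite E
  obtain ⟨R, hR⟩ := T.exists_isTransversal
  have h1 := card_transition_mul hs fun s' hs' => J.card_transition (s := s') hs'
  have hA : ∀ e ∈ N.A, T.ι e ∈ N.A := fun e => hs.inv_mem
  -- No state on the right is given yet, so stability of its label set comes from the left: labels
  -- that do not start at the node are already present there. The total weight is transferred in the
  -- same way below.
  have hB : ∀ e ∈ N.B, T.ι e ∈ N.B := by
    intro e he
    by_cases h : e ∈ N.Out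
    · exact J.In_subset (J.inv_mem_In.2 h)
    · have h2 := (J.stay e).1 ⟨he, h⟩
      exact ((J.stay _).2 ⟨hA e h2.1, fun h => h2.2 (J.inv_mem_Out.1 h)⟩).1
  have hstay : ∀ e, (e ∈ N.A ∧ e ∉ N.In) ↔ (e ∈ N.B ∧ e ∉ N.Out) := fun e => (J.stay e).symm
  have hsA := hs.sum_w
  have hsB : ∑ e with e ∈ N.B, T.w e = Nat.card α := by
    have h2 := sum_filter_split J.In_subset T.w
    have h3 := sum_filter_split J.Out_subset T.w
    rw [J.sum_In] at h2
    rw [J.sum_Out] at h3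
    rw [← hsA]
    simp only [J.stay] at h2
    exact h2.trans h3.symm
  have h2 := T.card_isLabelled hA hsA hR
  have h3 := T.card_isLabelled hB hsB hR
  have hC : 0 < Nat.card (Subgroup.centralizer {T.τ}) := Nat.card_pos
  have h4 : ∏ e with e ∈ N.B ∧ e ∈ R, T.w e = _ * _ := prod_filter_split J.In_subset T.w
  have h5 : ∏ e with e ∈ N.A ∧ e ∈ R, T.w e = _ * _ := prod_filter_split J.Out_subset T.w
  rw [hR.prod_pair_pair J.ne J.ne' J.mem_In] at h4
  rw [hR.prod_pair J.mem_Out] at h5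
  simp only [J.stay] at h4
  have h6 : 0 < ∏ e with (e ∈ N.rev.B ∧ e ∉ N.rev.Out) ∧ e ∈ R, T.w e :=
    Finset.prod_pos fun e _ => T.w_pos e
  rw [h4] at h3
  rw [h5] at h2
  generalize (∏ e with (e ∈ N.rev.B ∧ e ∉ N.rev.Out) ∧ e ∈ R, T.w e) = P at *
  generalize Nat.card {q : Perm α × (Perm α × (α → E)) // T.IsTransition N s q.1 q.2} = k at *
  generalize Nat.card {s // T.IsLabelled N.A s} = a at *
  generalize Nat.card {s // T.IsLabelled N.B s} = b at *
  generalize Nat.card (Subgroup.centralizer {T.τ}) = C at *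
  have h7 := T.w_pos e₁
  have h8 := T.w_pos e₂
  have h9 := T.w_pos e₃
  have ha : 0 < a := Nat.pos_of_ne_zero fun h => by rw [h] at h2; omega
  -- Here `a` and `b` count the labelled permutations on the left and on the right, and `P` is the
  -- product over the pairs of edges that pass the node. Both `a * P * w e₃` and `b * P * w e₁ * w
  -- e₂` equal the order of the centralizer.
  have h10 : (a * P) * k = (a * P) * (2 * T.w e₃) := by
    calc (a * P) * k = P * (k * a) := by ring
      _ = 2 * (b * (P * (T.w e₁ * T.w e₂))) := by rw [h1]; ring
      _ = (a * P) * (2 * T.w e₃) := by rw [h3, ← h2]; ring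
  exact Nat.eq_of_mul_eq_mul_left (Nat.mul_pos ha h6) h10

end IsJoin

end TwistData

/-! ### Counting paths -/

/-- The number of paths that start at a given state, when the number of continuations only depends
on the time. -/
theorem card_paths {S M : Type*} [Finite S] [Finite M] (R : ℕ → S → M → S → Prop)
    (P : ℕ → S → Prop) (K : ℕ → ℕ) (b : ℕ)
    (hP : ∀ m < b, ∀ s η s', P m s → R m s η s' → P (m + 1) s')
    (hK : ∀ m < b, ∀ s, P m s → Nat.card {q : M × S // R m s q.1 q.2} = K m) :
    Nat.card {q : (Fin (b + 1) → S) × (Fin b → M) //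
        P 0 (q.1 0) ∧ ∀ i : Fin b, R i (q.1 i.castSucc) (q.2 i) (q.1 i.succ)} =
      Nat.card {s // P 0 s} * ∏ m ∈ Finset.range b, K m := by
  induction b with
  | zero =>
    simp only [IsEmpty.forall_iff, and_true, Finset.range_zero, Finset.prod_empty, mul_one]
    refine Nat.card_congr ⟨fun q => ⟨q.1.1 0, q.2⟩, fun s => ⟨(fun _ => s.1, Fin.elim0), s.2⟩,
      ?_, ?_⟩
    · rintro ⟨⟨q, r⟩, h⟩
      refine Subtype.ext (Prod.ext ?_ ?_)
      · funext i
        rw [Fin.eq_zero i]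
      · funext i
        exact i.elim0
    · rintro ⟨s, h⟩
      rfl
  | succ b ih =>
    rw [Finset.prod_range_succ, ← mul_assoc, ← ih (fun m hm => hP m (by omega))
      (fun m hm => hK m (by omega))]
    have hlast : ∀ q : {q : (Fin (b + 1) → S) × (Fin b → M) //
        P 0 (q.1 0) ∧ ∀ i : Fin b, R i (q.1 i.castSucc) (q.2 i) (q.1 i.succ)},
        P b (q.1.1 (Fin.last b)) := by
      rintro ⟨⟨q, r⟩, h0, h⟩
      have key : ∀ m (hm : m < b + 1), P m (q ⟨m, hm⟩) := by
        intro m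
        induction m with
        | zero => exact fun _ => h0
        | succ m ihm =>
          intro hm
          exact hP m (by omega) _ _ _ (ihm (by omega)) (h ⟨m, by omega⟩)
      exact key b (by omega)
    let Q := {q : (Fin (b + 1) → S) × (Fin b → M) //
        P 0 (q.1 0) ∧ ∀ i : Fin b, R i (q.1 i.castSucc) (q.2 i) (q.1 i.succ)}
    -- A path of length `b + 1` is a path of length `b` with a continuation of its last state.
    have h1 : Nat.card (Σ q : Q, {z : M × S // R b (q.1.1 (Fin.last b)) z.1 z.2}) =
        Nat.card Q * K b := by
      have := Fintype.ofFinite Q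
      rw [Nat.card_sigma, Finset.sum_congr rfl fun q _ => hK b (by omega) _ (hlast q),
        Finset.sum_const, smul_eq_mul, Finset.card_univ, ← Nat.card_eq_fintype_card]
    rw [← h1]
    refine Nat.card_congr ⟨fun q => ⟨⟨(Fin.init q.1.1, Fin.init q.1.2), ?_, ?_⟩,
      ⟨(q.1.2 (Fin.last b), q.1.1 (Fin.last (b + 1))), ?_⟩⟩,
      fun q => ⟨(Fin.snoc q.1.1.1 q.2.1.2, Fin.snoc q.1.1.2 q.2.1.1), ?_, ?_⟩, ?_, ?_⟩
    · exact q.2.1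
    · intro i
      exact q.2.2 i.castSucc
    · exact q.2.2 (Fin.last b)
    · obtain ⟨⟨⟨q, r⟩, h0, h⟩, ⟨η, s⟩, h'⟩ := q
      change P 0 ((Fin.snoc q s : Fin (b + 1 + 1) → S) (Fin.castSucc 0))
      rw [Fin.snoc_castSucc]
      exact h0
    · obtain ⟨⟨⟨q, r⟩, h0, h⟩, ⟨η, s⟩, h'⟩ := q
      intro i
      induction i using Fin.lastCases with
      | last =>
        simpa using h'
      | cast i =>
        have := h i
        change R i ((Fin.snoc q s : Fin (b + 1 + 1) → S) i.castSucc.castSucc)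
          ((Fin.snoc r η : Fin (b + 1) → M) i.castSucc)
          ((Fin.snoc q s : Fin (b + 1 + 1) → S) i.succ.castSucc)
        rwa [Fin.snoc_castSucc, Fin.snoc_castSucc, Fin.snoc_castSucc]
    · rintro ⟨⟨q, r⟩, h0, h⟩
      refine Subtype.ext (Prod.ext ?_ ?_)
      · exact Fin.snoc_init_self q
      · exact Fin.snoc_init_self r
    · rintro ⟨⟨⟨q, r⟩, h0, h⟩, ⟨⟨η, s⟩, h'⟩⟩
      have e1 : Fin.init (Fin.snoc q s : Fin (b + 1 + 1) → S) = q := Fin.init_snoc (α := fun _ => S) s q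
      have e2 : Fin.init (Fin.snoc r η : Fin (b + 1) → M) = r := Fin.init_snoc (α := fun _ => M) η r
      have e3 : (Fin.snoc q s : Fin (b + 1 + 1) → S) (Fin.last _) = s := Fin.snoc_last (α := fun _ => S) s q
      have e4 : (Fin.snoc r η : Fin (b + 1) → M) (Fin.last _) = η := Fin.snoc_last (α := fun _ => M) η r
      refine Sigma.subtype_ext (Subtype.ext (Prod.ext e1 e2)) (Prod.ext e4 e3)

end

section

/-! ### The combinatorics of a twisted tropical cover -/

open PermTuple

theorem nodePos_lt_nodePos {b : ℕ} {p : Fin b → ℝ} (hp : StrictMono p) {k l : ℕ} (hkl : k < l)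
    (hl : l ≤ b + 1) : nodePos p k < nodePos p l := by
  obtain ⟨l, rfl⟩ : ∃ l', l = l' + 1 := ⟨l - 1, by omega⟩
  rcases k with _ | k
  · simp only [nodePos]
    split_ifs
    · exact EReal.bot_lt_coe _
    · exact bot_lt_top
  · have hk : k < b := by omega
    by_cases h : l < b
    · simp only [nodePos, hk, h, dif_pos]
      exact EReal.coe_lt_coe_iff.2 (hp (by simpa using hkl))
    · simp only [nodePos, hk, h, dif_pos, dif_neg, not_false_eq_true]
      exact EReal.coe_lt_top _

theorem nodePos_injective {b : ℕ} {p : Fin b → ℝ} (hp : StrictMono p) {k l : ℕ} (hk : k ≤ b + 1)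
    (hl : l ≤ b + 1) (h : nodePos p k = nodePos p l) : k = l := by
  rcases lt_trichotomy k l with h' | h' | h'
  · exact absurd h (nodePos_lt_nodePos hp h' hl).ne
  · exact h'
  · exact absurd h (nodePos_lt_nodePos hp h' hk).ne'

theorem nodePos_lt_iff {b : ℕ} {p : Fin b → ℝ} (hp : StrictMono p) {k l : ℕ} (hk : k ≤ b + 1)
    (hl : l ≤ b + 1) : nodePos p k < nodePos p l ↔ k < l := by
  refine ⟨fun h => ?_, fun h => nodePos_lt_nodePos hp h hl⟩
  by_contra h'
  rcases (not_lt.1 h').lt_or_eq with h' | rfl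
  · exact lt_asymm h (nodePos_lt_nodePos hp h' hk)
  · exact lt_irrefl _ h

theorem nodePos_succ {b : ℕ} (p : Fin b → ℝ) (i : Fin b) : nodePos p (i + 1) = (p i : EReal) := by
  simp [nodePos]

theorem nodePos_last {b : ℕ} (p : Fin b → ℝ) : nodePos p (b + 1) = ⊤ := by
  simp [nodePos]

namespace CoverData

/-- The edges of a cover oriented from left to right, and the nodes of the line over which its
vertices lie. -/
structure Orientation (D : CoverData.{u, v}) {b : ℕ} (p : Fin b → ℝ) where
  src : D.E → D.V
  tgt : D.E → D.V
  node : D.V → ℕ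
  ends : ∀ e, D.ends e = s(src e, tgt e)
  pos : ∀ x, D.pos x = nodePos p (node x)
  node_le : ∀ x, node x ≤ b + 1
  lt : ∀ e, node (src e) < node (tgt e)
  length : ∀ e, D.length e =
    (nodePos p (node (tgt e)) - nodePos p (node (src e))).toENNReal / (D.weight e : ℝ≥0∞)
  exists_edge : ∀ x, ∃ e, src e = x ∨ tgt e = x
  src_inj : ∀ e e', node (src e) = 0 → src e = src e' → e = e'
  tgt_inj : ∀ e e', node (tgt e) = b + 1 → tgt e = tgt e' → e = e'

namespace IsTwistedTropicalCover

variable {D : CoverData.{u, v}} {n b g : ℕ} {μ ν : n.Partition} {p : Fin b → ℝ}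
  (hD : D.IsTwistedTropicalCover g μ ν p)
include hD

open Classical in
-- The ends over `-∞` have total weight `2n`, so there is at least one.
theorem exists_pos_eq_bot (hn : 0 < n) : ∃ x, D.pos x = ⊥ := by
  by_contra! h
  have h1 := hD.left_ends
  have h2 : D.leftWeights = 0 := by
    unfold leftWeights
    rw [Finset.filter_false_of_mem]
    · rfl
    · rintro e - ⟨x, -, hx⟩
      exact h x hx
  rw [h2] at h1
  have h3 := μ.parts_sum
  have h4 := congrArg Multiset.sum h1
  rw [Multiset.sum_add] at h4
  simp at h4
  omega

theorem b_pos (hn : 0 < n) : 0 < b := by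
  have h1 := hD.branch_card
  have key : ∀ μ : n.Partition, 0 < μ.parts.card := by
    intro μ
    rw [Multiset.card_pos]
    intro h
    have := μ.parts_sum
    rw [h] at this
    simp at this
    omega
  have h2 := key μ
  have h3 := key ν
  omega

theorem pos_eq_of_weight_eq_zero {e : D.E} (he : D.weight e = 0) {x y : D.V}
    (h : D.ends e = s(x, y)) : D.pos x = D.pos y := by
  have key : ∀ x y, D.ends e = s(x, y) → ¬ D.pos x < D.pos y := by
    intro x y h hlt
    have h1 := hD.cover.linear e x y h hlt.le
    rw [he] at h1
    simp only [Nat.cast_zero, zero_mul, EReal.coe_ennreal_zero] at h1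
    exact (EReal.sub_pos.2 hlt).ne' h1
  exact le_antisymm (not_lt.1 (key y x (by rw [h, Sym2.eq_swap]))) (not_lt.1 (key x y h))

theorem pos_cases (x : D.V) : D.pos x = ⊥ ∨ D.pos x = ⊤ ∨ ∃ i, D.pos x = (p i : EReal) := by
  by_cases h : D.IsLeaf x
  · rcases hD.cover.pos_leaf x h with h | h
    · exact Or.inl h
    · exact Or.inr (Or.inl h)
  · exact Or.inr (Or.inr (hD.cover.pos_inner x h))

/-- In `EReal` both `⊥ - ⊥` and `⊤ - ⊤` are `⊥`, which is not a nonnegative length, so linearity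
excludes edges inside a fibre at infinity. Over a branch point the difference is `0` while lengths
are positive, so the slope vanishes. -/
theorem eq_zero_of_pos_eq {e : D.E} {x y : D.V} (h : D.ends e = s(x, y))
    (hxy : D.pos x = D.pos y) : D.weight e = 0 ∧ ∃ i, D.pos x = (p i : EReal) := by
  have h1 := hD.cover.linear e x y h hxy.le
  have h2 : ∃ i, D.pos x = (p i : EReal) := by
    rcases hD.pos_cases x with h3 | h3 | h3
    · rw [← hxy, h3] at h1
      have h4 : ((⊥ : EReal) - ⊥) = ⊥ := rfl
      rw [h4] at h1
      exact absurd h1.symm (EReal.coe_ennreal_ne_bot _)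
    · rw [← hxy, h3] at h1
      have h4 : ((⊤ : EReal) - ⊤) = ⊥ := rfl
      rw [h4] at h1
      exact absurd h1.symm (EReal.coe_ennreal_ne_bot _)
    · exact h3
  refine ⟨?_, h2⟩
  obtain ⟨i, hi⟩ := h2
  rw [← hxy, hi, ← EReal.coe_sub, sub_self, EReal.coe_zero, eq_comm,
    EReal.coe_ennreal_eq_zero, mul_eq_zero] at h1
  rcases h1 with h1 | h1
  · exact_mod_cast h1
  · exact absurd h1 (hD.cover.curve.length_pos e).ne'

/-- The fibre over a branch point is an orbit of the involution. -/
theorem eq_or_eq_inv {i : Fin b} {x y : D.V} (hx : D.pos x = (p i : EReal))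
    (hy : D.pos y = (p i : EReal)) : y = x ∨ y = D.invV x := by
  rcases hD.fibre i with ⟨h1, h2⟩ | ⟨h1, h2⟩
  · have hne : x ≠ D.invV x := by
      intro h
      have := (hD.fixed_vertex x).1 h.symm
      rw [h2 x hx] at this
      omega
    have h3 : ({x, D.invV x} : Set D.V) = {x | D.pos x = (p i : EReal)} := by
      refine Set.eq_of_subset_of_ncard_le ?_ ?_ (Set.toFinite _)
      · rintro z (rfl | rfl)
        · exact hx
        · rw [Set.mem_ofPred_eq, hD.involution.pos, hx]
      · rw [h1, Set.ncard_pair hne]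
    have h4 : y ∈ ({x, D.invV x} : Set D.V) := by rw [h3]; exact hy
    exact h4
  · left
    obtain ⟨z, hz⟩ := Set.ncard_eq_one.1 h1
    have h3 : x ∈ ({z} : Set D.V) := by rw [← hz]; exact hx
    have h4 : y ∈ ({z} : Set D.V) := by rw [← hz]; exact hy
    exact h4.trans h3.symm

theorem valence_of_pos {i : Fin b} {x : D.V} (hx : D.pos x = (p i : EReal)) :
    D.valence x = 3 ∨ D.valence x = 4 := by
  rcases hD.fibre i with ⟨-, h2⟩ | ⟨-, h2⟩
  · exact Or.inl (h2 x hx)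
  · exact Or.inr (h2 x hx)

theorem not_isLeaf {i : Fin b} {x : D.V} (hx : D.pos x = (p i : EReal)) : ¬ D.IsLeaf x := by
  unfold MetricGraph.IsLeaf
  rcases hD.valence_of_pos hx with h | h <;> omega

theorem mem_ends_invE {e : D.E} {x : D.V} (hx : x ∈ D.ends e) : D.invV x ∈ D.ends (D.invE e) := by
  rw [hD.involution.ends]
  exact Sym2.mem_map.2 ⟨x, hx, rfl⟩

open Classical in
/-- There are no contracted edges. -/
theorem pos_ne (hn : 0 < n) {e : D.E} {x y : D.V} (h : D.ends e = s(x, y)) :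
    D.pos x ≠ D.pos y := by
  intro hxy
  obtain ⟨hw, i, hi⟩ := hD.eq_zero_of_pos_eq h hxy
  have hxe : x ∈ D.ends e := by rw [h]; exact Sym2.mem_mk_left x y
  -- some edge at `x` is not contracted
  obtain ⟨e₁, hxe₁, hw₁⟩ : ∃ e₁, x ∈ D.ends e₁ ∧ D.weight e₁ ≠ 0 := by
    by_contra! hall
    have hall' : ∀ z, D.pos z = (p i : EReal) → ∀ e, z ∈ D.ends e → D.weight e = 0 := by
      intro z hz e he
      rcases hD.eq_or_eq_inv hi hz with rfl | rfl
      · exact hall e he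
      · have := hD.mem_ends_invE he
        rw [hD.involution.invV_invV] at this
        rw [← hD.involution.weight e]
        exact hall _ this
    obtain ⟨z, hz⟩ := hD.exists_pos_eq_bot hn
    -- If all edges at this fibre were contracted, connectedness would keep the whole graph over `p
    -- i`, although some vertex lies over `-∞`.
    have key : ∀ z, Relation.ReflTransGen D.Adj x z → D.pos z = (p i : EReal) := by
      intro z hz
      induction hz with
      | refl => exact hi
      | tail _ hadj ih =>
        obtain ⟨e, he⟩ := hadj
        rw [← ih]
        exact (hD.pos_eq_of_weight_eq_zero
          (hall' _ ih e (by rw [he]; exact Sym2.mem_mk_left _ _)) he).symm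
    have := key z (hD.cover.curve.connected x z)
    rw [hz] at this
    exact EReal.bot_ne_coe _ this
  -- At a `3`-valent vertex balancing gives a noncontracted edge on each side. The contracted edge
  -- then adds `2` to the valence: as a loop, or, if it joins `x` to its image, together with its
  -- own image under `ι`, which is a different edge.
  rcases hD.valence_of_pos hi with h3 | h4
  · have hbal := hD.cover.balanced x (hD.not_isLeaf hi)
    obtain ⟨z, hz⟩ := Sym2.mem_iff_exists.1 hxe₁
    have hne : D.pos x ≠ D.pos z := fun h' => hw₁ (hD.eq_zero_of_pos_eq hz h').1
    have hl : D.leftDegree x ≠ 0 ∧ D.rightDegree x ≠ 0 := by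
      rw [hbal, and_self]
      rcases hne.lt_or_gt with hlt | hlt
      · unfold rightDegree
        exact fun h => hw₁ (Finset.sum_eq_zero_iff.1 h e₁ (by simpa using ⟨z, hz, hlt⟩))
      · rw [← hbal]
        unfold leftDegree
        exact fun h => hw₁ (Finset.sum_eq_zero_iff.1 h e₁
          (by simpa using ⟨z, by rw [hz, Sym2.eq_swap], hlt⟩))
    obtain ⟨el, hel, hwl⟩ := Finset.exists_ne_zero_of_sum_ne_zero hl.1
    obtain ⟨er, her, hwr⟩ := Finset.exists_ne_zero_of_sum_ne_zero hl.2
    obtain ⟨yl, hyl, hltl⟩ := (Finset.mem_filter.1 hel).2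
    obtain ⟨yr, hyr, hltr⟩ := (Finset.mem_filter.1 her).2
    have hlr : el ≠ er := by
      rintro rfl
      rw [hyl, Sym2.eq_iff] at hyr
      rcases hyr with ⟨rfl, rfl⟩ | ⟨rfl, -⟩
      · exact lt_irrefl _ hltl
      · exact lt_asymm hltl hltr
    have hle : el ≠ e := by rintro rfl; exact hwl hw
    have hre : er ≠ e := by rintro rfl; exact hwr hw
    have hsub : ∀ S : Finset D.E, ∑ e ∈ S, (if x ∈ D.ends e then
        (if (D.ends e).IsDiag then 2 else 1) else 0) ≤ 3 := by
      intro S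
      rw [← h3]
      exact Finset.sum_le_univ_sum_of_nonneg fun e => Nat.zero_le _
    have hml : x ∈ D.ends el := by rw [hyl]; exact Sym2.mem_mk_right _ _
    have hmr : x ∈ D.ends er := by rw [hyr]; exact Sym2.mem_mk_left _ _
    have hone : ∀ e, x ∈ D.ends e → 1 ≤ (if x ∈ D.ends e then
        (if (D.ends e).IsDiag then 2 else 1) else 0) := by
      intro e he
      rw [if_pos he]
      split_ifs <;> omega
    rcases hD.eq_or_eq_inv hi (hxy ▸ hi) with rfl | rfl
    · have h5 := hsub {el, er, e}
      rw [Finset.sum_insert (by simp [hlr, hle]), Finset.sum_pair hre] at h5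
      have h6 := hone el hml
      have h7 := hone er hmr
      have h8 : (if y ∈ D.ends e then (if (D.ends e).IsDiag then 2 else 1) else 0) = 2 := by
        rw [if_pos hxe, if_pos]
        rw [h]
        exact Sym2.mk_isDiag_iff.2 rfl
      omega
    · have hwι : D.weight (D.invE e) = 0 := by rw [hD.involution.weight, hw]
      have hle' : el ≠ D.invE e := by rintro rfl; exact hwl hwι
      have hre' : er ≠ D.invE e := by rintro rfl; exact hwr hwι
      have h5 := hsub {el, er, e, D.invE e}
      rw [Finset.sum_insert (by simp [hlr, hle, hle']), Finset.sum_insert (by simp [hre, hre']),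
        Finset.sum_pair (hD.fixed_edge e).symm] at h5
      have h6 := hone el hml
      have h7 := hone er hmr
      have h8 := hone e hxe
      have h9 := hone (D.invE e) (by
        have : D.invV x ∈ D.ends e := by rw [h]; exact Sym2.mem_mk_right _ _
        have := hD.mem_ends_invE this
        rwa [hD.involution.invV_invV] at this)
      omega
  -- The weights at a `4`-valent vertex agree, so `e₁` would be contracted too.
  · exact hw₁ ((hD.four_valent x h4 e₁ e hxe₁ hxe).trans hw)

theorem weight_pos (hn : 0 < n) (e : D.E) : 0 < D.weight e := by
  obtain ⟨x, y, h⟩ : ∃ x y, D.ends e = s(x, y) := by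
    induction h : D.ends e using Sym2.inductionOn with
    | _ x y => exact ⟨x, y, rfl⟩
  exact Nat.pos_of_ne_zero fun h' => hD.pos_ne hn h (hD.pos_eq_of_weight_eq_zero h' h)

theorem exists_oriented (hn : 0 < n) (e : D.E) :
    ∃ x y, D.ends e = s(x, y) ∧ D.pos x < D.pos y := by
  obtain ⟨x, y, h⟩ : ∃ x y, D.ends e = s(x, y) := by
    induction h : D.ends e using Sym2.inductionOn with
    | _ x y => exact ⟨x, y, rfl⟩
  rcases (hD.pos_ne hn h).lt_or_gt with hlt | hlt
  · exact ⟨x, y, h, hlt⟩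
  · exact ⟨y, x, by rw [h, Sym2.eq_swap], hlt⟩

theorem exists_node (x : D.V) : ∃ k, k ≤ b + 1 ∧ D.pos x = nodePos p k := by
  rcases hD.pos_cases x with h | h | ⟨i, h⟩
  · exact ⟨0, by omega, h⟩
  · exact ⟨b + 1, le_rfl, by rw [h, nodePos_last]⟩
  · exact ⟨i + 1, by omega, by rw [h, nodePos_succ]⟩

end IsTwistedTropicalCover

open Classical in
theorem valence_eq {D : CoverData.{u, v}} {src tgt : D.E → D.V}
    (h : ∀ e, D.ends e = s(src e, tgt e)) (hne : ∀ e, src e ≠ tgt e) (x : D.V) :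
    D.valence x = (Finset.univ.filter fun e => tgt e = x).card +
      (Finset.univ.filter fun e => src e = x).card := by
  unfold MetricGraph.valence
  rw [Finset.card_filter, Finset.card_filter, ← Finset.sum_add_distrib]
  refine Finset.sum_congr rfl fun e _ => ?_
  have h1 := hne e
  have h2 : ¬ (D.ends e).IsDiag := by rw [h, Sym2.mk_isDiag_iff]; exact h1
  rw [if_neg h2, h]
  simp only [Sym2.mem_iff]
  by_cases hs : src e = x
  · subst hs
    simp [h1.symm]
  · by_cases ht : tgt e = x
    · subst ht
      simp [h1]
    · simp [hs, ht, Ne.symm hs, Ne.symm ht]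

namespace IsTwistedTropicalCover

variable {D : CoverData.{u, v}} {n b g : ℕ} {μ ν : n.Partition} {p : Fin b → ℝ}

open Classical in
-- No edge is contracted, so each has a left and a right end, and linearity can be solved for its
-- length. Vertices over `±∞` are leaves because all other vertices lie over branch points; this
-- gives the uniqueness of the edge at them.
theorem exists_orientation (hD : D.IsTwistedTropicalCover g μ ν p) (hn : 0 < n) :
    Nonempty (D.Orientation p) := by
  choose src tgt ends lt using hD.exists_oriented hn
  choose node node_le pos using hD.exists_node
  have hval := valence_eq ends fun e h => (h ▸ lt e).false
  have leaf : ∀ x, (node x = 0 ∨ node x = b + 1) → D.valence x = 1 := by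
    intro x hx
    by_contra hleaf
    obtain ⟨i, hi⟩ := hD.cover.pos_inner x hleaf
    rw [pos, ← nodePos_succ] at hi
    have := nodePos_injective hD.branch_strictMono (node_le x) (by omega) hi
    omega
  refine ⟨⟨src, tgt, node, ends, pos, node_le, fun e => ?_, fun e => ?_,
    fun x => ?_, fun e e' he h => ?_, fun e e' he h => ?_⟩⟩
  · have := lt e
    rwa [pos, pos, nodePos_lt_iff hD.branch_strictMono (node_le _) (node_le _)] at this
  · have h1 := hD.cover.linear e _ _ (ends e) (lt e).le
    have h2 := hD.weight_pos hn e
    rw [← pos, ← pos, h1, EReal.toENNReal_coe, mul_comm,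
      ENNReal.mul_div_cancel_right (by exact_mod_cast h2.ne') (ENNReal.natCast_ne_top _)]
  · by_contra! h
    have h1 : D.valence x = 0 := by
      rw [hval, Finset.filter_false_of_mem fun e _ => (h e).2,
        Finset.filter_false_of_mem fun e _ => (h e).1]
      rfl
    by_cases hl : D.IsLeaf x
    · unfold MetricGraph.IsLeaf at hl
      omega
    · obtain ⟨i, hi⟩ := hD.cover.pos_inner x hl
      rcases hD.valence_of_pos hi with h | h <;> omega
  · have h1 := leaf _ (Or.inl he)
    rw [hval] at h1
    have h2 : (Finset.univ.filter fun e' => src e' = src e).card ≤ 1 := by omega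
    exact Finset.card_le_one.1 h2 e (by simp) e' (by simp [h])
  · have h1 := leaf _ (Or.inr he)
    rw [hval] at h1
    have h2 : (Finset.univ.filter fun e' => tgt e' = tgt e).card ≤ 1 := by omega
    exact Finset.card_le_one.1 h2 e (by simp) e' (by simp [h])

end IsTwistedTropicalCover

end CoverData

end

/-! ### The nodes of a cover: joins, cuts and `4`-valent vertices -/

section

open PermTuple

/-- The involution carries the edges at `x` to those at `j x`, so it is enough to know one of the
two vertices. -/
theorem TwistData.isJoin_of_vertex {α E V : Type*} {T : TwistData α E} {N : NodeData E V}
    {j : V → V} (hj : ∀ x, j (j x) = x) {x : V} (hx : j x ≠ x)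
    (htgt : ∀ e, N.tgt (T.ι e) = j (N.tgt e)) (hsrc : ∀ e, N.src (T.ι e) = j (N.src e))
    (hIn : ∀ e, e ∈ N.In ↔ N.tgt e = x ∨ N.tgt e = j x)
    (hOut : ∀ e, e ∈ N.Out ↔ N.src e = x ∨ N.src e = j x)
    (hA : N.In ⊆ N.A) (hB : N.Out ⊆ N.B)
    (hstay : ∀ e, (e ∈ N.A ∧ e ∉ N.In) ↔ (e ∈ N.B ∧ e ∉ N.Out)) {e₁ e₂ e₃ : E} (hne : e₁ ≠ e₂)
    (h₁ : ∀ e, N.tgt e = x ↔ e = e₁ ∨ e = e₂) (h₂ : ∀ e, N.src e = x ↔ e = e₃)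
    (hw : T.w e₃ = T.w e₁ + T.w e₂) : T.IsJoin N e₁ e₂ e₃ := by
  have hι : ∀ e e', T.ι e = e' ↔ e = T.ι e' := fun e e' =>
    ⟨fun h => by rw [← h, T.inv_inv], fun h => by rw [h, T.inv_inv]⟩
  have h₁' : ∀ e, N.tgt e = j x ↔ e = T.ι e₁ ∨ e = T.ι e₂ := by
    intro e
    rw [← hι, ← hι, ← h₁, htgt]
    exact ⟨fun h => by rw [h, hj], fun h => by rw [← h, hj]⟩
  have h₂' : ∀ e, N.src e = j x ↔ e = T.ι e₃ := by
    intro e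
    rw [← hι, ← h₂, hsrc]
    exact ⟨fun h => by rw [h, hj], fun h => by rw [← h, hj]⟩
  have e1 : N.tgt e₁ = x := (h₁ _).2 (Or.inl rfl)
  have e2 : N.tgt e₂ = x := (h₁ _).2 (Or.inr rfl)
  have e3 : N.src e₃ = x := (h₂ _).2 rfl
  refine ⟨fun e => ?_, fun e => ?_, hA, hB, hstay, hne, by rw [e1, e3], by rw [e2, e3],
    by rw [htgt, hsrc, e1, e3], by rw [htgt, hsrc, e2, e3], by rw [hsrc, e3]; exact hx.symm, hw⟩
  · rw [hIn, h₁, h₁']; tauto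
  · rw [hOut, h₂, h₂']

namespace CoverData

variable {D : CoverData.{u, v}} {n b g : ℕ} {μ ν : n.Partition} {p : Fin b → ℝ}

namespace Orientation

variable (o : D.Orientation p)

/-- The edges over the interval between the nodes `m` and `m + 1`. -/
def level (m : ℕ) : Set D.E := {e | o.node (o.src e) ≤ m ∧ m < o.node (o.tgt e)}

/-- The edges of `D` near the node `m + 1`. -/
def nodeData (m : ℕ) : NodeData D.E D.V where
  A := o.level m
  B := o.level (m + 1)
  In := {e | o.node (o.tgt e) = m + 1}
  Out := {e | o.node (o.src e) = m + 1}
  tgt := o.tgt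
  src := o.src

theorem In_subset (m : ℕ) : (o.nodeData m).In ⊆ (o.nodeData m).A := by
  intro e (he : o.node (o.tgt e) = m + 1)
  have := o.lt e
  exact ⟨by omega, by omega⟩

theorem Out_subset (m : ℕ) : (o.nodeData m).Out ⊆ (o.nodeData m).B := by
  intro e (he : o.node (o.src e) = m + 1)
  have := o.lt e
  exact ⟨by omega, by omega⟩

theorem stay_iff (m : ℕ) (e : D.E) :
    (e ∈ (o.nodeData m).A ∧ e ∉ (o.nodeData m).In) ↔
      (e ∈ (o.nodeData m).B ∧ e ∉ (o.nodeData m).Out) := by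
  have := o.lt e
  simp only [nodeData, level, Set.mem_ofPred_eq]
  omega

theorem ends_eq {x y : D.V} {e : D.E} (h : D.ends e = s(x, y)) (hlt : o.node x < o.node y) :
    o.src e = x ∧ o.tgt e = y := by
  rw [o.ends, Sym2.eq_iff] at h
  rcases h with h | ⟨h1, h2⟩
  · exact h
  · have := o.lt e
    rw [h1, h2] at this
    omega

theorem src_ne_tgt (e : D.E) : o.src e ≠ o.tgt e := fun h => by
  have := o.lt e
  rw [h] at this
  exact lt_irrefl _ this

section

variable (hp : StrictMono p) (hI : D.IsInvolution)
include hp hI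

theorem node_invV (x : D.V) : o.node (D.invV x) = o.node x := by
  refine nodePos_injective hp (o.node_le _) (o.node_le _) ?_
  rw [← o.pos, ← o.pos, hI.pos]

theorem src_tgt_invE (e : D.E) :
    o.src (D.invE e) = D.invV (o.src e) ∧ o.tgt (D.invE e) = D.invV (o.tgt e) := by
  refine o.ends_eq ?_ ?_
  · rw [hI.ends, o.ends, Sym2.map_mk]
  · rw [o.node_invV hp hI, o.node_invV hp hI]
    exact o.lt e

end

open Classical in
theorem leftDegree_eq (hp : StrictMono p) (x : D.V) :
    D.leftDegree x = ∑ e with o.tgt e = x, D.weight e := by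
  unfold leftDegree
  refine Finset.sum_congr (Finset.filter_congr fun e _ => ?_) fun _ _ => rfl
  constructor
  · rintro ⟨y, h, hlt⟩
    rw [o.pos, o.pos, nodePos_lt_iff hp (o.node_le _) (o.node_le _)] at hlt
    exact (o.ends_eq h hlt).2
  · rintro rfl
    refine ⟨o.src e, o.ends e, ?_⟩
    rw [o.pos, o.pos, nodePos_lt_iff hp (o.node_le _) (o.node_le _)]
    exact o.lt e

open Classical in
theorem rightDegree_eq (hp : StrictMono p) (x : D.V) :
    D.rightDegree x = ∑ e with o.src e = x, D.weight e := by
  unfold rightDegree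
  refine Finset.sum_congr (Finset.filter_congr fun e _ => ?_) fun _ _ => rfl
  constructor
  · rintro ⟨y, h, hlt⟩
    rw [o.pos, o.pos, nodePos_lt_iff hp (o.node_le _) (o.node_le _)] at hlt
    exact (o.ends_eq h hlt).1
  · rintro rfl
    refine ⟨o.tgt e, o.ends e, ?_⟩
    rw [o.pos, o.pos, nodePos_lt_iff hp (o.node_le _) (o.node_le _)]
    exact o.lt e

end Orientation

/-- The labels of a twisted tropical cover: its edges. -/
def IsTwistedTropicalCover.twistData (hD : D.IsTwistedTropicalCover g μ ν p) (hn : 0 < n) :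
    TwistData (Pts n) D.E where
  τ := tau n
  ι := D.invE
  w := D.weight
  tau_mul_tau := tau_mul_tau n
  tau_ne x := by cases x <;> simp [tau]
  inv_inv := hD.involution.invE_invE
  inv_ne := hD.fixed_edge
  w_inv := hD.involution.weight
  w_pos := hD.weight_pos hn

namespace IsTwistedTropicalCover

variable (hD : D.IsTwistedTropicalCover g μ ν p) (hn : 0 < n) (o : D.Orientation p)

include hD

theorem pos_eq_iff (m : Fin b) (x : D.V) : D.pos x = (p m : EReal) ↔ o.node x = m + 1 := by
  rw [o.pos, ← nodePos_succ]
  exact ⟨fun h => nodePos_injective hD.branch_strictMono (o.node_le _) (by omega) h,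
    fun h => by rw [h]⟩

open Classical in
/-- Over every branch point the cover has two joins, two cuts, or a `4`-valent vertex. -/
theorem node_cases (m : ℕ) (hm : m < b) :
    ((∃ e₁ e₂ e₃, (hD.twistData hn).IsJoin (o.nodeData m) e₁ e₂ e₃) ∧
      ∀ x, o.node x = m + 1 → D.valence x ≠ 4) ∨
    ((∃ e₁ e₂ e₃, (hD.twistData hn).IsJoin (o.nodeData m).rev e₁ e₂ e₃) ∧
      ∀ x, o.node x = m + 1 → D.valence x ≠ 4) ∨
    ∃ e₁ e₂ x, (hD.twistData hn).IsRearrangement (o.nodeData m) e₁ e₂ ∧ D.valence x = 4 ∧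
      (∀ y, o.node y = m + 1 ↔ y = x) ∧ D.vertexWeight x = D.weight e₁ := by
  have hp := hD.branch_strictMono
  have hI := hD.involution
  have hpos := hD.pos_eq_iff o ⟨m, hm⟩
  have hfib := hD.fibre ⟨m, hm⟩
  have hval := valence_eq o.ends o.src_ne_tgt
  have hdeg : ∀ x, o.node x = m + 1 →
      ∑ e with o.tgt e = x, D.weight e = ∑ e with o.src e = x, D.weight e := by
    intro x hx
    rw [← o.leftDegree_eq hp, ← o.rightDegree_eq hp]
    exact hD.cover.balanced x (hD.not_isLeaf ((hpos x).2 hx))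
  have htgt := fun e => (o.src_tgt_invE hp hI e).2
  have hsrc := fun e => (o.src_tgt_invE hp hI e).1
  simp only [hpos] at hfib
  rcases hfib with ⟨hcard, h3⟩ | ⟨hcard, h4⟩
  · obtain ⟨x, hx⟩ : {x | o.node x = m + 1}.Nonempty :=
      Set.nonempty_of_ncard_ne_zero (by rw [hcard]; omega)
    have hx : o.node x = m + 1 := hx
    have hv := h3 x hx
    have hxι : D.invV x ≠ x := fun h => by
      have := (hD.fixed_vertex x).1 h
      omega
    have hmem : ∀ y, o.node y = m + 1 ↔ y = x ∨ y = D.invV x := by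
      intro y
      constructor
      · intro hy
        exact hD.eq_or_eq_inv ((hpos x).2 hx) ((hpos y).2 hy)
      · rintro (rfl | rfl)
        · exact hx
        · rw [o.node_invV hp hI, hx]
    have hno : ∀ x, o.node x = m + 1 → D.valence x ≠ 4 := by
      intro y hy
      rw [h3 y hy]
      omega
    have hd := hdeg x hx
    rw [hval] at hv
    have hwpos := hD.weight_pos hn
    -- All weights are positive, so balancing forbids a vertex with edges on one side only. Valence
    -- `3` then splits as `2 + 1` or `1 + 2`.
    have hpos1 : (Finset.univ.filter fun e => o.tgt e = x).card ≠ 0 := by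
      intro h
      rw [Finset.card_eq_zero] at h
      rw [h, Finset.sum_empty, eq_comm, Finset.sum_eq_zero_iff] at hd
      have h5 : (Finset.univ.filter fun e => o.src e = x).Nonempty := by
        rw [← Finset.card_pos]
        rw [h, Finset.card_empty] at hv
        omega
      obtain ⟨e, he⟩ := h5
      exact (hwpos e).ne' (hd e he)
    have hpos2 : (Finset.univ.filter fun e => o.src e = x).card ≠ 0 := by
      intro h
      rw [Finset.card_eq_zero] at h
      rw [h, Finset.sum_empty, Finset.sum_eq_zero_iff] at hd
      have h5 : (Finset.univ.filter fun e => o.tgt e = x).Nonempty := by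
        rw [← Finset.card_pos]
        rw [h, Finset.card_empty] at hv
        omega
      obtain ⟨e, he⟩ := h5
      exact (hwpos e).ne' (hd e he)
    obtain h5 | h5 : (Finset.univ.filter fun e => o.tgt e = x).card = 2 ∧
        (Finset.univ.filter fun e => o.src e = x).card = 1 ∨
        (Finset.univ.filter fun e => o.tgt e = x).card = 1 ∧
        (Finset.univ.filter fun e => o.src e = x).card = 2 := by omega
    · left
      obtain ⟨e₁, e₂, hne, h6⟩ := Finset.card_eq_two.1 h5.1
      obtain ⟨e₃, h7⟩ := Finset.card_eq_one.1 h5.2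
      refine ⟨⟨e₁, e₂, e₃, ?_⟩, hno⟩
      rw [h6, h7, Finset.sum_pair hne, Finset.sum_singleton] at hd
      refine TwistData.isJoin_of_vertex (T := hD.twistData hn) (N := o.nodeData m) hI.invV_invV hxι htgt hsrc (fun e => hmem _)
        (fun e => hmem _) (o.In_subset m) (o.Out_subset m) (o.stay_iff m) hne ?_ ?_ hd.symm
      · intro e
        have := Finset.ext_iff.1 h6 e
        change o.tgt e = x ↔ _
        simpa using this
      · intro e
        have := Finset.ext_iff.1 h7 e
        change o.src e = x ↔ _
        simpa using this
    · right; left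
      obtain ⟨e₁, e₂, hne, h6⟩ := Finset.card_eq_two.1 h5.2
      obtain ⟨e₃, h7⟩ := Finset.card_eq_one.1 h5.1
      refine ⟨⟨e₁, e₂, e₃, ?_⟩, hno⟩
      rw [h6, h7, Finset.sum_pair hne, Finset.sum_singleton] at hd
      refine TwistData.isJoin_of_vertex (T := hD.twistData hn) (N := (o.nodeData m).rev) hI.invV_invV hxι hsrc htgt
        (fun e => hmem _) (fun e => hmem _) (o.Out_subset m) (o.In_subset m)
        (fun e => (o.stay_iff m e).symm) hne ?_ ?_ hd
      · intro e
        have := Finset.ext_iff.1 h6 e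
        change o.src e = x ↔ _
        simpa using this
      · intro e
        have := Finset.ext_iff.1 h7 e
        change o.tgt e = x ↔ _
        simpa using this
  · right; right
    obtain ⟨x, hx⟩ := Set.ncard_eq_one.1 hcard
    have hmem : ∀ y, o.node y = m + 1 ↔ y = x := fun y => Set.ext_iff.1 hx y
    have hxm := (hmem x).2 rfl
    have hv := h4 x hxm
    have hxι : D.invV x = x := (hD.fixed_vertex x).2 hv
    have hd := hdeg x hxm
    have hends : ∀ e, x ∈ D.ends e ↔ x = o.src e ∨ x = o.tgt e := fun e => by
      rw [o.ends, Sym2.mem_iff]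
    have hvw : ∀ e, x ∈ D.ends e → D.vertexWeight x = D.weight e := by
      intro e he
      unfold vertexWeight
      apply le_antisymm
      · refine Finset.sup_le fun e' he' => ?_
        rw [Finset.mem_filter] at he'
        exact (hD.four_valent x hv e' e he'.2 he).le
      · exact Finset.le_sup (f := D.weight) (by simpa using he)
    -- As the weights agree, balancing says that the numbers of incoming and outgoing edges are
    -- equal, hence `2` and `2`.
    rw [Finset.sum_congr rfl fun e he => (hvw e ((hends e).2 (Or.inr
        (Finset.mem_filter.1 he).2.symm))).symm,
      Finset.sum_congr (s₁ := Finset.univ.filter fun e => o.src e = x) rfl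
        fun e he => (hvw e ((hends e).2 (Or.inl (Finset.mem_filter.1 he).2.symm))).symm,
      Finset.sum_const, Finset.sum_const, smul_eq_mul, smul_eq_mul] at hd
    have hpos : 0 < D.vertexWeight x := by
      obtain ⟨e, he⟩ := o.exists_edge x
      rw [hvw e ((hends e).2 (by tauto))]
      exact hD.weight_pos hn e
    have hcard := Nat.eq_of_mul_eq_mul_right hpos hd
    rw [hval] at hv
    -- The involution fixes the vertex but no edge, so the two edges on either side are exchanged.
    have pair : ∀ f : D.E → D.V, (∀ e, f (D.invE e) = D.invV (f e)) →
        (Finset.univ.filter fun e => f e = x).card = 2 →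
        ∃ e₁, f e₁ = x ∧ ∀ e, f e = x ↔ e = e₁ ∨ e = D.invE e₁ := by
      intro f hf hc
      obtain ⟨e₁, he₁⟩ : (Finset.univ.filter fun e => f e = x).Nonempty := by
        rw [← Finset.card_pos]; omega
      have he₁' : f e₁ = x := (Finset.mem_filter.1 he₁).2
      refine ⟨e₁, he₁', ?_⟩
      have h5 : ({e₁, D.invE e₁} : Finset D.E) = Finset.univ.filter fun e => f e = x := by
        refine Finset.eq_of_subset_of_card_le ?_ ?_
        · intro e he
          rw [Finset.mem_insert, Finset.mem_singleton] at he
          rcases he with rfl | rfl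
          · exact he₁
          · simp [hf, he₁', hxι]
        · rw [hc, Finset.card_pair (hD.fixed_edge e₁).symm]
      intro e
      have := Finset.ext_iff.1 h5 e
      simpa using this.symm
    obtain ⟨e₁, he₁, h5⟩ := pair o.tgt htgt (by omega)
    obtain ⟨e₂, he₂, h6⟩ := pair o.src hsrc (by omega)
    have hv1 := hvw e₁ ((hends e₁).2 (Or.inr he₁.symm))
    have hv2 := hvw e₂ ((hends e₂).2 (Or.inl he₂.symm))
    refine ⟨e₁, e₂, x, ⟨fun e => (hmem _).trans (h5 e), fun e => (hmem _).trans (h6 e),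
      o.In_subset m, o.Out_subset m, o.stay_iff m, fun e he e' he' => ?_, hv1.symm.trans hv2⟩,
      h4 x hxm, hmem, hv1⟩
    exact ((hmem _).1 he).trans ((hmem _).1 he').symm

open Classical in
/-- The number of transitions at a node. -/
theorem card_transition {m : ℕ} (hm : m < b) {s : Equiv.Perm (Pts n) × (Pts n → D.E)}
    (hs : (hD.twistData hn).IsLabelled (o.level m) s) {R : Set D.E}
    (hR : (hD.twistData hn).IsTransversal R) :
    Nat.card {q : Equiv.Perm (Pts n) × (Equiv.Perm (Pts n) × (Pts n → D.E)) //
        (hD.twistData hn).IsTransition (o.nodeData m) s q.1 q.2} =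
      2 * ((∏ e with o.node (o.tgt e) = m + 1 ∧ e ∈ R, D.weight e) *
        ∏ x with o.node x = m + 1 ∧ D.valence x = 4, (D.vertexWeight x - 1)) := by
  have hs' : (hD.twistData hn).IsLabelled (o.nodeData m).A s := hs
  have hprod : ∏ e with e ∈ (o.nodeData m).In ∧ e ∈ R, (hD.twistData hn).w e =
      ∏ e with o.node (o.tgt e) = m + 1 ∧ e ∈ R, D.weight e := by
    refine Finset.prod_congr (Finset.ext fun e => ?_) fun _ _ => rfl
    simp only [Finset.mem_filter]
    rfl
  rcases hD.node_cases hn o m hm with ⟨⟨e₁, e₂, e₃, J⟩, h4⟩ | ⟨⟨e₁, e₂, e₃, J⟩, h4⟩ |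
    ⟨e₁, e₂, x, J, h4, hx, hw⟩
  · rw [J.card_transition hs', Finset.filter_false_of_mem (p := fun x => _ ∧ D.valence x = 4)
      fun x _ h => h4 x h.1 h.2, Finset.prod_empty, mul_one]
    exact congrArg _ ((hR.prod_pair_pair J.ne J.ne' J.mem_In).symm.trans hprod)
  -- At a cut the only incoming pair is that of the edge that is cut.
  · rw [J.card_transition_of_rev hs', Finset.filter_false_of_mem (p := fun x => _ ∧ D.valence x = 4)
      fun x _ h => h4 x h.1 h.2, Finset.prod_empty, mul_one]
    exact congrArg _ ((hR.prod_pair J.mem_Out).symm.trans hprod)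
  · have h5 : (Finset.univ.filter fun x => o.node x = m + 1 ∧ D.valence x = 4) = {x} := by
      ext y
      simp only [Finset.mem_filter, Finset.mem_univ, true_and, Finset.mem_singleton, hx]
      exact ⟨fun h => h.1, fun h => ⟨h, h ▸ h4⟩⟩
    rw [J.card_transition hs', h5, Finset.prod_singleton, hw]
    exact congrArg _ (congrArg (· * _) ((hR.prod_pair J.mem_In).symm.trans hprod))

/-- No edge joins `-∞` to `+∞`. -/
theorem node_tgt_le (hn : 0 < n) (e : D.E) (he : o.node (o.src e) = 0) : o.node (o.tgt e) ≤ b := by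
  by_contra h
  have he' : o.node (o.tgt e) = b + 1 := by
    have := o.node_le (o.tgt e)
    omega
  have hb := hD.b_pos hn
  -- Both ends of such an edge would be leaves, so the edge would be a whole component. As `0 < b`,
  -- there is also a vertex over the first branch point, against connectedness.
  have key : ∀ z, Relation.ReflTransGen D.Adj (o.src e) z → z = o.src e ∨ z = o.tgt e := by
    intro z hz
    induction hz with
    | refl => exact Or.inl rfl
    | @tail y z _ hadj ih =>
      obtain ⟨e', h'⟩ := hadj
      have h5 := o.ends e'
      rw [h', Sym2.eq_iff] at h5
      have hlt := o.lt e'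
      have hle := o.node_le (o.tgt e')
      rcases ih with rfl | rfl
      · rcases h5 with ⟨h6, h7⟩ | ⟨h6, h7⟩
        · have := o.src_inj e e' he h6
          subst this
          exact Or.inr h7
        · rw [← h6, he] at hlt
          omega
      · rcases h5 with ⟨h6, h7⟩ | ⟨h6, h7⟩
        · rw [← h6, he'] at hlt
          omega
        · have := o.tgt_inj e e' he' h6
          subst this
          exact Or.inl h7
  obtain ⟨z, hz⟩ : ∃ z, o.node z = 1 := by
    have h1 : {x | D.pos x = (p ⟨0, hb⟩ : EReal)}.Nonempty := by
      rcases hD.fibre ⟨0, hb⟩ with h | h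
      · exact Set.nonempty_of_ncard_ne_zero (by rw [h.1]; omega)
      · exact Set.nonempty_of_ncard_ne_zero (by rw [h.1]; omega)
    obtain ⟨z, hz⟩ := h1
    exact ⟨z, (hD.pos_eq_iff o ⟨0, hb⟩ z).1 hz⟩
  rcases key z (hD.cover.curve.connected _ _) with rfl | rfl <;> omega

end IsTwistedTropicalCover

end CoverData

end

section

/-! ### Counting the labelled factorisations of a cover -/

open PermTuple

namespace CoverData

namespace IsTwistedTropicalCover

variable {D : CoverData.{u, v}} {n b g : ℕ} {μ ν : n.Partition} {p : Fin b → ℝ}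
  (hD : D.IsTwistedTropicalCover g μ ν p) (hn : 0 < n) (o : D.Orientation p)

/-- A sequence of transpositions, with the intermediate permutations whose cycles are labelled by
the edges of the cover. -/
def IsPath (q : (Fin (b + 1) → Equiv.Perm (Pts n) × (Pts n → D.E)) ×
    (Fin b → Equiv.Perm (Pts n))) : Prop :=
  (hD.twistData hn).IsLabelled (o.level 0) (q.1 0) ∧ ∀ i : Fin b,
    (hD.twistData hn).IsTransition (o.nodeData i) (q.1 i.castSucc) (q.2 i) (q.1 i.succ)

include hD

theorem isLeaf_iff (x : D.V) : D.IsLeaf x ↔ o.node x = 0 ∨ o.node x = b + 1 := by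
  constructor
  · intro h
    rcases hD.cover.pos_leaf x h with h | h
    · left
      refine nodePos_injective hD.branch_strictMono (o.node_le x) (by omega) ?_
      rw [← o.pos, h]
      rfl
    · right
      refine nodePos_injective hD.branch_strictMono (o.node_le x) le_rfl ?_
      rw [← o.pos, h, nodePos_last]
  · intro h
    by_contra hl
    obtain ⟨i, hi⟩ := hD.cover.pos_inner x hl
    rw [hD.pos_eq_iff o] at hi
    omega

theorem length_ne_top_iff (e : D.E) :
    D.length e ≠ ⊤ ↔ o.node (o.src e) ≠ 0 ∧ o.node (o.tgt e) ≤ b := by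
  have h1 := o.lt e
  have h2 := o.node_le (o.tgt e)
  rw [Ne, hD.cover.curve.length_eq_top]
  have : D.IsEnd e ↔ o.node (o.src e) = 0 ∨ o.node (o.tgt e) = b + 1 := by
    unfold MetricGraph.IsEnd
    constructor
    · rintro ⟨x, hx, hl⟩
      rw [o.ends, Sym2.mem_iff] at hx
      rw [hD.isLeaf_iff o] at hl
      rcases hx with rfl | rfl <;> omega
    · rintro (h | h)
      · exact ⟨o.src e, by rw [o.ends]; exact Sym2.mem_mk_left _ _,
          (hD.isLeaf_iff o _).2 (Or.inl h)⟩
      · exact ⟨o.tgt e, by rw [o.ends]; exact Sym2.mem_mk_right _ _,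
          (hD.isLeaf_iff o _).2 (Or.inr h)⟩
  rw [this]
  omega

open Classical in
theorem leftWeights_eq : D.leftWeights =
    (Finset.univ.filter fun e => e ∈ o.level 0).val.map D.weight := by
  unfold leftWeights
  congr 2
  refine Finset.filter_congr fun e _ => ?_
  have h1 := o.lt e
  have key : ∀ x, D.pos x = ⊥ ↔ o.node x = 0 := by
    intro x
    rw [o.pos]
    refine ⟨fun h => nodePos_injective hD.branch_strictMono (o.node_le _) (by omega) h, fun h => ?_⟩
    rw [h]
    rfl
  simp only [key, o.ends, Sym2.mem_iff, Orientation.level, Set.mem_ofPred_eq]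
  constructor
  · rintro ⟨x, rfl | rfl, h⟩ <;> omega
  · rintro ⟨h, -⟩
    exact ⟨_, Or.inl rfl, by omega⟩

open Classical in
theorem rightWeights_eq : D.rightWeights =
    (Finset.univ.filter fun e => e ∈ o.level b).val.map D.weight := by
  unfold rightWeights
  congr 2
  refine Finset.filter_congr fun e _ => ?_
  have h1 := o.lt e
  have h2 := o.node_le (o.tgt e)
  have key : ∀ x, D.pos x = ⊤ ↔ o.node x = b + 1 := by
    intro x
    rw [o.pos, ← nodePos_last p]
    refine ⟨fun h => nodePos_injective hD.branch_strictMono (o.node_le _) le_rfl h, fun h => ?_⟩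
    rw [h]
  simp only [key, o.ends, Sym2.mem_iff, Orientation.level, Set.mem_ofPred_eq]
  constructor
  · rintro ⟨x, rfl | rfl, h⟩ <;> omega
  · rintro ⟨h, h'⟩
    exact ⟨_, Or.inr rfl, by omega⟩

omit hD in
theorem card_pts (n : ℕ) : Nat.card (Pts n) = 2 * n := by
  simp [Pts]; ring

open Classical in
-- The edges over the first interval are the ends over `-∞`, whose weights add up to the number `2n`
-- of points, as the general count requires.
theorem card_isLabelled_level_zero {R : Set D.E} (hR : (hD.twistData hn).IsTransversal R) :
    Nat.card {s // (hD.twistData hn).IsLabelled (o.level 0) s} *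
      ∏ e with o.node (o.src e) = 0 ∧ e ∈ R, D.weight e = Nat.doubleFactorial (2 * n) := by
  refine Eq.trans ?_ (((hD.twistData hn).card_isLabelled (A := o.level 0) ?_ ?_ hR).trans
    (card_centralizer_tau n))
  · congr 1
    refine Finset.prod_congr (Finset.ext fun e => ?_) fun _ _ => rfl
    have := o.lt e
    simp only [Finset.mem_filter, Finset.mem_univ, true_and]
    change _ ↔ (o.node (o.src e) ≤ 0 ∧ 0 < o.node (o.tgt e)) ∧ e ∈ R
    refine and_congr ?_ Iff.rfl
    omega
  · intro e he
    have h := o.src_tgt_invE hD.branch_strictMono hD.involution e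
    change o.node (o.src (D.invE e)) ≤ 0 ∧ 0 < o.node (o.tgt (D.invE e))
    rw [h.1, h.2, o.node_invV hD.branch_strictMono hD.involution,
      o.node_invV hD.branch_strictMono hD.involution]
    exact he
  · have h := congrArg Multiset.sum ((hD.leftWeights_eq o).symm.trans hD.left_ends)
    rw [Multiset.sum_add, μ.parts_sum] at h
    rw [card_pts, two_mul]
    exact h

open Classical in
/-- The number of labelled factorisations. -/
theorem card_isPath {R : Set D.E} (hR : (hD.twistData hn).IsTransversal R) :
    Nat.card {q // hD.IsPath hn o q} =
      Nat.doubleFactorial (2 * n) * 2 ^ b * (∏ x with D.valence x = 4, (D.vertexWeight x - 1)) *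
        ∏ e with e ∈ R ∧ D.length e ≠ ⊤, D.weight e := by
  have h1 := card_paths (fun m => (hD.twistData hn).IsTransition (o.nodeData m))
    (fun m => (hD.twistData hn).IsLabelled (o.level m)) _ b
    (fun m _ s η s' _ h => h.right) (fun m hm s hs => hD.card_transition hn o hm hs hR)
  rw [Finset.prod_mul_distrib, Finset.prod_mul_distrib, Finset.prod_const, Finset.card_range] at h1
  -- Grouped by their right ends, the factors run over the edges of `R` that end at a branch point.
  -- They are split into those that come from `-∞`, all of which occur, and the internal ones.
  have h2 : ∏ m ∈ Finset.range b, ∏ e with o.node (o.tgt e) = m + 1 ∧ e ∈ R, D.weight e =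
      (∏ e with o.node (o.src e) = 0 ∧ e ∈ R, D.weight e) *
        ∏ e with e ∈ R ∧ D.length e ≠ ⊤, D.weight e := by
    have h3 := Finset.prod_fiberwise_of_maps_to
      (s := Finset.univ.filter fun e => e ∈ R ∧ o.node (o.tgt e) ≤ b) (t := Finset.range b)
      (g := fun e => o.node (o.tgt e) - 1) (fun e he => by
        have := o.lt e
        simp only [Finset.mem_filter, Finset.mem_univ, true_and] at he
        rw [Finset.mem_range]
        omega) D.weight
    have h4 := Finset.prod_filter_mul_prod_filter_not
      (Finset.univ.filter fun e => e ∈ R ∧ o.node (o.tgt e) ≤ b) (fun e => o.node (o.src e) = 0)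
      D.weight
    refine (Eq.trans ?_ h3).trans (h4.symm.trans ?_)
    · refine Finset.prod_congr rfl fun m hm => Finset.prod_congr (Finset.ext fun e => ?_)
        fun _ _ => rfl
      have := o.lt e
      rw [Finset.mem_range] at hm
      simp only [Finset.mem_filter, Finset.mem_univ, true_and]
      constructor
      · rintro ⟨h5, h6⟩
        exact ⟨⟨h6, by omega⟩, by omega⟩
      · rintro ⟨⟨h5, h6⟩, h7⟩
        exact ⟨by omega, h5⟩
    · congr 1
      · refine Finset.prod_congr (Finset.ext fun e => ?_) fun _ _ => rfl
        simp only [Finset.mem_filter, Finset.mem_univ, true_and]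
        exact ⟨fun h => ⟨h.2, h.1.1⟩, fun h => ⟨⟨h.2, hD.node_tgt_le o hn e h.1⟩, h.1⟩⟩
      · refine Finset.prod_congr (Finset.ext fun e => ?_) fun _ _ => rfl
        simp only [Finset.mem_filter, Finset.mem_univ, true_and, hD.length_ne_top_iff o]
        tauto
  -- A `4`-valent vertex is not a leaf, so it lies over exactly one branch point.
  have h3 : ∏ m ∈ Finset.range b, ∏ x with o.node x = m + 1 ∧ D.valence x = 4,
      (D.vertexWeight x - 1) = ∏ x with D.valence x = 4, (D.vertexWeight x - 1) := by
    have h3 := Finset.prod_fiberwise_of_maps_to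
      (s := Finset.univ.filter fun x => D.valence x = 4) (t := Finset.range b)
      (g := fun x => o.node x - 1) (fun x hx => by
        simp only [Finset.mem_filter, Finset.mem_univ, true_and] at hx
        have h4 : ¬ D.IsLeaf x := by
          unfold MetricGraph.IsLeaf
          omega
        rw [hD.isLeaf_iff o] at h4
        have := o.node_le x
        rw [Finset.mem_range]
        omega) (fun x => D.vertexWeight x - 1)
    refine Eq.trans ?_ h3
    refine Finset.prod_congr rfl fun m hm => Finset.prod_congr (Finset.ext fun x => ?_)
      fun _ _ => rfl
    simp only [Finset.mem_filter, Finset.mem_univ, true_and]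
    constructor
    · rintro ⟨h5, h6⟩
      exact ⟨h6, by omega⟩
    · rintro ⟨h5, h6⟩
      have h4 : ¬ D.IsLeaf x := by
        unfold MetricGraph.IsLeaf
        omega
      rw [hD.isLeaf_iff o] at h4
      exact ⟨by omega, h5⟩
  rw [h2, h3] at h1
  rw [← hD.card_isLabelled_level_zero hn o hR]
  refine h1.trans ?_
  ring

theorem vertexWeight_pos (hn : 0 < n) (x : D.V) : 0 < D.vertexWeight x := by
  classical
  obtain ⟨o⟩ := hD.exists_orientation hn
  obtain ⟨e, he⟩ := o.exists_edge x
  have hx : x ∈ D.ends e := by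
    rw [o.ends, Sym2.mem_iff]
    exact he.imp Eq.symm Eq.symm
  refine (hD.weight_pos hn e).trans_le ?_
  unfold vertexWeight
  exact Finset.le_sup (f := D.weight) (by simpa using hx)

open Classical in
-- A transversal of the involution is a set of representatives for the edges of the quotient, and an
-- edge is internal when its length is finite.
theorem prod_quotEdge {R : Set D.E} (hR : (hD.twistData hn).IsTransversal R) :
    ∏ e : D.QuotEdge with quotLength hD.involution e ≠ ⊤, quotWeight hD.involution e =
      ∏ e with e ∈ R ∧ D.length e ≠ ⊤, D.weight e := by
  symm
  let mk : D.E → D.QuotEdge := Quot.mk _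
  refine Finset.prod_bij (fun e _ => mk e) ?_ ?_ ?_ ?_
  · intro e he
    rw [Finset.mem_filter] at he ⊢
    exact ⟨Finset.mem_univ _, he.2.2⟩
  · intro e he e' he' h
    rw [Finset.mem_filter] at he he'
    have key : ∀ e e' : D.E, Relation.EqvGen (fun e e' : D.E => D.invE e = e') e e' →
        e = e' ∨ D.invE e = e' := by
      intro e e' h
      induction h with
      | rel _ _ h => exact Or.inr h
      | refl => exact Or.inl rfl
      | symm x y _ ih =>
        rcases ih with rfl | rfl
        · exact Or.inl rfl
        · exact Or.inr (hD.involution.invE_invE _)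
      | trans x y z _ _ ih ih' =>
        rcases ih with rfl | rfl
        · exact ih'
        · rcases ih' with rfl | rfl
          · exact Or.inr rfl
          · exact Or.inl (hD.involution.invE_invE _).symm
    rcases key e e' (Quot.eqvGen_exact h) with h | h
    · exact h
    · refine absurd ?_ ((hR e).1 he.2.1)
      change D.invE e ∈ R
      rw [h]
      exact he'.2.1
  · intro q hq
    rw [Finset.mem_filter] at hq
    induction q using Quot.ind with
    | _ e =>
      have hl : D.length e ≠ ⊤ := hq.2
      by_cases he : e ∈ R
      · exact ⟨e, by simp [he, hl], rfl⟩
      · refine ⟨D.invE e, ?_, ?_⟩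
        · rw [Finset.mem_filter, hD.involution.length]
          exact ⟨Finset.mem_univ _, hR.inv_mem he, hl⟩
        · exact (Quot.sound (r := fun e e' : D.E => D.invE e = e') (a := e) rfl).symm
  · intro e he
    rfl

end IsTwistedTropicalCover

end CoverData

end

section

/-! ### The edges of the cover of a factorisation -/

open PermTuple

namespace IsTwistedFactorisation

variable {n b g : ℕ} {μ ν : n.Partition} {t : PermTuple n b}

theorem mem_orbit_nodeGroup_of_sameCycle {l m : ℕ} (hσ : t.perm m ∈ t.nodeGroup l) {x y : Pts n}
    (h : (t.perm m).SameCycle x y) : y ∈ MulAction.orbit (t.nodeGroup l) x := by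
  obtain ⟨k, rfl⟩ := h
  exact ⟨⟨_, zpow_mem hσ k⟩, rfl⟩

/-- A cycle that is not touched remains a cycle. -/
theorem sameCycle_iff_of_forall_fixed {σ σ' η η' : Equiv.Perm (Pts n)} (h : σ' = η * σ * η')
    {x : Pts n} (hx : ∀ z, σ.SameCycle x z → η z = z ∧ η' z = z) (y : Pts n) :
    σ'.SameCycle x y ↔ σ.SameCycle x y := by
  have key : ∀ z, σ.SameCycle x z → σ' z = σ z := by
    intro z hz
    rw [h, Equiv.Perm.mul_apply, Equiv.Perm.mul_apply, (hx z hz).2, (hx _ (by simpa using hz)).1]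
  constructor
  · intro hy
    refine hy.mem_of_mapsTo (s := {z | σ.SameCycle x z}) (fun z hz => ?_)
      (Equiv.Perm.SameCycle.refl _ _)
    rw [Set.mem_ofPred_eq, key z hz]
    simpa using hz
  · intro hy
    refine (hy.mem_of_mapsTo (s := {z | σ.SameCycle x z ∧ σ'.SameCycle x z}) (fun z hz => ?_)
      ⟨Equiv.Perm.SameCycle.refl _ _, Equiv.Perm.SameCycle.refl _ _⟩).2
    refine ⟨by simpa using hz.1, ?_⟩
    rw [← key z hz.1]
    simpa using hz.2

theorem not_touched_iff {l : ℕ} {σ : Equiv.Perm (Pts n)} {x : Pts n} :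
    ¬ t.Touched l {y | σ.SameCycle x y} ↔ ∀ z, σ.SameCycle x z →
      t.etaAt l z = z ∧ (tau n * t.etaAt l * tau n) z = z := by
  unfold Touched
  push Not
  rfl

variable (h : IsTwistedFactorisation g μ ν t)
include h

omit h in
theorem sameCycle_succ_iff {m : ℕ} {x : Pts n}
    (hx : ¬ t.Touched (m + 1) {y | (t.perm m).SameCycle x y}) (y : Pts n) :
    (t.perm (m + 1)).SameCycle x y ↔ (t.perm m).SameCycle x y :=
  sameCycle_iff_of_forall_fixed (rfl) (not_touched_iff.1 hx) y

theorem sameCycle_iff_succ {m : ℕ} {x : Pts n}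
    (hx : ¬ t.Touched (m + 1) {y | (t.perm (m + 1)).SameCycle x y}) (y : Pts n) :
    (t.perm m).SameCycle x y ↔ (t.perm (m + 1)).SameCycle x y := by
  refine sameCycle_iff_of_forall_fixed (η := t.etaAt (m + 1))
    (η' := tau n * t.etaAt (m + 1) * tau n) ?_ (not_touched_iff.1 hx) y
  have h1 : ∀ z, t.etaAt (m + 1) * (t.etaAt (m + 1) * z) = z := fun z => by
    rw [← mul_assoc, h.etaAt_mul_self, one_mul]
  have h2 : ∀ z, tau n * (tau n * z) = z := fun z => by rw [← mul_assoc, tau_mul_tau, one_mul]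
  rw [perm]
  simp only [mul_assoc, h1, h2, tau_mul_tau, mul_one]

/-- If the cycle of `x` on one side is not touched, it is also the cycle of `x` on the other side.
So it makes no difference from which side a node is viewed. -/
theorem touched_succ_iff {m : ℕ} {x : Pts n} :
    t.Touched (m + 1) {y | (t.perm (m + 1)).SameCycle x y} ↔
      t.Touched (m + 1) {y | (t.perm m).SameCycle x y} := by
  constructor
  · intro hx
    by_contra hx'
    refine hx' ?_
    simpa only [sameCycle_succ_iff hx'] using hx
  · intro hx
    by_contra hx'
    refine hx' ?_
    simpa only [h.sameCycle_iff_succ hx'] using hx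

/-- The strand of `x` is followed to the left until its cycle is touched or `-∞` is reached. -/
theorem exists_left (m : ℕ) (x : Pts n) : ∃ k ≤ m,
    (k = 0 ∨ t.Touched k {y | (t.perm m).SameCycle x y}) ∧
    (∀ j, k < j → j ≤ m → ¬ t.Touched j {y | (t.perm m).SameCycle x y}) ∧
    ∀ j, k ≤ j → j ≤ m → {y | (t.perm m).SameCycle x y} = {y | (t.perm j).SameCycle x y} := by
  induction m with
  | zero =>
    refine ⟨0, le_rfl, Or.inl rfl, fun j _ _ => by omega, fun j _ _ => ?_⟩
    obtain rfl : j = 0 := by omega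
    rfl
  | succ m ih =>
    by_cases hT : t.Touched (m + 1) {y | (t.perm (m + 1)).SameCycle x y}
    · refine ⟨m + 1, le_rfl, Or.inr hT, fun j _ _ => by omega, fun j _ _ => ?_⟩
      obtain rfl : j = m + 1 := by omega
      rfl
    · have hc : {y | (t.perm (m + 1)).SameCycle x y} = {y | (t.perm m).SameCycle x y} :=
        Set.ext fun y => (h.sameCycle_iff_succ hT y).symm
      obtain ⟨k, hk, h1, h2, h3⟩ := ih
      refine ⟨k, by omega, by rwa [hc], fun j hj hj' => ?_, fun j hj hj' => ?_⟩
      · rcases hj'.eq_or_lt with rfl | hj'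
        · exact hT
        · rw [hc]
          exact h2 j hj (by omega)
      · rcases hj'.eq_or_lt with rfl | hj'
        · rfl
        · rw [hc]
          exact h3 j hj (by omega)

omit h in
theorem exists_right (d : ℕ) : ∀ m, m + d = b → ∀ x : Pts n, ∃ l, m < l ∧ l ≤ b + 1 ∧
    (l = b + 1 ∨ t.Touched l {y | (t.perm m).SameCycle x y}) ∧
    (∀ j, m < j → j < l → ¬ t.Touched j {y | (t.perm m).SameCycle x y}) ∧
    ∀ j, m ≤ j → j < l → {y | (t.perm m).SameCycle x y} = {y | (t.perm j).SameCycle x y} := by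
  induction d with
  | zero =>
    intro m hm x
    refine ⟨m + 1, by omega, by omega, Or.inl (by omega), fun j _ _ => by omega, fun j _ _ => ?_⟩
    obtain rfl : j = m := by omega
    rfl
  | succ d ih =>
    intro m hm x
    by_cases hT : t.Touched (m + 1) {y | (t.perm m).SameCycle x y}
    · refine ⟨m + 1, by omega, by omega, Or.inr hT, fun j _ _ => by omega, fun j _ _ => ?_⟩
      obtain rfl : j = m := by omega
      rfl
    · have hc : {y | (t.perm m).SameCycle x y} = {y | (t.perm (m + 1)).SameCycle x y} :=
        Set.ext fun y => (sameCycle_succ_iff hT y).symm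
      obtain ⟨l, hl, hl', h1, h2, h3⟩ := ih (m + 1) (by omega) x
      refine ⟨l, by omega, hl', by rwa [hc], fun j hj hj' => ?_, fun j hj hj' => ?_⟩
      · rcases (Nat.succ_le_of_lt hj).eq_or_lt with rfl | hj
        · exact hT
        · rw [hc]
          exact h2 j hj (by omega)
      · rcases hj.eq_or_lt with rfl | hj
        · rfl
        · rw [hc]
          exact h3 j hj (by omega)

variable (p : Fin b → ℝ)

/-- Every point lies on an edge over every interval. -/
theorem exists_edgeAt (m : ℕ) (hm : m ≤ b) (x : Pts n) : ∃ e : (h.toCover p).E,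
    (e.1.1 : ℕ) ≤ m ∧ m < e.1.2.1 ∧ e.1.2.2 = {y | (t.perm m).SameCycle x y} := by
  obtain ⟨k, hk, h1, h2, h3⟩ := h.exists_left m x
  obtain ⟨l, hl, hl', h1', h2', h3'⟩ := exists_right (t := t) (b - m) m (by omega) x
  refine ⟨⟨(⟨k, by omega⟩, ⟨l, by omega⟩, {y | (t.perm m).SameCycle x y}), ?_⟩, hk, hl, rfl⟩
  refine ⟨show k < l by omega, fun j hj hj' => ?_, h1, h1', fun j hj hj' => ?_⟩
  · change k ≤ j at hj
    change j < l at hj'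
    rcases le_total j m with hjm | hjm
    · exact ⟨x, h3 j hj hjm⟩
    · exact ⟨x, h3' j hjm hj'⟩
  · change k < j at hj
    change j < l at hj'
    rcases le_or_gt j m with hjm | hjm
    · exact h2 j hj hjm
    · exact h2' j hjm hj'

theorem cycle_eq {e : (h.toCover p).E} {m : ℕ} (h1 : (e.1.1 : ℕ) ≤ m) (h2 : m < e.1.2.1)
    {x : Pts n} (hx : x ∈ e.1.2.2) : e.1.2.2 = {y | (t.perm m).SameCycle x y} := by
  obtain ⟨z, hz⟩ := e.2.2.1 m h1 h2
  rw [hz] at hx ⊢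
  ext y
  exact ⟨fun h => hx.symm.trans h, fun h => hx.trans h⟩

/-- The point determines the cycle. If the left ends differed, the later one would be a node that
touches this cycle in the interior of the other edge; the right ends are treated in the same way. -/
theorem edge_unique {e e' : (h.toCover p).E} {m : ℕ} (h1 : (e.1.1 : ℕ) ≤ m) (h2 : m < e.1.2.1)
    (h1' : (e'.1.1 : ℕ) ≤ m) (h2' : m < e'.1.2.1) {x : Pts n} (hx : x ∈ e.1.2.2)
    (hx' : x ∈ e'.1.2.2) : e = e' := by
  have hc : e.1.2.2 = e'.1.2.2 := (h.cycle_eq p h1 h2 hx).trans (h.cycle_eq p h1' h2' hx').symm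
  obtain ⟨⟨k, l, c⟩, he⟩ := e
  obtain ⟨⟨k', l', c'⟩, he'⟩ := e'
  obtain rfl : c = c' := hc
  change (k : ℕ) ≤ m at h1
  change (k' : ℕ) ≤ m at h1'
  change m < (l : ℕ) at h2
  change m < (l' : ℕ) at h2'
  obtain ⟨a1, a2, a3, a4, a5⟩ := he
  obtain ⟨b1, b2, b3, b4, b5⟩ := he'
  change (k : ℕ) = 0 ∨ t.Touched k c at a3
  change (k' : ℕ) = 0 ∨ t.Touched k' c at b3
  change (l : ℕ) = b + 1 ∨ t.Touched l c at a4
  change (l' : ℕ) = b + 1 ∨ t.Touched l' c at b4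
  change ∀ m, (k : ℕ) < m → m < (l : ℕ) → ¬ t.Touched m c at a5
  change ∀ m, (k' : ℕ) < m → m < (l' : ℕ) → ¬ t.Touched m c at b5
  have hk : k = k' := by
    apply Fin.ext
    rcases lt_trichotomy (k : ℕ) k' with hlt | heq | hlt
    · exact absurd (b3.resolve_left (by omega)) (a5 k' hlt (h1'.trans_lt h2))
    · exact heq
    · exact absurd (a3.resolve_left (by omega)) (b5 k hlt (h1.trans_lt h2'))
  have hl : l = l' := by
    apply Fin.ext
    rcases lt_trichotomy (l : ℕ) l' with hlt | heq | hlt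
    · exact absurd (a4.resolve_left (by omega)) (b5 l (h1'.trans_lt h2) hlt)
    · exact heq
    · exact absurd (b4.resolve_left (by omega)) (a5 l' (h1.trans_lt h2') hlt)
  subst hk hl
  rfl

/-- The edge over the interval after the node `m` that contains the point `x`. -/
noncomputable def edgeAt (m : ℕ) (hm : m ≤ b) (x : Pts n) : (h.toCover p).E :=
  (h.exists_edgeAt p m hm x).choose

theorem edgeAt_left_le (m : ℕ) (hm : m ≤ b) (x : Pts n) : ((h.edgeAt p m hm x).1.1 : ℕ) ≤ m :=
  (h.exists_edgeAt p m hm x).choose_spec.1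

theorem lt_edgeAt_right (m : ℕ) (hm : m ≤ b) (x : Pts n) : m < (h.edgeAt p m hm x).1.2.1 :=
  (h.exists_edgeAt p m hm x).choose_spec.2.1

theorem edgeAt_cycle (m : ℕ) (hm : m ≤ b) (x : Pts n) :
    (h.edgeAt p m hm x).1.2.2 = {y | (t.perm m).SameCycle x y} :=
  (h.exists_edgeAt p m hm x).choose_spec.2.2

theorem mem_edgeAt (m : ℕ) (hm : m ≤ b) (x : Pts n) : x ∈ (h.edgeAt p m hm x).1.2.2 := by
  rw [edgeAt_cycle]
  exact Equiv.Perm.SameCycle.refl _ _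

theorem eq_edgeAt {e : (h.toCover p).E} {m : ℕ} (h1 : (e.1.1 : ℕ) ≤ m) (h2 : m < e.1.2.1)
    (hm : m ≤ b) {x : Pts n} (hx : x ∈ e.1.2.2) : e = h.edgeAt p m hm x :=
  h.edge_unique p h1 h2 (h.edgeAt_left_le p m hm x) (h.lt_edgeAt_right p m hm x) hx
    (h.mem_edgeAt p m hm x)

theorem edge_nonempty (e : (h.toCover p).E) : e.1.2.2.Nonempty := by
  obtain ⟨z, hz⟩ := e.2.2.1 e.1.1 le_rfl e.2.1
  exact ⟨z, by rw [hz]; exact Equiv.Perm.SameCycle.refl _ _⟩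

theorem edgeAt_right_eq_iff (m : ℕ) (hm : m < b) (x : Pts n) :
    ((h.edgeAt p m hm.le x).1.2.1 : ℕ) = m + 1 ↔
      t.Touched (m + 1) {y | (t.perm m).SameCycle x y} := by
  rw [← h.edgeAt_cycle p m hm.le x]
  have h1 := (h.edgeAt p m hm.le x).2
  have h2 := h.edgeAt_left_le p m hm.le x
  have h3 := h.lt_edgeAt_right p m hm.le x
  constructor
  · intro h4
    rw [← h4]
    exact h1.2.2.2.1.resolve_left (by omega)
  · intro h4
    by_contra h5
    exact h1.2.2.2.2 (m + 1) (by omega) (by omega) h4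

theorem edgeAt_left_eq_iff (m : ℕ) (hm : m + 1 ≤ b) (x : Pts n) :
    ((h.edgeAt p (m + 1) hm x).1.1 : ℕ) = m + 1 ↔
      t.Touched (m + 1) {y | (t.perm (m + 1)).SameCycle x y} := by
  rw [← h.edgeAt_cycle p (m + 1) hm x]
  have h1 := (h.edgeAt p (m + 1) hm x).2
  have h2 := h.edgeAt_left_le p (m + 1) hm x
  have h3 := h.lt_edgeAt_right p (m + 1) hm x
  constructor
  · intro h4
    have h5 := h1.2.2.1.resolve_left (by omega)
    rwa [h4] at h5
  · intro h4
    by_contra h5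
    exact h1.2.2.2.2 (m + 1) (by omega) (by omega) h4

theorem nodeOf_left {e : (h.toCover p).E} {x : Pts n} (hx : x ∈ e.1.2.2) :
    t.nodeOf e.1.1 e.1.2.2 = MulAction.orbit (t.nodeGroup e.1.1) x := by
  rw [h.cycle_eq p le_rfl e.2.1 hx]
  exact t.nodeOf_eq_orbit (t.perm_mem_nodeGroup _)

theorem nodeOf_right {e : (h.toCover p).E} {x : Pts n} (hx : x ∈ e.1.2.2) :
    t.nodeOf e.1.2.1 e.1.2.2 = MulAction.orbit (t.nodeGroup e.1.2.1) x := by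
  have h1 := e.2.1
  obtain ⟨m, hm⟩ : ∃ m, (e.1.2.1 : ℕ) = m + 1 := ⟨e.1.2.1 - 1, by omega⟩
  rw [h.cycle_eq p (m := m) (by omega) (by omega) hx, hm]
  exact t.nodeOf_eq_orbit (t.perm_mem_nodeGroup_succ m)

omit h in
-- At the nodes `0` and `b + 1` the transposition is trivial, so the node group is cyclic and the
-- leaves are the cycles themselves.
theorem nodeOf_eq_self {l m : ℕ} (hl : t.etaAt l = 1) (hσ : t.perm l = t.perm m) {x : Pts n} :
    t.nodeOf l {y | (t.perm m).SameCycle x y} = {y | (t.perm m).SameCycle x y} := by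
  rw [t.nodeOf_eq_orbit (hσ ▸ t.perm_mem_nodeGroup l)]
  ext y
  constructor
  · rintro ⟨⟨γ, hγ⟩, rfl⟩
    have hle : t.nodeGroup l ≤ Subgroup.zpowers (t.perm m) := by
      refine (Subgroup.closure_le _).2 ?_
      rintro γ (rfl | rfl | rfl)
      · rw [hσ]
        exact Subgroup.mem_zpowers _
      · rw [hl]
        exact one_mem _
      · rw [hl, mul_one, tau_mul_tau]
        exact one_mem _
    obtain ⟨k, rfl⟩ := hle hγ
    exact ⟨k, rfl⟩
  · exact fun hy => mem_orbit_nodeGroup_of_sameCycle (hσ ▸ t.perm_mem_nodeGroup l) hy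

omit h in
theorem etaAt_last : t.etaAt (b + 1) = 1 := by
  simp [etaAt]

omit h in
theorem perm_last : t.perm (b + 1) = t.perm b := by
  rw [perm, etaAt_last]
  simp [tau_mul_tau]

/-- The orientation of the cover of a factorisation. -/
def orientation : (h.toCover p).Orientation p where
  src e := ⟨(e.1.1, t.nodeOf e.1.1 e.1.2.2), e.2.isVertex_left⟩
  tgt e := ⟨(e.1.2.1, t.nodeOf e.1.2.1 e.1.2.2), e.2.isVertex_right⟩
  node x := x.1.1
  ends e := rfl
  pos x := rfl
  node_le x := by
    have := x.1.1.2
    omega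
  lt e := e.2.1
  length e := rfl
  exists_edge x := by
    obtain ⟨⟨l, d⟩, ⟨x, hd⟩, hl⟩ := x
    change d = _ at hd
    have hlt := l.2
    rcases hl with hl | hl | hl
    · change (l : ℕ) = 0 at hl
      obtain rfl : l = 0 := Fin.ext hl
      refine ⟨h.edgeAt p 0 (Nat.zero_le _) x, Or.inl ?_⟩
      have h1 := h.edgeAt_left_le p 0 (Nat.zero_le _) x
      have h2 := h.nodeOf_left p (h.mem_edgeAt p 0 (Nat.zero_le _) x)
      have h3 : (h.edgeAt p 0 (Nat.zero_le _) x).1.1 = 0 := Fin.ext (by simpa using h1)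
      refine Subtype.ext (Prod.ext h3 (h2.trans ?_))
      rw [h3]
      exact hd.symm
    · change (l : ℕ) = b + 1 at hl
      refine ⟨h.edgeAt p b le_rfl x, Or.inr ?_⟩
      have h1 := h.lt_edgeAt_right p b le_rfl x
      have h2 := h.nodeOf_right p (h.mem_edgeAt p b le_rfl x)
      have h3 : (h.edgeAt p b le_rfl x).1.2.1 = l := Fin.ext (by omega)
      refine Subtype.ext (Prod.ext h3 (h2.trans ?_))
      rw [h3]
      exact hd.symm
    · obtain ⟨z, hz, hz'⟩ := hl
      change z ∈ d at hz
      change t.etaAt l z ≠ z ∨ (tau n * t.etaAt l * tau n) z ≠ z at hz'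
      have hl1 : (l : ℕ) ≤ b := by
        by_contra hl1
        obtain hl2 : (l : ℕ) = b + 1 := by omega
        rw [hl2, etaAt_last] at hz'
        simp [tau_mul_tau] at hz'
      obtain hl0 | ⟨m, hm⟩ : (l : ℕ) = 0 ∨ ∃ m, (l : ℕ) = m + 1 := by
        rcases Nat.eq_zero_or_pos (l : ℕ) with h0 | h0
        · exact Or.inl h0
        · exact Or.inr ⟨l - 1, by omega⟩
      · rw [hl0] at hz'
        simp [etaAt, tau_mul_tau] at hz'
      · have hm' : m + 1 ≤ b := by omega
        refine ⟨h.edgeAt p (m + 1) hm' z, Or.inl ?_⟩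
        have h1 := (h.edgeAt_left_eq_iff p m hm' z).2
          ⟨z, Equiv.Perm.SameCycle.refl _ _, by rwa [← hm]⟩
        have h2 := h.nodeOf_left p (h.mem_edgeAt p (m + 1) hm' z)
        have h3 : (h.edgeAt p (m + 1) hm' z).1.1 = l := Fin.ext (by omega)
        refine Subtype.ext (Prod.ext h3 (h2.trans ?_))
        rw [h3]
        rw [hd] at hz
        exact (MulAction.orbit_eq_iff.2 hz).trans hd.symm
  src_inj e e' h0 heq := by
    have h1 : e.1.1 = e'.1.1 := congrArg (fun x => x.1.1) heq
    have h2 : t.nodeOf e.1.1 e.1.2.2 = t.nodeOf e'.1.1 e'.1.2.2 := congrArg (fun x => x.1.2) heq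
    have h0 : (e.1.1 : ℕ) = 0 := h0
    have h0' : (e'.1.1 : ℕ) = 0 := by rw [← h1, h0]
    obtain ⟨x, hx⟩ := h.edge_nonempty p e
    obtain ⟨x', hx'⟩ := h.edge_nonempty p e'
    have l1 := e.2.1
    have l2 := e'.2.1
    have h3 := h.cycle_eq p (m := 0) h0.le (by omega) hx
    have h4 := h.cycle_eq p (m := 0) h0'.le (by omega) hx'
    have h5 : t.etaAt 0 = 1 := rfl
    rw [h3, h4, h0, h0', nodeOf_eq_self h5 rfl, nodeOf_eq_self h5 rfl, ← h3, ← h4] at h2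
    exact h.edge_unique p (m := 0) h0.le (by omega) h0'.le (by omega) hx (h2 ▸ hx)
  tgt_inj e e' h0 heq := by
    have h1 : e.1.2.1 = e'.1.2.1 := congrArg (fun x => x.1.1) heq
    have h2 : t.nodeOf e.1.2.1 e.1.2.2 = t.nodeOf e'.1.2.1 e'.1.2.2 :=
      congrArg (fun x => x.1.2) heq
    have h0 : (e.1.2.1 : ℕ) = b + 1 := h0
    have h0' : (e'.1.2.1 : ℕ) = b + 1 := by rw [← h1, h0]
    obtain ⟨x, hx⟩ := h.edge_nonempty p e
    obtain ⟨x', hx'⟩ := h.edge_nonempty p e'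
    have l1 := e.2.1
    have l2 := e'.2.1
    have h3 := h.cycle_eq p (m := b) (by omega) (by omega) hx
    have h4 := h.cycle_eq p (m := b) (by omega) (by omega) hx'
    rw [h3, h4, h0, h0', nodeOf_eq_self etaAt_last perm_last,
      nodeOf_eq_self etaAt_last perm_last, ← h3, ← h4] at h2
    exact h.edge_unique p (m := b) (by omega) (by omega) (by omega) (by omega) hx (h2 ▸ hx)

theorem nodeOf_tau (l : ℕ) (c : Set (Pts n)) : t.nodeOf l (tau n '' c) = tau n '' t.nodeOf l c := by
  have key : ∀ x y, y ∈ MulAction.orbit (t.nodeGroup l) x →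
      tau n y ∈ MulAction.orbit (t.nodeGroup l) (tau n x) := by
    rintro x _ ⟨⟨γ, hγ⟩, rfl⟩
    refine ⟨⟨_, h.tau_conj_mem_nodeGroup l hγ⟩, ?_⟩
    change (tau n * γ * tau n) (tau n x) = tau n (γ x)
    simp [tau_tau]
  ext y
  constructor
  · rintro ⟨_, ⟨x, hx, rfl⟩, hy⟩
    refine ⟨tau n y, ⟨x, hx, ?_⟩, tau_tau n y⟩
    have := key _ _ hy
    rwa [tau_tau] at this
  · rintro ⟨z, ⟨x, hx, hz⟩, rfl⟩
    exact ⟨tau n x, ⟨x, hx, rfl⟩, key _ _ hz⟩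

theorem toCover_isInvolution : (h.toCover p).IsInvolution where
  invV_invV x := Subtype.ext (Prod.ext rfl (tau_image_tau_image _))
  invE_invE e := Subtype.ext (Prod.ext rfl (Prod.ext rfl (tau_image_tau_image _)))
  ends e := by
    change s(_, _) = s(_, _)
    have h1 := h.nodeOf_tau e.1.1 e.1.2.2
    have h2 := h.nodeOf_tau e.1.2.1 e.1.2.2
    exact congrArg₂ (fun x y => s(x, y)) (Subtype.ext (Prod.ext rfl h1))
      (Subtype.ext (Prod.ext rfl h2))
  length e := by
    change _ / _ = _ / _
    congr 2
    exact Set.ncard_image_of_injective _ (tau n).injective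
  pos x := rfl
  weight e := Set.ncard_image_of_injective _ (tau n).injective

theorem edgeAt_tau (m : ℕ) (hm : m ≤ b) (x : Pts n) :
    h.edgeAt p m hm (tau n x) = (h.toCover p).invE (h.edgeAt p m hm x) := by
  have h1 : tau n x ∈ ((h.toCover p).invE (h.edgeAt p m hm x)).1.2.2 := by
    change tau n x ∈ tau n '' _
    exact ⟨x, h.mem_edgeAt p m hm x, rfl⟩
  exact (h.eq_edgeAt p (e := (h.toCover p).invE _) (h.edgeAt_left_le p m hm x)
    (h.lt_edgeAt_right p m hm x) hm h1).symm

theorem edgeAt_eq_iff (m : ℕ) (hm : m ≤ b) (x y : Pts n) :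
    h.edgeAt p m hm x = h.edgeAt p m hm y ↔ (t.perm m).SameCycle x y := by
  constructor
  · intro he
    have h1 := h.mem_edgeAt p m hm y
    rw [← he, edgeAt_cycle] at h1
    exact h1
  · intro hxy
    refine h.eq_edgeAt p (h.edgeAt_left_le p m hm x) (h.lt_edgeAt_right p m hm x) hm ?_
    rw [edgeAt_cycle]
    exact hxy

end IsTwistedFactorisation

end

section

/-! ### Isomorphisms of oriented covers -/

open PermTuple

namespace CoverData

namespace Orientation

variable {D : CoverData.{u, v}} {D' : CoverData.{u', v'}} {b : ℕ} {p : Fin b → ℝ}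
  (o : D.Orientation p) (o' : D'.Orientation p)

/-- The end vertex of a half-edge. -/
def endpoint (a : D.E × Bool) : D.V := cond a.2 (o.tgt a.1) (o.src a.1)

theorem exists_endpoint (x : D.V) : ∃ a, o.endpoint a = x := by
  obtain ⟨e, he | he⟩ := o.exists_edge x
  · exact ⟨(e, false), he⟩
  · exact ⟨(e, true), he⟩

theorem node_iso (hp : StrictMono p) (φ : D.Iso D') (x : D.V) :
    o'.node (φ.onV x) = o.node x := by
  refine nodePos_injective hp (o'.node_le _) (o.node_le _) ?_
  rw [← o'.pos, ← o.pos, φ.pos]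

theorem src_tgt_iso (hp : StrictMono p) (φ : D.Iso D') (e : D.E) :
    o'.src (φ.onE e) = φ.onV (o.src e) ∧ o'.tgt (φ.onE e) = φ.onV (o.tgt e) := by
  refine o'.ends_eq ?_ ?_
  · rw [φ.ends, o.ends, Sym2.map_mk]
  · rw [o.node_iso o' hp, o.node_iso o' hp]
    exact o.lt e

/-- Every vertex is the left or right end of an edge, and isomorphisms preserve left and right. -/
theorem iso_ext (hp : StrictMono p) {φ ψ : D.Iso D'} (h : φ.onE = ψ.onE) (o : D.Orientation p)
    (o' : D'.Orientation p) : φ = ψ := by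
  refine Iso.ext (Equiv.ext fun x => ?_) h
  obtain ⟨e, rfl | rfl⟩ := o.exists_edge x
  · rw [← (o.src_tgt_iso o' hp φ e).1, ← (o.src_tgt_iso o' hp ψ e).1, h]
  · rw [← (o.src_tgt_iso o' hp φ e).2, ← (o.src_tgt_iso o' hp ψ e).2, h]

/-- A bijection between the edges that respects the incidence relation, the weights, the positions
and the involution is induced by an isomorphism. -/
theorem exists_iso (hp : StrictMono p) (hI : D.IsInvolution) (hI' : D'.IsInvolution)
    (f : D.E ≃ D'.E) (hw : ∀ e, D'.weight (f e) = D.weight e)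
    (hf : ∀ e, D'.invE (f e) = f (D.invE e))
    (hn : ∀ a, o'.node (o'.endpoint (f a.1, a.2)) = o.node (o.endpoint a))
    (he : ∀ a a', o.endpoint a = o.endpoint a' ↔
      o'.endpoint (f a.1, a.2) = o'.endpoint (f a'.1, a'.2)) :
    ∃ φ : D.Iso D', φ.onE = f := by
  -- A vertex is mapped by means of a chosen half-edge at it; by `he` the image does not depend on
  -- the choice.
  choose s hs using o.exists_endpoint
  have key : ∀ a, o'.endpoint (f (s (o.endpoint a)).1, (s (o.endpoint a)).2) =
      o'.endpoint (f a.1, a.2) := fun a => (he _ _).1 (hs _)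
  have hbij : Function.Bijective fun x => o'.endpoint (f (s x).1, (s x).2) := by
    constructor
    · intro x y hxy
      rw [← hs x, ← hs y]
      exact (he _ _).2 hxy
    · intro y
      obtain ⟨⟨e, i⟩, rfl⟩ := o'.exists_endpoint y
      refine ⟨o.endpoint (f.symm e, i), ?_⟩
      simpa using key (f.symm e, i)
  have hinv : ∀ a, o.endpoint (D.invE a.1, a.2) = D.invV (o.endpoint a) := by
    rintro ⟨e, _ | _⟩
    · exact (o.src_tgt_invE hp hI e).1
    · exact (o.src_tgt_invE hp hI e).2
  have hinv' : ∀ a, o'.endpoint (D'.invE a.1, a.2) = D'.invV (o'.endpoint a) := by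
    rintro ⟨e, _ | _⟩
    · exact (o'.src_tgt_invE hp hI' e).1
    · exact (o'.src_tgt_invE hp hI' e).2
  refine ⟨⟨Equiv.ofBijective _ hbij, f, fun e => ?_, fun e => ?_, fun x => ?_, hw, fun x => ?_,
    hf⟩, rfl⟩
  · rw [o.ends, o'.ends, Sym2.map_mk]
    have h1 := key (e, false)
    have h2 := key (e, true)
    exact (congrArg₂ (fun x y => s(x, y)) h1 h2).symm
  · have h1 := hn (e, false)
    have h2 := hn (e, true)
    change o'.node (o'.src (f e)) = o.node (o.src e) at h1
    change o'.node (o'.tgt (f e)) = o.node (o.tgt e) at h2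
    rw [o.length, o'.length, h1, h2, hw]
  · change D'.pos (o'.endpoint (f (s x).1, (s x).2)) = _
    rw [o.pos, o'.pos, ← hs x, key, hn]
  · change D'.invV (o'.endpoint (f (s x).1, (s x).2)) =
      o'.endpoint (f (s (D.invV x)).1, (s (D.invV x)).2)
    rw [← hinv', hf]
    refine (he (D.invE (s x).1, (s x).2) _).1 ?_
    rw [hinv (s x), hs, hs]

end Orientation

/-- The inverse isomorphism. -/
def Iso.symm {D : CoverData.{u, v}} {D' : CoverData.{u', v'}} (φ : D.Iso D') : D'.Iso D where
  onV := φ.onV.symm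
  onE := φ.onE.symm
  ends e := by
    obtain ⟨e, rfl⟩ := φ.onE.surjective e
    rw [φ.ends, Sym2.map_map]
    simp
  length e := by simpa using (φ.length (φ.onE.symm e)).symm
  pos x := by simpa using (φ.pos (φ.onV.symm x)).symm
  weight e := by simpa using (φ.weight (φ.onE.symm e)).symm
  invV x := by
    rw [Equiv.eq_symm_apply, ← φ.invV, Equiv.apply_symm_apply]
  invE x := by
    rw [Equiv.eq_symm_apply, ← φ.invE, Equiv.apply_symm_apply]

/-- The composition of isomorphisms. -/
def Iso.trans {D : CoverData.{u, v}} {D' : CoverData.{u', v'}} {D'' : CoverData} (φ : D.Iso D')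
    (ψ : D'.Iso D'') : D.Iso D'' where
  onV := φ.onV.trans ψ.onV
  onE := φ.onE.trans ψ.onE
  ends e := by simp [ψ.ends, φ.ends, Sym2.map_map]
  length e := by simp [ψ.length, φ.length]
  pos x := by simp [ψ.pos, φ.pos]
  weight e := by simp [ψ.weight, φ.weight]
  invV x := by simp [ψ.invV, φ.invV]
  invE x := by simp [ψ.invE, φ.invE]

/-- An isomorphism of covers identifies the isomorphisms to `D'` with the automorphisms. -/
def Iso.equivAut {D : CoverData.{u, v}} {D' : CoverData.{u', v'}} (φ : D.Iso D') :
    D.Iso D' ≃ D'.Aut where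
  toFun ψ := φ.symm.trans ψ
  invFun ψ := φ.trans ψ
  left_inv ψ := by
    ext <;> simp [Iso.trans, Iso.symm]
  right_inv ψ := by
    ext <;> simp [Iso.trans, Iso.symm]

instance {D : CoverData.{u, v}} {D' : CoverData.{u', v'}} : Finite (D.Iso D') :=
  Finite.of_injective (fun φ => (φ.onV, φ.onE)) fun _ _ h =>
    Iso.ext (congrArg Prod.fst h) (congrArg Prod.snd h)

instance {D : CoverData.{u, v}} : Nonempty D.Aut :=
  ⟨⟨Equiv.refl _, Equiv.refl _, by simp, by simp, by simp, by simp, by simp, by simp⟩⟩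

end CoverData

end

section

/-! ### From the factorisations to the labelled factorisations -/

open PermTuple CoverData

namespace PermTuple

variable {n b : ℕ} {t : PermTuple n b}

theorem etaAt_succ (i : Fin b) : t.etaAt (i + 1) = t.η i := by
  simp [etaAt]

theorem perm_succ (i : Fin b) :
    t.perm (i + 1) = t.η i * t.perm i * (tau n * t.η i * tau n) := by
  rw [perm, etaAt_succ]

end PermTuple

namespace CoverData

variable {D : CoverData.{u, v}} {n b g : ℕ} {μ ν : n.Partition} {p : Fin b → ℝ}
  {t : PermTuple n b}

namespace IsTwistedTropicalCover

variable (hD : D.IsTwistedTropicalCover g μ ν p) (hn : 0 < n) (o : D.Orientation p)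
  (h : IsTwistedFactorisation g μ ν t) (φ : (h.toCover p).Iso D)

include hD in
theorem node_src_iso (e : (h.toCover p).E) : o.node (o.src (φ.onE e)) = e.1.1 := by
  rw [((h.orientation p).src_tgt_iso o hD.branch_strictMono φ e).1,
    (h.orientation p).node_iso o hD.branch_strictMono]
  rfl

include hD in
theorem node_tgt_iso (e : (h.toCover p).E) : o.node (o.tgt (φ.onE e)) = e.1.2.1 := by
  rw [((h.orientation p).src_tgt_iso o hD.branch_strictMono φ e).2,
    (h.orientation p).node_iso o hD.branch_strictMono]
  rfl

/-- The labelling of the points by the edges of `D` over the interval after the node `m`. -/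
noncomputable def labelAt (h : IsTwistedFactorisation g μ ν t) (φ : (h.toCover p).Iso D) (m : ℕ) (hm : m ≤ b)
    (x : Pts n) : D.E := φ.onE (h.edgeAt p m hm x)

/-- Over a fixed interval the edges of the cover are the cycles, and an isomorphism preserves
weights, end nodes and involutions. -/
theorem isLabelled_labelAt (m : ℕ) (hm : m ≤ b) : (hD.twistData hn).IsLabelled (o.level m)
    (t.perm m, labelAt h φ m hm) where
  conj := h.tau_perm_tau m
  sameCycle x y := φ.onE.apply_eq_iff_eq.trans (h.edgeAt_eq_iff p m hm x y)
  tau x := by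
    change φ.onE (h.edgeAt p m hm (tau n x)) = D.invE (φ.onE _)
    rw [h.edgeAt_tau, φ.invE]
  mem x := by
    change o.node (o.src (φ.onE _)) ≤ m ∧ m < o.node (o.tgt (φ.onE _))
    rw [hD.node_src_iso o, hD.node_tgt_iso o]
    exact ⟨h.edgeAt_left_le p m hm x, h.lt_edgeAt_right p m hm x⟩
  ncard e he := by
    obtain ⟨e, rfl⟩ := φ.onE.surjective e
    change o.node (o.src (φ.onE _)) ≤ m ∧ m < o.node (o.tgt (φ.onE _)) at he
    rw [hD.node_src_iso o, hD.node_tgt_iso o] at he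
    change {x | φ.onE _ = φ.onE e}.ncard = D.weight (φ.onE e)
    rw [φ.weight]
    change _ = e.1.2.2.ncard
    congr 1
    ext x
    change φ.onE _ = φ.onE e ↔ _
    rw [φ.onE.apply_eq_iff_eq]
    constructor
    · rintro rfl
      exact h.mem_edgeAt p m hm x
    · intro hx
      exact (h.eq_edgeAt p he.1 he.2 hm hx).symm

/-- An edge ends or starts at the node exactly when its cycle is touched there, and its vertex is
the orbit of any of its points. An isomorphism turns these facts about the cover of `t` into the
required incidences in `D`. -/
theorem isTransition_labelAt (i : Fin b) : (hD.twistData hn).IsTransition (o.nodeData i)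
    (t.perm i, labelAt h φ i i.2.le) (t.η i) (t.perm (i + 1), labelAt h φ (i + 1) i.2) := by
  have hL := hD.isLabelled_labelAt hn o h φ i i.2.le
  have hR := hD.isLabelled_labelAt hn o h φ (i + 1) i.2
  have hIn : ∀ x, labelAt h φ i i.2.le x ∈ (o.nodeData i).In ↔
      ((h.edgeAt p i i.2.le x).1.2.1 : ℕ) = i + 1 := fun x => by
    rw [← hD.node_tgt_iso o h φ]
    rfl
  have hOut : ∀ x, labelAt h φ (i + 1) i.2 x ∈ (o.nodeData i).Out ↔
      ((h.edgeAt p (i + 1) i.2 x).1.1 : ℕ) = i + 1 := fun x => by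
    rw [← hD.node_src_iso o h φ]
    rfl
  have hInOut : ∀ x, labelAt h φ i i.2.le x ∈ (o.nodeData i).In ↔
      labelAt h φ (i + 1) i.2 x ∈ (o.nodeData i).Out := fun x => by
    rw [hIn, hOut, h.edgeAt_right_eq_iff p i i.2, h.edgeAt_left_eq_iff p i i.2,
      h.touched_succ_iff]
  have htgt : ∀ x, labelAt h φ i i.2.le x ∈ (o.nodeData i).In →
      ((h.orientation p).tgt (h.edgeAt p i i.2.le x)).1.1.1 = i + 1 ∧
      ((h.orientation p).tgt (h.edgeAt p i i.2.le x)).1.2 =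
        MulAction.orbit (t.nodeGroup (i + 1)) x := fun x hx => by
    have h1 := (hIn x).1 hx
    exact ⟨h1, (h.nodeOf_right p (h.mem_edgeAt p i i.2.le x)).trans
      (congrArg (fun l => MulAction.orbit (t.nodeGroup l) x) h1)⟩
  have hsrc : ∀ x, labelAt h φ (i + 1) i.2 x ∈ (o.nodeData i).Out →
      ((h.orientation p).src (h.edgeAt p (i + 1) i.2 x)).1.1.1 = i + 1 ∧
      ((h.orientation p).src (h.edgeAt p (i + 1) i.2 x)).1.2 =
        MulAction.orbit (t.nodeGroup (i + 1)) x := fun x hx => by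
    have h1 := (hOut x).1 hx
    exact ⟨h1, (h.nodeOf_left p (h.mem_edgeAt p (i + 1) i.2 x)).trans
      (congrArg (fun l => MulAction.orbit (t.nodeGroup l) x) h1)⟩
  have htgt' : ∀ x, (o.nodeData i).tgt (labelAt h φ i i.2.le x) =
      φ.onV ((h.orientation p).tgt (h.edgeAt p i i.2.le x)) := fun x =>
    ((h.orientation p).src_tgt_iso o hD.branch_strictMono φ _).2
  have hsrc' : ∀ x, (o.nodeData i).src (labelAt h φ (i + 1) i.2 x) =
      φ.onV ((h.orientation p).src (h.edgeAt p (i + 1) i.2 x)) := fun x =>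
    ((h.orientation p).src_tgt_iso o hD.branch_strictMono φ _).1
  have hst : ∀ x, labelAt h φ i i.2.le x ∈ (o.nodeData i).In →
      (o.nodeData i).src (labelAt h φ (i + 1) i.2 x) =
        (o.nodeData i).tgt (labelAt h φ i i.2.le x) := fun x hx => by
    rw [htgt', hsrc', φ.onV.apply_eq_iff_eq]
    have h1 := htgt x hx
    have h2 := hsrc x ((hInOut x).1 hx)
    exact Subtype.ext (Prod.ext (Fin.ext (h2.1.trans h1.1.symm)) (h2.2.trans h1.2.symm))
  refine ⟨hL, hR, t.perm_succ i, ?_, fun x => ?_, fun x => ?_, fun x hx => ?_, fun x hx => ?_,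
    fun x hx => ⟨(hInOut x).1 hx, hst x hx⟩, fun x hx => ⟨(hInOut x).2 hx, (hst x ((hInOut x).2 hx)).symm⟩,
    fun x y hx hy => ?_⟩
  · obtain ⟨x, y, hxy, he⟩ := h.isSwap i
    refine ⟨x, y, hxy, fun hτ => h.ne_conj i ?_, fun z => ?_, ?_, ?_⟩
    · rw [he]
      refine Eq.trans ?_ ((hD.twistData hn).tau_mul_swap_mul_tau x y).symm
      rw [show (hD.twistData hn).τ x = y from hτ, Equiv.swap_comm]
      rw [← hτ]
      exact congrArg _ ((hD.twistData hn).tau_tau x).symm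
    · rw [he, Equiv.swap_apply_ne_self_iff]
      simp [hxy]
    · rw [he, Equiv.swap_apply_left]
    · rw [he, Equiv.swap_apply_right]
  · rw [hIn, h.edgeAt_right_eq_iff p i i.2]
    unfold Touched
    rw [etaAt_succ]
    refine exists_congr fun y => and_congr ?_ Iff.rfl
    rw [hL.sameCycle y x]
    exact Equiv.Perm.sameCycle_comm
  · rw [hOut, h.edgeAt_left_eq_iff p i i.2]
    unfold Touched
    rw [etaAt_succ]
    refine exists_congr fun y => and_congr ?_ Iff.rfl
    rw [hR.sameCycle y x]
    exact Equiv.Perm.sameCycle_comm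
  · rw [hIn] at hx
    have h1 := h.edgeAt_left_le p i i.2.le x
    have h2 := h.lt_edgeAt_right p i i.2.le x
    exact congrArg φ.onE (h.eq_edgeAt p (by omega) (by omega) i.2 (h.mem_edgeAt p i i.2.le x)).symm
  · rw [hOut] at hx
    have h1 := h.edgeAt_left_le p (i + 1) i.2 x
    have h2 := h.lt_edgeAt_right p (i + 1) i.2 x
    exact congrArg φ.onE (h.eq_edgeAt p (by omega) (by omega) i.2.le
      (h.mem_edgeAt p (i + 1) i.2 x))
  · have h1 := htgt x hx
    have h2 := htgt y hy
    have hG : (hD.twistData hn).localGroup (t.perm (i + 1)) (t.η i) = t.nodeGroup (i + 1) := by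
      unfold TwistData.localGroup nodeGroup
      rw [etaAt_succ]
      rfl
    change _ ↔ y ∈ MulAction.orbit ((hD.twistData hn).localGroup (t.perm (i + 1)) (t.η i)) x
    rw [hG, htgt', htgt', φ.onV.apply_eq_iff_eq, ← MulAction.orbit_eq_iff, ← h1.2, ← h2.2]
    constructor
    · intro h3
      rw [h3]
    · intro h3
      exact Subtype.ext (Prod.ext (Fin.ext (h1.1.trans h2.1.symm)) h3.symm)

/-- The labelled factorisation given by a factorisation and an isomorphism of its cover to `D`. -/
noncomputable def pathOf (h : IsTwistedFactorisation g μ ν t) (φ : (h.toCover p).Iso D) :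
    (Fin (b + 1) → Equiv.Perm (Pts n) × (Pts n → D.E)) × (Fin b → Equiv.Perm (Pts n)) :=
  (fun i => (t.perm i, labelAt h φ i (Nat.lt_succ_iff.1 i.2)), t.η)

theorem isPath_pathOf : hD.IsPath hn o (pathOf h φ) :=
  ⟨hD.isLabelled_labelAt hn o h φ 0 (Nat.zero_le _), fun i => hD.isTransition_labelAt hn o h φ i⟩

end IsTwistedTropicalCover

end CoverData

end

section

/-! ### The cycle type of a labelled permutation -/

namespace TwistData.IsLabelled

open Equiv Equiv.Perm

variable {α E : Type*} [Fintype α] [DecidableEq α] {T : TwistData α E} {A : Set E}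
  {s : Perm α × (α → E)} (hs : T.IsLabelled A s)
include hs

theorem support_cycleOf_eq (x : α) (hx : s.1 x ≠ x) :
    ((s.1.cycleOf x).support : Set α) = {y | s.2 y = s.2 x} := by
  ext y
  rw [Finset.mem_coe, mem_support_cycleOf_iff' hx, Set.mem_ofPred_eq, hs.sameCycle]
  exact sameCycle_comm

omit [Fintype α] [DecidableEq α] in
theorem fibre_eq_singleton_iff (x : α) : {y | s.2 y = s.2 x} = {x} ↔ s.1 x = x := by
  constructor
  · intro h
    have h1 : s.1 x ∈ {y | s.2 y = s.2 x} := hs.apply x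
    rwa [h] at h1
  · intro h
    refine Set.eq_singleton_iff_unique_mem.2 ⟨rfl, fun y hy => ?_⟩
    exact (((hs.sameCycle _ _).1 hy).symm.eq_of_left h).symm

omit [Fintype α] [DecidableEq α] in
theorem w_eq_one_iff (x : α) : T.w (s.2 x) = 1 ↔ s.1 x = x := by
  rw [← hs.ncard _ (hs.mem x), ← hs.fibre_eq_singleton_iff, Set.ncard_eq_one]
  constructor
  · rintro ⟨a, ha⟩
    have h1 : x ∈ {y | s.2 y = s.2 x} := rfl
    rw [ha] at h1 ⊢
    rw [h1]
  · exact fun h => ⟨x, h⟩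

/-- Labels of weight different from `1` correspond to the nontrivial cycles, which `cycleType`
records. Labels of weight `1` correspond to the fixed points, which the partition adds as parts
equal to `1`. -/
theorem partition_parts [Fintype E] [DecidablePred (· ∈ A)] :
    s.1.partition.parts = (Finset.univ.filter (· ∈ A)).val.map T.w := by
  classical
  have hex : ∀ e : A, ∃ x, s.2 x = e := fun e => hs.exists_eq e.2
  choose r hr using hex
  have hfix : ∀ e : A, T.w e = 1 ↔ s.1 (r e) = r e := fun e => by
    rw [← hs.w_eq_one_iff, hr]
  have h1 : s.1.cycleType =
      ((Finset.univ.filter fun e : A => T.w e ≠ 1).val.map fun e : A => T.w e) := by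
    have hc : s.1.cycleFactorsFinset =
        (Finset.univ.filter fun e : A => T.w e ≠ 1).image fun e => s.1.cycleOf (r e) := by
      ext c
      rw [Finset.mem_image]
      constructor
      · intro hc
        obtain ⟨x, hx, hx'⟩ := (mem_cycleFactorsFinset_iff.1 hc).1
        have hcx : c = s.1.cycleOf x :=
          (cycle_is_cycleOf (mem_support.2 hx) hc)
        refine ⟨⟨s.2 x, hs.mem x⟩, ?_, ?_⟩
        · rw [Finset.mem_filter_univ]
          change T.w (s.2 x) ≠ 1
          rw [Ne, hs.w_eq_one_iff]
          intro h
          rw [hcx, cycleOf_apply_self] at hx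
          exact hx h
        · rw [hcx]
          exact SameCycle.cycleOf_eq ((hs.sameCycle _ _).1 (hr ⟨s.2 x, hs.mem x⟩))
      · rintro ⟨e, he, rfl⟩
        rw [Finset.mem_filter_univ, Ne, hfix] at he
        exact cycleOf_mem_cycleFactorsFinset_iff.2 (mem_support.2 he)
    have hsupp : ∀ e : A, T.w e ≠ 1 → (s.1.cycleOf (r e)).support.card = T.w e := by
      intro e he
      rw [Ne, hfix] at he
      rw [← Set.ncard_coe_finset, hs.support_cycleOf_eq _ he, hr, hs.ncard _ e.2]
    rw [cycleType_def, hc, Finset.image_val_of_injOn, Multiset.map_map]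
    · refine Multiset.map_congr rfl fun e he => hsupp e ?_
      exact (Finset.mem_filter.1 he).2
    · intro e he e' he' hee
      rw [Finset.mem_coe, Finset.mem_filter_univ, Ne, hfix] at he he'
      have h2 := congrArg (fun c => (c.support : Set α)) hee
      simp only [hs.support_cycleOf_eq _ he, hs.support_cycleOf_eq _ he'] at h2
      have h3 : r e ∈ {y | s.2 y = s.2 (r e)} := rfl
      rw [h2, Set.mem_ofPred_eq, hr, hr] at h3
      exact Subtype.ext h3
  have h2 : Multiset.replicate (Fintype.card α - s.1.support.card) 1 =
      ((Finset.univ.filter fun e : A => ¬ T.w e ≠ 1).val.map fun e : A => T.w e) := by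
    symm
    rw [Multiset.eq_replicate]
    constructor
    · rw [Multiset.card_map, Finset.card_val, ← Finset.card_compl]
      refine Finset.card_bij (fun e _ => r e) ?_ ?_ ?_
      · intro e he
        rw [Finset.mem_filter_univ, not_not, hfix] at he
        simpa using he
      · intro e _ e' _ hee
        exact Subtype.ext ((hr e).symm.trans ((congrArg s.2 hee).trans (hr e')))
      · intro x hx
        have hx' : s.1 x = x := by simpa using hx
        refine ⟨⟨s.2 x, hs.mem x⟩, ?_, ?_⟩
        · rw [Finset.mem_filter_univ, not_not]
          exact (hs.w_eq_one_iff x).2 hx'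
        · exact (((hs.sameCycle _ _).1 (hr ⟨s.2 x, hs.mem x⟩)).symm.eq_of_left hx').symm
    · intro k hk
      obtain ⟨e, he, rfl⟩ := Multiset.mem_map.1 hk
      exact not_not.1 ((Finset.mem_filter.1 he).2)
  rw [parts_partition, h1, h2, ← Multiset.map_add]
  have h3 : (Finset.univ.filter fun e : A => T.w e ≠ 1).val +
      (Finset.univ.filter fun e : A => ¬ T.w e ≠ 1).val = (Finset.univ : Finset A).val :=
    Multiset.filter_add_not _ _
  have h4 : (Finset.univ.filter (· ∈ A)).val = (Finset.univ : Finset A).val.map (↑) := by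
    have : Finset.univ.filter (· ∈ A) = (Finset.univ : Finset A).map (.subtype _) := by
      ext e
      simp
    rw [this, Finset.map_val]
    rfl
  rw [h3, h4, Multiset.map_map]
  rfl

/-- A self-symmetric cycle would contain `τ x` together with `x`, and its label would be fixed by
`ι`. So the labelling alone excludes self-symmetric cycles of `σ₁`. -/
theorem not_tau_conj_cycle_eq_inv {c : Perm α} (hc : c ∈ s.1.cycleFactorsFinset) :
    T.τ * c * T.τ ≠ c⁻¹ := by
  intro h
  obtain ⟨x, hx, -⟩ := (mem_cycleFactorsFinset_iff.1 hc).1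
  have hcx : c = s.1.cycleOf x := cycle_is_cycleOf (mem_support.2 hx) hc
  have h1 : c⁻¹ (T.τ x) ≠ T.τ x := by
    rw [← h]
    simpa [T.tau_tau] using hx
  have h2 : T.τ x ∈ c.support := by
    rw [← support_inv]
    exact mem_support.2 h1
  rw [hcx] at h2
  have h3 : s.1.SameCycle x (T.τ x) := (mem_support_cycleOf_iff.1 h2).1
  rw [← hs.sameCycle, hs.tau] at h3
  exact T.inv_ne _ h3.symm

end TwistData.IsLabelled

end

section

/-! ### From the labelled factorisations to the factorisations -/

open PermTuple CoverData

namespace CoverData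

namespace IsTwistedTropicalCover

variable {D : CoverData.{u, v}} {n b g : ℕ} {μ ν : n.Partition} {p : Fin b → ℝ}

/-- The factorisation underlying a labelled factorisation. -/
def tupleOf (q : (Fin (b + 1) → Equiv.Perm (Pts n) × (Pts n → D.E)) ×
    (Fin b → Equiv.Perm (Pts n))) : PermTuple n b :=
  ⟨(q.1 0).1, q.2, (q.1 (Fin.last b)).1⟩

/-- The labelled permutation over the interval after the node `m`. -/
def stateAt (q : (Fin (b + 1) → Equiv.Perm (Pts n) × (Pts n → D.E)) ×
    (Fin b → Equiv.Perm (Pts n))) (m : ℕ) (hm : m ≤ b) : Equiv.Perm (Pts n) × (Pts n → D.E) :=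
  q.1 ⟨m, Nat.lt_succ_of_le hm⟩

variable {hD : D.IsTwistedTropicalCover g μ ν p} {hn : 0 < n} {o : D.Orientation p}
  {q : (Fin (b + 1) → Equiv.Perm (Pts n) × (Pts n → D.E)) × (Fin b → Equiv.Perm (Pts n))}

namespace IsPath

variable (hq : hD.IsPath hn o q)
include hq

theorem isTransition (m : ℕ) (hm : m < b) : (hD.twistData hn).IsTransition (o.nodeData m)
    (stateAt q m hm.le) (q.2 ⟨m, hm⟩) (stateAt q (m + 1) hm) :=
  hq.2 ⟨m, hm⟩

theorem isLabelled (m : ℕ) (hm : m ≤ b) :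
    (hD.twistData hn).IsLabelled (o.level m) (stateAt q m hm) := by
  cases m with
  | zero => exact hq.1
  | succ m => exact (hq.isTransition m hm).right

theorem perm_eq (m : ℕ) (hm : m ≤ b) : (tupleOf q).perm m = (stateAt q m hm).1 := by
  induction m with
  | zero => rfl
  | succ m ih =>
    rw [(hq.isTransition m hm).eq_mul, ← ih (by omega)]
    exact (tupleOf q).perm_succ ⟨m, hm⟩

theorem localGroup_eq (m : ℕ) (hm : m < b) :
    (hD.twistData hn).localGroup (stateAt q (m + 1) hm).1 (q.2 ⟨m, hm⟩) =
      (tupleOf q).nodeGroup (m + 1) := by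
  unfold TwistData.localGroup nodeGroup
  rw [← hq.perm_eq, show (tupleOf q).etaAt (m + 1) = q.2 ⟨m, hm⟩ from
    (tupleOf q).etaAt_succ ⟨m, hm⟩]
  rfl

/-- The label of a point does not change along an edge. -/
theorem label_eq_label {m m' : ℕ} (hm : m ≤ b) (hm' : m' ≤ b) {x : Pts n}
    (h : (stateAt q m hm).2 x ∈ o.level m') : (stateAt q m' hm').2 x = (stateAt q m hm).2 x := by
  -- Moving to the right, the label can change only at the node where its edge ends; moving to the
  -- left, only where it starts.
  have hup : ∀ d m (hm : m ≤ b) (hm' : m + d ≤ b), (stateAt q m hm).2 x ∈ o.level (m + d) →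
      (stateAt q (m + d) hm').2 x = (stateAt q m hm).2 x := by
    intro d
    induction d with
    | zero => exact fun _ _ _ _ => rfl
    | succ d ih =>
      intro m hm hm' h
      have h1 := (hq.isLabelled m hm).mem x
      have h2 := ih m hm (by omega) ⟨by have := h1.1; omega, by have := h.2; omega⟩
      have h3 := (hq.isTransition (m + d) hm').eq_of_notMem_In x (fun h4 => by
        rw [h2] at h4
        have h4 : o.node (o.tgt _) = m + d + 1 := h4
        have := h.2
        omega)
      exact h3.trans h2
  have hdown : ∀ d m' (hm' : m' ≤ b) (hm : m' + d ≤ b), (stateAt q (m' + d) hm).2 x ∈ o.level m' →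
      (stateAt q m' hm').2 x = (stateAt q (m' + d) hm).2 x := by
    intro d
    induction d with
    | zero => exact fun _ _ _ _ => rfl
    | succ d ih =>
      intro m' hm' hm h
      have h1 := (hq.isLabelled (m' + (d + 1)) hm).mem x
      have h3 := (hq.isTransition (m' + d) hm).eq_of_notMem_Out x (fun h4 => by
        have h4 : o.node (o.src _) = m' + d + 1 := h4
        have := h.1
        change o.node (o.src ((stateAt q (m' + d + 1) hm).2 x)) ≤ m' at this
        omega)
      have h3' : (stateAt q (m' + d) (by omega)).2 x = (stateAt q (m' + d + 1) hm).2 x := h3.symm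
      rw [ih m' hm' (by omega) (by rw [h3']; exact h), h3']
      rfl
  rcases le_total m m' with hle | hle
  · obtain ⟨d, rfl⟩ := Nat.exists_eq_add_of_le hle
    exact hup d m hm hm' h
  · obtain ⟨d, rfl⟩ := Nat.exists_eq_add_of_le hle
    exact hdown d m' hm' hm h

theorem exists_label_eq {e : D.E} {m : ℕ} (hm : m ≤ b) (he : e ∈ o.level m) :
    ∃ x, (stateAt q m hm).2 x = e :=
  (hq.isLabelled m hm).exists_eq he

/-- Two half-edges are attached to the same vertex if and only if their points are in the same
orbit. -/
theorem endpoint_eq_iff {a a' : D.E × Bool} {l m m' : ℕ} (hm : m ≤ b) (hm' : m' ≤ b)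
    {x x' : Pts n} (ha : o.node (o.endpoint a) = l) (ha' : o.node (o.endpoint a') = l)
    (hx : (stateAt q m hm).2 x = a.1) (hx' : (stateAt q m' hm').2 x' = a'.1) :
    o.endpoint a = o.endpoint a' ↔ x' ∈ MulAction.orbit ((tupleOf q).nodeGroup l) x := by
  have hlb : l ≤ b + 1 := ha ▸ o.node_le _
  obtain rfl | hl0 := Nat.eq_zero_or_pos l
  -- Over `-∞` the orbits are the cycles of `σ₁`, and a leaf determines its edge; the node `b + 1`
  -- is treated in the same way.
  · have key : ∀ (a : D.E × Bool) (m : ℕ) (hm : m ≤ b) (x : Pts n), o.node (o.endpoint a) = 0 →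
        (stateAt q m hm).2 x = a.1 →
        a.2 = false ∧ (stateAt q 0 (Nat.zero_le _)).2 x = a.1 := by
      rintro ⟨e, _ | _⟩ m hm x h1 h2
      · refine ⟨rfl, ?_⟩
        have h3 : o.node (o.src e) = 0 := h1
        have h4 := o.lt e
        rw [← h2]
        refine hq.label_eq_label hm _ ?_
        rw [h2]
        change e ∈ o.level _
        exact ⟨h3.le, by omega⟩
      · have h3 : o.node (o.tgt e) = 0 := h1
        have h4 := o.lt e
        omega
    obtain ⟨i, h1⟩ := key a m hm x ha hx
    obtain ⟨i', h1'⟩ := key a' m' hm' x' ha' hx'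
    obtain ⟨e, j⟩ := a
    obtain ⟨e', j'⟩ := a'
    obtain rfl : j = false := i
    obtain rfl : j' = false := i'
    rw [← (tupleOf q).nodeOf_eq_orbit ((tupleOf q).perm_mem_nodeGroup 0),
      IsTwistedFactorisation.nodeOf_eq_self rfl rfl]
    change o.src e = o.src e' ↔ ((tupleOf q).perm 0).SameCycle x x'
    rw [hq.perm_eq 0 (Nat.zero_le _), ← (hq.isLabelled 0 (Nat.zero_le _)).sameCycle, h1, h1']
    exact ⟨o.src_inj e e' ha, fun h => congrArg _ h⟩
  obtain rfl | hlb := hlb.eq_or_lt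
  · have key : ∀ (a : D.E × Bool) (m : ℕ) (hm : m ≤ b) (x : Pts n),
        o.node (o.endpoint a) = b + 1 → (stateAt q m hm).2 x = a.1 →
        a.2 = true ∧ (stateAt q b le_rfl).2 x = a.1 := by
      rintro ⟨e, _ | _⟩ m hm x h1 h2
      · have h3 : o.node (o.src e) = b + 1 := h1
        have h4 := o.lt e
        have h5 := o.node_le (o.tgt e)
        omega
      · refine ⟨rfl, ?_⟩
        have h3 : o.node (o.tgt e) = b + 1 := h1
        have h4 := o.lt e
        rw [← h2]
        refine hq.label_eq_label hm _ ?_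
        rw [h2]
        change e ∈ o.level _
        exact ⟨by omega, by omega⟩
    obtain ⟨i, h1⟩ := key a m hm x ha hx
    obtain ⟨i', h1'⟩ := key a' m' hm' x' ha' hx'
    obtain ⟨e, j⟩ := a
    obtain ⟨e', j'⟩ := a'
    obtain rfl : j = true := i
    obtain rfl : j' = true := i'
    rw [← (tupleOf q).nodeOf_eq_orbit ((tupleOf q).perm_mem_nodeGroup (b + 1)),
      IsTwistedFactorisation.nodeOf_eq_self IsTwistedFactorisation.etaAt_last rfl]
    change o.tgt e = o.tgt e' ↔ ((tupleOf q).perm (b + 1)).SameCycle x x'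
    rw [IsTwistedFactorisation.perm_last, hq.perm_eq b le_rfl,
      ← (hq.isLabelled b le_rfl).sameCycle, h1, h1']
    exact ⟨o.tgt_inj e e' ha, fun h => congrArg _ h⟩
  obtain ⟨i, rfl⟩ : ∃ i, l = i + 1 := ⟨l - 1, by omega⟩
  have hi : i < b := by omega
  -- Transitions compare incoming labels only. A half-edge that leaves the vertex is therefore
  -- replaced by the incoming one that carries the same point.
  have key : ∀ (a : D.E × Bool) (m : ℕ) (hm : m ≤ b) (x : Pts n),
      o.node (o.endpoint a) = i + 1 → (stateAt q m hm).2 x = a.1 →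
      (stateAt q i hi.le).2 x ∈ (o.nodeData i).In ∧
        o.tgt ((stateAt q i hi.le).2 x) = o.endpoint a := by
    rintro ⟨e, _ | _⟩ m hm x h1 h2
    · have h3 : o.node (o.src e) = i + 1 := h1
      have h4 := o.lt e
      have h5 : (stateAt q (i + 1) hi).2 x = e := by
        rw [← show (stateAt q m hm).2 x = e from h2]
        refine hq.label_eq_label hm _ ?_
        rw [h2]
        change e ∈ o.level _
        exact ⟨h3.le, by omega⟩
      have h6 := (hq.isTransition i hi).tgt_eq x (by rw [h5]; exact h3)
      exact ⟨h6.1, h6.2.trans (congrArg o.src h5)⟩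
    · have h3 : o.node (o.tgt e) = i + 1 := h1
      have h4 := o.lt e
      have h5 : (stateAt q i hi.le).2 x = e := by
        rw [← show (stateAt q m hm).2 x = e from h2]
        refine hq.label_eq_label hm _ ?_
        rw [h2]
        change e ∈ o.level _
        exact ⟨by omega, by omega⟩
      rw [h5]
      exact ⟨h3, rfl⟩
  obtain ⟨h1, h2⟩ := key a m hm x ha hx
  obtain ⟨h1', h2'⟩ := key a' m' hm' x' ha' hx'
  rw [← h2, ← h2', ← hq.localGroup_eq i hi]
  exact (hq.isTransition i hi).orbit x x' h1 h1'

end IsPath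

end IsTwistedTropicalCover

end CoverData

end

/-! ### Labelled factorisations satisfy the conditions on factorisations -/

section

open PermTuple CoverData

namespace CoverData

namespace IsTwistedTropicalCover

namespace IsPath

variable {D : CoverData.{u, v}} {n b g : ℕ} {μ ν : n.Partition} {p : Fin b → ℝ}
  {hD : D.IsTwistedTropicalCover g μ ν p} {hn : 0 < n} {o : D.Orientation p}
  {q : (Fin (b + 1) → Equiv.Perm (Pts n) × (Pts n → D.E)) × (Fin b → Equiv.Perm (Pts n))}
  (hq : hD.IsPath hn o q)
include hq

/-- This is connectedness of the graph. Points on edges with a common vertex are in one orbit of the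
node group there, which lies in the generated group, and any two points are linked by walking along
the edges. -/
theorem isPretransitive : MulAction.IsPretransitive
    (Subgroup.closure ({(tupleOf q).σ₁, (tupleOf q).σ₂} ∪ Set.range (tupleOf q).η ∪
      Set.range fun i => tau n * (tupleOf q).η i * tau n)) (Pts n) := by
  set G := Subgroup.closure ({(tupleOf q).σ₁, (tupleOf q).σ₂} ∪ Set.range (tupleOf q).η ∪
      Set.range fun i => tau n * (tupleOf q).η i * tau n) with hG
  have hσ : (tupleOf q).σ₁ ∈ G := Subgroup.subset_closure (by simp)
  have hη : ∀ i, (tupleOf q).η i ∈ G := fun i => Subgroup.subset_closure (by simp)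
  have hτ : ∀ i, tau n * (tupleOf q).η i * tau n ∈ G := fun i =>
    Subgroup.subset_closure (Or.inr ⟨i, rfl⟩)
  have hη' : ∀ l, (tupleOf q).etaAt l ∈ G ∧ tau n * (tupleOf q).etaAt l * tau n ∈ G := by
    intro l
    have h1 : tau n * 1 * tau n ∈ G := by
      rw [mul_one, tau_mul_tau]
      exact one_mem G
    cases l with
    | zero => exact ⟨one_mem G, h1⟩
    | succ l =>
      by_cases hl : l < b
      · rw [show (tupleOf q).etaAt (l + 1) = _ from (tupleOf q).etaAt_succ ⟨l, hl⟩]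
        exact ⟨hη _, hτ _⟩
      · rw [show (tupleOf q).etaAt (l + 1) = 1 by simp [etaAt, hl]]
        exact ⟨one_mem G, h1⟩
  have hperm : ∀ m, (tupleOf q).perm m ∈ G := by
    intro m
    induction m with
    | zero => exact hσ
    | succ m ih =>
      rw [perm]
      exact mul_mem (mul_mem (hη' _).1 ih) (hη' _).2
  have hle : ∀ l, (tupleOf q).nodeGroup l ≤ G := by
    intro l
    refine (Subgroup.closure_le _).2 ?_
    rintro γ (rfl | rfl | rfl)
    · exact hperm l
    · exact (hη' l).1
    · exact (hη' l).2
  have horb : ∀ (a a' : D.E × Bool) (m m' : ℕ) (hm : m ≤ b) (hm' : m' ≤ b) (x x' : Pts n),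
      (stateAt q m hm).2 x = a.1 → (stateAt q m' hm').2 x' = a'.1 →
      o.endpoint a = o.endpoint a' → ∃ γ : G, γ • x = x' := by
    intro a a' m m' hm hm' x x' hx hx' haa
    obtain ⟨⟨γ, hγ⟩, h⟩ := (hq.endpoint_eq_iff hm hm' rfl (by rw [haa]) hx hx').1 haa
    exact ⟨⟨γ, hle _ hγ⟩, h⟩
  have hex : ∀ e : D.E, ∃ (m : ℕ) (hm : m ≤ b) (x : Pts n), (stateAt q m hm).2 x = e := by
    intro e
    have h1 := o.lt e
    have h2 := o.node_le (o.tgt e)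
    have h3 : o.node (o.src e) ≤ b := by omega
    exact ⟨_, h3, hq.exists_label_eq h3 ⟨le_rfl, h1⟩⟩
  have hstep : ∀ v w : D.V, Relation.ReflTransGen D.Adj v w → ∀ (a a' : D.E × Bool) (m m' : ℕ)
      (hm : m ≤ b) (hm' : m' ≤ b) (x x' : Pts n), (stateAt q m hm).2 x = a.1 →
      (stateAt q m' hm').2 x' = a'.1 → o.endpoint a = v → o.endpoint a' = w →
      ∃ γ : G, γ • x = x' := by
    intro v w hvw
    induction hvw with
    | refl =>
      intro a a' m m' hm hm' x x' hx hx' ha ha'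
      exact horb a a' m m' hm hm' x x' hx hx' (ha.trans ha'.symm)
    | tail _ hadj ih =>
      intro a a' m m' hm hm' x x' hx hx' ha ha'
      obtain ⟨e, he⟩ := hadj
      obtain ⟨k, hk, z, hz⟩ := hex e
      rw [o.ends, Sym2.eq_iff] at he
      obtain ⟨i, j, hi, hj⟩ : ∃ i j, o.endpoint (e, i) = _ ∧ o.endpoint (e, j) = _ := by
        rcases he with ⟨h1, h2⟩ | ⟨h1, h2⟩
        · exact ⟨false, true, h1, h2⟩
        · exact ⟨true, false, h2, h1⟩
      obtain ⟨γ, hγ⟩ := ih a (e, i) m k hm hk x z hx hz ha hi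
      obtain ⟨γ', hγ'⟩ := horb (e, j) a' k m' hk hm' z x' hz hx' (hj.trans ha'.symm)
      exact ⟨γ' * γ, by rw [mul_smul, hγ, hγ']⟩
  refine ⟨fun x y => ?_⟩
  exact hstep _ _ (hD.cover.curve.connected _ _) (_, false) (_, false) 0 0 (Nat.zero_le _)
    (Nat.zero_le _) x y rfl rfl rfl rfl

/-- The two cycle types are the weights of the ends over `-∞` and `+∞`; the remaining conditions
come from the labellings and transitions. -/
theorem isTwistedFactorisation : IsTwistedFactorisation g μ ν (tupleOf q) := by
  classical
  have hL := hq.isLabelled 0 (Nat.zero_le _)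
  have hR := hq.isLabelled b le_rfl
  have h1 : (tupleOf q).σ₁.partition.parts = μ.parts + μ.parts := by
    rw [← hD.left_ends, hD.leftWeights_eq o]
    exact hL.partition_parts
  have h2 : (tupleOf q).σ₂.partition.parts = ν.parts + ν.parts := by
    rw [← hD.right_ends, hD.rightWeights_eq o]
    exact hR.partition_parts
  refine ⟨hD.branch_card, hD.b_pos hn, h1, h2, fun i => ?_, fun i h => ?_, ⟨⟨hL.conj, ?_⟩, h1⟩,
    hq.perm_eq b le_rfl, hq.isPretransitive⟩
  · obtain ⟨x, y, hxy, -, he⟩ := (hq.isTransition i i.2).exists_eq_swap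
    exact ⟨x, y, hxy, he⟩
  · obtain ⟨x, y, hxy, hτ, he⟩ := (hq.isTransition i i.2).exists_eq_swap
    change q.2 i = tau n * q.2 i * tau n at h
    change q.2 i = _ at he
    have h3 : tau n * q.2 i * tau n = Equiv.swap (tau n x) (tau n y) := by
      rw [he]
      exact (hD.twistData hn).tau_mul_swap_mul_tau x y
    rw [he] at h h3
    rw [h3] at h
    have h4 : Equiv.swap (tau n x) (tau n y) x ≠ x := by
      rw [← h, Equiv.swap_apply_left]
      exact hxy.symm
    rcases (Equiv.swap_apply_ne_self_iff.1 h4).2 with h5 | h5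
    · exact (hD.twistData hn).tau_ne x h5.symm
    · refine hτ ?_
      rw [h5]
      exact tau_tau n y
  · exact fun c hc => hL.not_tau_conj_cycle_eq_inv hc

end IsPath

end IsTwistedTropicalCover

end CoverData

end

/-! ### The bijection with isomorphisms of covers, and the final count -/

section

open PermTuple CoverData

namespace CoverData

namespace IsTwistedTropicalCover

variable {D : CoverData.{u, v}} {n b g : ℕ} {μ ν : n.Partition} {p : Fin b → ℝ}
  {hD : D.IsTwistedTropicalCover g μ ν p} {hn : 0 < n} {o : D.Orientation p}
  {q : (Fin (b + 1) → Equiv.Perm (Pts n) × (Pts n → D.E)) × (Fin b → Equiv.Perm (Pts n))}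

namespace IsPath

variable (hq : hD.IsPath hn o q) (h : IsTwistedFactorisation g μ ν (tupleOf q))
include hq

/-- Strictly between its ends the cycle is not touched, so the transitions leave its label
unchanged. At its ends it is touched or at infinity, so the label starts and ends over the same
nodes. -/
theorem exists_forall_label_eq (e : (h.toCover p).E) : ∃ d : D.E,
    (∀ (m : ℕ) (hm : m ≤ b) (x : Pts n), (e.1.1 : ℕ) ≤ m → m < e.1.2.1 → x ∈ e.1.2.2 →
      (stateAt q m hm).2 x = d) ∧ o.node (o.src d) = e.1.1 ∧ o.node (o.tgt d) = e.1.2.1 := by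
  have hlt : (e.1.1 : ℕ) < e.1.2.1 := e.2.1
  have hl := e.1.2.1.2
  have hk : (e.1.1 : ℕ) ≤ b := by omega
  obtain ⟨x₀, hx₀⟩ := h.edge_nonempty p e
  have hconst : ∀ (m : ℕ) (hm : m ≤ b) (x : Pts n), (e.1.1 : ℕ) ≤ m → m < e.1.2.1 →
      x ∈ e.1.2.2 → (stateAt q m hm).2 x = (stateAt q _ hk).2 x₀ := by
    intro m hm x h1 h2 hx
    induction m, h1 using Nat.le_induction generalizing x with
    | base =>
      rw [(hq.isLabelled _ hk).sameCycle, ← hq.perm_eq]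
      rw [h.cycle_eq p le_rfl h2 hx₀] at hx
      exact hx.symm
    | succ m h1 ih =>
      have h3 := ih (by omega) x (by omega) hx
      rw [← h3]
      refine (hq.isTransition m hm).eq_of_notMem_In x fun h4 => ?_
      obtain ⟨y, hy, hy'⟩ := ((hq.isTransition m hm).mem_In x).1 h4
      refine e.2.2.2.2.2 (m + 1) (by omega) h2 ⟨y, ?_, ?_⟩
      · rw [h.cycle_eq p h1 (by omega) hx, Set.mem_ofPred_eq, hq.perm_eq m (by omega)]
        exact ((hq.isLabelled m (by omega)).sameCycle _ _).1 hy.symm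
      · rw [show (tupleOf q).etaAt (m + 1) = q.2 ⟨m, hm⟩ from (tupleOf q).etaAt_succ ⟨m, hm⟩]
        exact hy'
  have hmov : ∀ (i : ℕ) (hi : i < b), (tupleOf q).etaAt (i + 1) = q.2 ⟨i, hi⟩ := fun i hi =>
    (tupleOf q).etaAt_succ ⟨i, hi⟩
  refine ⟨(stateAt q _ hk).2 x₀, hconst, ?_, ?_⟩
  · have hmem := (hq.isLabelled _ hk).mem x₀
    obtain h0 | ⟨i, hi⟩ : (e.1.1 : ℕ) = 0 ∨ ∃ i, (e.1.1 : ℕ) = i + 1 := by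
      rcases Nat.eq_zero_or_pos (e.1.1 : ℕ) with h0 | h0
      · exact Or.inl h0
      · exact Or.inr ⟨e.1.1 - 1, by omega⟩
    · have := hmem.1
      omega
    · have hib : i < b := by omega
      have hT : (tupleOf q).Touched (i + 1) e.1.2.2 := by
        have h1 := e.2.2.2.1.resolve_left (by omega)
        rwa [hi] at h1
      obtain ⟨y, hy, hy'⟩ := hT
      rw [hmov i hib] at hy'
      have h1 : (stateAt q (i + 1) hib).2 x₀ ∈ (o.nodeData i).Out :=
        ((hq.isTransition i hib).mem_Out x₀).2 ⟨y, by
          rw [hconst (i + 1) hib y (by omega) (by omega) hy,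
            hconst (i + 1) hib x₀ (by omega) (by omega) hx₀], hy'⟩
      rw [hconst (i + 1) hib x₀ (by omega) (by omega) hx₀] at h1
      have h1 : o.node (o.src _) = i + 1 := h1
      omega
  · obtain h0 | h0 : (e.1.2.1 : ℕ) = b + 1 ∨ (e.1.2.1 : ℕ) ≤ b := by omega
    · have h1 := (hq.isLabelled b le_rfl).mem x₀
      rw [hconst b le_rfl x₀ (by omega) (by omega) hx₀] at h1
      have h2 := h1.2
      have h3 := o.node_le (o.tgt ((stateAt q _ hk).2 x₀))
      omega
    · obtain ⟨i, hi⟩ : ∃ i, (e.1.2.1 : ℕ) = i + 1 := ⟨e.1.2.1 - 1, by omega⟩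
      have hib : i < b := by omega
      have hT : (tupleOf q).Touched (i + 1) e.1.2.2 := by
        have h1 := e.2.2.2.2.1.resolve_left (by omega)
        rwa [hi] at h1
      obtain ⟨y, hy, hy'⟩ := hT
      rw [hmov i hib] at hy'
      have h1 : (stateAt q i hib.le).2 x₀ ∈ (o.nodeData i).In :=
        ((hq.isTransition i hib).mem_In x₀).2 ⟨y, by
          rw [hconst i hib.le y (by omega) (by omega) hy,
            hconst i hib.le x₀ (by omega) (by omega) hx₀], hy'⟩
      rw [hconst i hib.le x₀ (by omega) (by omega) hx₀] at h1
      have h1 : o.node (o.tgt _) = i + 1 := h1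
      omega

/-- Sending each edge to its constant label is a bijection. It respects incidence because in both
graphs two half-edges over the same node meet exactly when their points lie in one orbit of the node
group. -/
theorem exists_iso : ∃ φ : (h.toCover p).Iso D, ∀ (m : ℕ) (hm : m ≤ b) (x : Pts n),
    φ.onE (h.edgeAt p m hm x) = (stateAt q m hm).2 x := by
  choose f hf hsrc htgt using hq.exists_forall_label_eq h
  have hfe : ∀ (m : ℕ) (hm : m ≤ b) (x : Pts n),
      f (h.edgeAt p m hm x) = (stateAt q m hm).2 x := fun m hm x =>
    (hf _ m hm x (h.edgeAt_left_le p m hm x) (h.lt_edgeAt_right p m hm x)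
      (h.mem_edgeAt p m hm x)).symm
  have hleft : ∀ e : (h.toCover p).E, (e.1.1 : ℕ) ≤ b := fun e => by
    have h1 : (e.1.1 : ℕ) < e.1.2.1 := e.2.1
    have := e.1.2.1.2
    omega
  have hbij : Function.Bijective f := by
    constructor
    · intro e e' hee
      have h1 : (e.1.1 : ℕ) = e'.1.1 := by rw [← hsrc, ← hsrc, hee]
      obtain ⟨x, hx⟩ := h.edge_nonempty p e
      obtain ⟨x', hx'⟩ := h.edge_nonempty p e'
      have hlt : (e.1.1 : ℕ) < e.1.2.1 := e.2.1
      have hlt' : (e'.1.1 : ℕ) < e'.1.2.1 := e'.2.1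
      have h2 := hf e _ (hleft e) x le_rfl hlt hx
      have h3 := hf e' _ (hleft e) x' h1.ge (by omega) hx'
      rw [← hee, ← h2, (hq.isLabelled _ (hleft e)).sameCycle, ← hq.perm_eq] at h3
      refine h.edge_unique p le_rfl hlt h1.ge (by omega) hx ?_
      rw [h.cycle_eq p h1.ge (by omega) hx']
      exact h3
    · intro d
      have h1 := o.lt d
      have h2 := o.node_le (o.tgt d)
      have h3 : o.node (o.src d) ≤ b := by omega
      obtain ⟨x, hx⟩ := hq.exists_label_eq h3 ⟨le_rfl, h1⟩
      exact ⟨h.edgeAt p _ h3 x, (hfe _ h3 x).trans hx⟩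
  have hw : ∀ e, D.weight (f e) = (h.toCover p).weight e := by
    intro e
    obtain ⟨x, hx⟩ := h.edge_nonempty p e
    have hlt : (e.1.1 : ℕ) < e.1.2.1 := e.2.1
    have hL := hq.isLabelled _ (hleft e)
    have h1 := hf e _ (hleft e) x le_rfl hlt hx
    refine (hL.ncard (f e) (h1 ▸ hL.mem x)).symm.trans ?_
    change _ = e.1.2.2.ncard
    rw [h.cycle_eq p le_rfl hlt hx, hq.perm_eq _ (hleft e), ← h1]
    congr 1
    ext y
    exact (hL.sameCycle y x).trans Equiv.Perm.sameCycle_comm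
  have hinv : ∀ e, D.invE (f e) = f ((h.toCover p).invE e) := by
    intro e
    obtain ⟨x, hx⟩ := h.edge_nonempty p e
    have hlt : (e.1.1 : ℕ) < e.1.2.1 := e.2.1
    have h1 := hf e _ (hleft e) x le_rfl hlt hx
    have h2 := hf ((h.toCover p).invE e) _ (hleft e) (tau n x) le_rfl hlt
      (show tau n x ∈ tau n '' _ from ⟨x, hx, rfl⟩)
    rw [← h1, ← h2]
    exact ((hq.isLabelled _ (hleft e)).tau x).symm
  have hnode : ∀ a : (h.toCover p).E × Bool, o.node (o.endpoint (f a.1, a.2)) =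
      (h.orientation p).node ((h.orientation p).endpoint a) := by
    rintro ⟨e, _ | _⟩
    · exact hsrc e
    · exact htgt e
  have horb : ∀ (a : (h.toCover p).E × Bool) (x : Pts n), x ∈ a.1.1.2.2 →
      ((h.orientation p).endpoint a).1.2 = MulAction.orbit
        ((tupleOf q).nodeGroup ((h.orientation p).node ((h.orientation p).endpoint a))) x := by
    rintro ⟨e, _ | _⟩ x hx
    · exact h.nodeOf_left p hx
    · exact h.nodeOf_right p hx
  obtain ⟨φ, hφ⟩ := (h.orientation p).exists_iso o hD.branch_strictMono
    (h.toCover_isInvolution p) hD.involution (Equiv.ofBijective f hbij) hw hinv hnode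
    fun a a' => by
      change _ ↔ o.endpoint (f a.1, a.2) = o.endpoint (f a'.1, a'.2)
      by_cases hna : (h.orientation p).node ((h.orientation p).endpoint a) =
          (h.orientation p).node ((h.orientation p).endpoint a')
      · obtain ⟨x, hx⟩ := h.edge_nonempty p a.1
        obtain ⟨x', hx'⟩ := h.edge_nonempty p a'.1
        have h1 := hf a.1 _ (hleft a.1) x le_rfl a.1.2.1 hx
        have h1' := hf a'.1 _ (hleft a'.1) x' le_rfl a'.1.2.1 hx'
        have h2 := horb a x hx
        have h2' := horb a' x' hx'
        rw [hq.endpoint_eq_iff (a := (f a.1, a.2)) (a' := (f a'.1, a'.2)) (hleft a.1)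
          (hleft a'.1) (hnode a) ((hnode a').trans hna.symm) h1 h1', ← MulAction.orbit_eq_iff,
          ← h2]
        rw [← hna] at h2'
        rw [← h2']
        constructor
        · intro h3
          rw [h3]
        · intro h3
          exact Subtype.ext (Prod.ext (Fin.ext hna) h3.symm)
      · refine iff_of_false (fun h3 => hna (by rw [h3])) fun h3 => hna ?_
        rw [← hnode, ← hnode, h3]
  exact ⟨φ, fun m hm x => (by rw [hφ]; exact hfe m hm x)⟩

end IsPath

/-- The isomorphisms from covers of factorisations to `D` correspond to the labelled
factorisations. -/
theorem bijective_pathOf (hD : D.IsTwistedTropicalCover g μ ν p) (hn : 0 < n)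
    (o : D.Orientation p) : Function.Bijective
      fun s : (Σ t : {t : PermTuple n b // IsTwistedFactorisation g μ ν t},
        (t.2.toCover p).Iso D) =>
      (⟨pathOf s.1.2 s.2, hD.isPath_pathOf hn o s.1.2 s.2⟩ : {q // hD.IsPath hn o q}) := by
  constructor
  · rintro ⟨⟨t, h⟩, φ⟩ ⟨⟨t', h'⟩, φ'⟩ heq
    have heq : pathOf h φ = pathOf h' φ' := congrArg Subtype.val heq
    have hη : t.η = t'.η := congrArg Prod.snd heq
    have hfst : ∀ i, (pathOf h φ).1 i = (pathOf h' φ').1 i := fun i => by rw [heq]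
    obtain rfl : t = t' := by
      refine PermTuple.ext (congrArg Prod.fst (hfst 0)) hη ?_
      -- The path records `σ₂` as its last permutation.
      rw [← h.prod_eq, ← h'.prod_eq]
      exact congrArg Prod.fst (hfst (Fin.last b))
    have hE : φ.onE = φ'.onE := by
      refine Equiv.ext fun e => ?_
      obtain ⟨x, hx⟩ := h.edge_nonempty p e
      have h1 : (e.1.1 : ℕ) < e.1.2.1 := e.2.1
      have h2 := e.1.2.1.2
      have h3 : (e.1.1 : ℕ) ≤ b := by omega
      rw [h.eq_edgeAt p le_rfl h1 h3 hx]
      exact congrFun (congrArg Prod.snd (hfst ⟨e.1.1, by omega⟩)) x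
    obtain rfl : φ = φ' := (h.orientation p).iso_ext hD.branch_strictMono hE o
    rfl
  · rintro ⟨q, hq⟩
    have h := hq.isTwistedFactorisation
    obtain ⟨φ, hφ⟩ := hq.exists_iso h
    refine ⟨⟨⟨tupleOf q, h⟩, φ⟩, Subtype.ext (Prod.ext (funext fun i => ?_) rfl)⟩
    have hi : (i : ℕ) ≤ b := Nat.lt_succ_iff.1 i.2
    exact Prod.ext (hq.perm_eq i hi) (funext fun x => hφ i hi x)

/-- Once an isomorphism `c t` from the cover of `t` to `D` is fixed, every other one differs from it
by a unique automorphism. So each such `t` underlies as many paths as `D` has automorphisms. -/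
theorem ncard_mul_card_aut (hD : D.IsTwistedTropicalCover g μ ν p) (hn : 0 < n)
    (o : D.Orientation p) :
    {t : PermTuple n b | ∃ h : IsTwistedFactorisation g μ ν t,
      Nonempty ((h.toCover p).Iso D)}.ncard * Nat.card D.Aut =
        Nat.card {q // hD.IsPath hn o q} := by
  rw [← Nat.card_congr (Equiv.ofBijective _ (hD.bijective_pathOf hn o)), ← Nat.card_coe_set_eq,
    ← Nat.card_prod]
  have hex : ∀ t : {t : PermTuple n b | ∃ h : IsTwistedFactorisation g μ ν t,
      Nonempty ((h.toCover p).Iso D)}, Nonempty ((t.2.choose.toCover p).Iso D) :=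
    fun t => t.2.choose_spec
  let c := fun t => (hex t).some
  refine Nat.card_congr (Equiv.ofBijective (fun s => ⟨⟨s.1.1, s.1.2.choose⟩,
    (c s.1).equivAut.symm s.2⟩) ⟨?_, ?_⟩)
  · rintro ⟨⟨t, ht⟩, α⟩ ⟨⟨t', ht'⟩, α'⟩ heq
    obtain rfl : t = t' := congrArg (fun s => s.1.1) heq
    have h1 := eq_of_heq (Sigma.mk.inj heq).2
    exact Prod.ext rfl (Equiv.injective _ h1)
  · rintro ⟨⟨t, h⟩, φ⟩
    refine ⟨(⟨t, h, ⟨φ⟩⟩, (c ⟨t, h, ⟨φ⟩⟩).equivAut φ), ?_⟩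
    simp

end IsTwistedTropicalCover

end CoverData

end

open Classical in
/-- The number of twisted factorisations whose associated cover is isomorphic to `(π, ι)`. -/
theorem proposition4 {n b g : ℕ} (hn : 0 < n) (μ ν : n.Partition) (p : Fin b → ℝ)
    (D : CoverData.{u, v}) (hD : D.IsTwistedTropicalCover g μ ν p) :
    (({t : PermTuple n b | ∃ h : IsTwistedFactorisation g μ ν t,
        Nonempty ((h.toCover p).Iso D)}.ncard : ℕ) : ℚ) =
      (Nat.doubleFactorial (2 * n) : ℚ) * 2 ^ b *
        (∏ x : D.V with D.valence x = 4, ((D.vertexWeight x : ℚ) - 1)) *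
        (∏ e : D.QuotEdge with CoverData.quotLength hD.involution e ≠ ⊤,
          (CoverData.quotWeight hD.involution e : ℚ)) /
        (Nat.card D.Aut : ℚ) := by
  obtain ⟨o⟩ := hD.exists_orientation hn
  obtain ⟨R, hR⟩ := (hD.twistData hn).exists_isTransversal
  have h1 := (hD.ncard_mul_card_aut hn o).trans (hD.card_isPath hn o hR)
  rw [← hD.prod_quotEdge hn hR] at h1
  have h2 : (Nat.card D.Aut : ℚ) ≠ 0 := Nat.cast_ne_zero.2 Nat.card_pos.ne'
  -- The truncated subtraction agrees with the rational one because vertex weights are positive.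
  have h3 : ((∏ x : D.V with D.valence x = 4, (D.vertexWeight x - 1) : ℕ) : ℚ) =
      ∏ x : D.V with D.valence x = 4, ((D.vertexWeight x : ℚ) - 1) := by
    rw [Nat.cast_prod]
    exact Finset.prod_congr rfl fun x _ => Nat.cast_pred (hD.vertexWeight_pos hn x)
  rw [eq_div_iff h2, ← h3]
  exact_mod_cast h1
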